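/- Let $K$ be a field and let $q\in K$ be nonzero and not a root of unity. For positive integers $m,n$ let $\mathcal O_q(M(m,n))$ be the $K$-algebra generated by $x_{ij}$ $(1\le i\le m,\ 1\le j\le n)$ with relations $$x_{ij}x_{il}=q\,x_{il}x_{ij}\ (j<l),\qquad x_{ij}x_{kj}=q\,x_{kj}x_{ij}\ (i<k),$$ $$x_{ij}x_{kl}=x_{kl}x_{ij}\ (k<i,\ j<l),\qquad x_{ij}x_{kl}-x_{kl}x_{ij}=(q-q^{-1})x_{il}x_{kj}\ (i<k,\ j<l).$$ Let $1<k$ and $2k\le n$, and put $p=n-k$. For a $k$-element set $J=\{j_1<\dots<j_k\}\subseteq\{1,\dots,n\}$ let $$[J]=\sum_{s\in S_k}(-q)^{\ell(s)}x_{1j_{s(1)}}\cdots x_{kj_{s(k)}}\in\mathcal O_q(M(k,n)),$$ where $\ell(s)$ is the number of inversions of $s$, and let $\mathcal O_q(G(k,n))$ be the $K$-subalgebra of $\mathcal O_q(M(k,n))$ generated by all the $[J]$. Put $[u]=[1,\dots,k]$ and $[w]=[n-k+1,\dots,n]$. Let $\rho$ be a $K$-algebra automorphism of $\mathcal O_q(G(k,n))$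 with $\rho([u])=[u]$ and $\rho([w])=[w]$. Then the powers of $[u]$ form an Ore set in $\mathcal O_q(G(k,n))$, the canonical map from $\mathcal O_q(G(k,n))$ to the Ore localization $T=\mathcal O_q(G(k,n))[[u]^{-1}]$ is injective, and $T=\mathcal O_q(M(k,p))[y^{\pm1};\sigma]$ in the following sense. Put $y=[u]\in T$. There are a $K$-algebra automorphism $\sigma$ of $\mathcal O_q(M(k,p))$ with $\sigma(x_{ij})=q\,x_{ij}$ and a $K$-algebra homomorphism $\mathcal O_q(M(k,p))\to T$ with $$x_{ij}\mapsto[\{1,\dots,k\}\setminus\{k+1-i\}\cup\{k+j\}]\,[u]^{-1}\qquad(1\le i\le k,\ 1\le j\le p);$$ writing $r$ also for the image in $T$ of $r\in\mathcal O_q(M(k,p))$, one has $yr=\sigma(r)y$ for all $r$, and every element of $T$ is uniquely a finite sum $\sum_{s\in\mathbb Z}r_sy^s$ with $r_s\in\mathcal O_q(M(k,p))$. In particular, $\mathcal O_q(M(k,p))$ is identified with a subalgebra of $T$. Moreover, $\rho$ extends uniquely to a $K$-algebra automorphism $\rho$ of $T$, and this extension satisfies $\rho(y)=y$ and $\rho(\mathcal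 O_q(M(k,p)))=\mathcal O_q(M(k,p))$. -/

import Mathlib

open scoped BigOperators

noncomputable section

namespace QGrass

variable {K : Type*} [Field K]

/-- The defining relations of the algebra of `m × n` quantum matrices, on the free algebra
with generators `x (i, j)`. -/
inductive QMatRel (q : K) (m n : ℕ) :
    FreeAlgebra K (Fin m × Fin n) → FreeAlgebra K (Fin m × Fin n) → Prop
  | row (i : Fin m) (j l : Fin n) (hjl : j < l) :
      QMatRel q m n
        (FreeAlgebra.ι K (i, j) * FreeAlgebra.ι K (i, l))
        (q • (FreeAlgebra.ι K (i, l) * FreeAlgebra.ι K (i, j)))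
  | col (i k : Fin m) (j : Fin n) (hik : i < k) :
      QMatRel q m n
        (FreeAlgebra.ι K (i, j) * FreeAlgebra.ι K (k, j))
        (q • (FreeAlgebra.ι K (k, j) * FreeAlgebra.ι K (i, j)))
  | anti (i k : Fin m) (j l : Fin n) (hki : k < i) (hjl : j < l) :
      QMatRel q m n
        (FreeAlgebra.ι K (i, j) * FreeAlgebra.ι K (k, l))
        (FreeAlgebra.ι K (k, l) * FreeAlgebra.ι K (i, j))
  | diag (i k : Fin m) (j l : Fin n) (hik : i < k) (hjl : j < l) :
      QMatRel q m n
        (FreeAlgebra.ι K (i, j) * FreeAlgebra.ι K (k, l) -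
          FreeAlgebra.ι K (k, l) * FreeAlgebra.ι K (i, j))
        ((q - q⁻¹) • (FreeAlgebra.ι K (i, l) * FreeAlgebra.ι K (k, j)))

/-- The quantum matrix algebra `O_q(M(m,n))`. -/
def QMat (q : K) (m n : ℕ) : Type _ := RingQuot (QMatRel q m n)

instance (q : K) (m n : ℕ) : Ring (QMat q m n) :=
  inferInstanceAs (Ring (RingQuot (QMatRel q m n)))

instance (q : K) (m n : ℕ) : Algebra K (QMat q m n) :=
  inferInstanceAs (Algebra K (RingQuot (QMatRel q m n)))

/-- The generator `x_{ij}` of `O_q(M(m,n))` (rows and columns are numbered from `0`). -/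
def QMat.X (q : K) {m n : ℕ} (i : Fin m) (j : Fin n) : QMat q m n :=
  (RingQuot.mkAlgHom K (QMatRel q m n) (FreeAlgebra.ι K (i, j)) : RingQuot (QMatRel q m n))

/-- The length of a permutation, i.e. its number of inversions. -/
def permLength {t : ℕ} (s : Equiv.Perm (Fin t)) : ℕ :=
  (Finset.univ.filter fun p : Fin t × Fin t => p.1 < p.2 ∧ s p.2 < s p.1).card

/-- The quantum determinant `∑_s (-q)^{ℓ(s)} f_{1 s(1)} ⋯ f_{t s(t)}` (factors in this order)
of a `t × t` array of elements. -/
def qDet {A : Type*} [Ring A] [Algebra K A] (q : K) {t : ℕ} (f : Fin t → Fin t → A) : A :=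
  ∑ s : Equiv.Perm (Fin t), (-q) ^ permLength s • (List.ofFn fun i => f i (s i)).prod

/-- The maximal quantum minor `[1 ⋯ k | J]` of `O_q(M(k,n))`, for a `k`-element set `J` of
columns. -/
def maxMinor (q : K) {k n : ℕ} (J : Finset (Fin n)) (hJ : J.card = k) : QMat q k n :=
  qDet q fun i j => QMat.X q i (J.orderEmbOfFin hJ j)

/-- The quantum grassmannian `O_q(G(k,n))`: the subalgebra of `O_q(M(k,n))` generated by the
maximal quantum minors. -/
def grass (q : K) (k n : ℕ) : Subalgebra K (QMat q k n) :=
  Algebra.adjoin K {a | ∃ (J : Finset (Fin n)) (hJ : J.card = k), a = maxMinor q J hJ}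

/-- The quantum Plücker coordinate `[J]`. -/
def plucker (q : K) {k n : ℕ} (J : Finset (Fin n)) (hJ : J.card = k) : grass q k n :=
  ⟨maxMinor q J hJ, Algebra.subset_adjoin ⟨J, hJ, rfl⟩⟩

/-- The set `{1, …, k}` of the first `k` columns. -/
def firstCols (k n : ℕ) : Finset (Fin n) := Finset.univ.filter fun c => (c : ℕ) < k

/-- The set `{n-k+1, …, n}` of the last `k` columns. -/
def lastCols (k n : ℕ) : Finset (Fin n) := Finset.univ.filter fun c => n - k ≤ (c : ℕ)

/-- The column numbered `k + j`, for `j` a column of a `k × (n-k)` matrix. -/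
def rightCol {k n : ℕ} (j : Fin (n - k)) : Fin n := ⟨k + j, by omega⟩

/-- The column of a `k × n` matrix with the number of the row `i` counted from the bottom; with
rows and columns numbered from `1` this is `k + 1 - i`. -/
def revCol {k n : ℕ} (hkn : k ≤ n) (i : Fin k) : Fin n := ⟨i.rev, by omega⟩

/-- With rows and columns numbered from `1`, the set `{1, …, k} \ {k+1-i} ∪ {k+j}`. -/
def genCols {k n : ℕ} (hkn : k ≤ n) (i : Fin k) (j : Fin (n - k)) : Finset (Fin n) :=
  insert (rightCol j) ((firstCols k n).erase (revCol hkn i))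

theorem card_firstCols {k n : ℕ} (hkn : k ≤ n) : (firstCols k n).card = k := by
  rw [firstCols, Fin.card_filter_val_lt, min_eq_right hkn]

theorem card_lastCols {k n : ℕ} (hkn : k ≤ n) : (lastCols k n).card = k := by
  have h := Finset.card_filter_add_card_filter_not (s := (Finset.univ : Finset (Fin n)))
    (fun c : Fin n => (c : ℕ) < n - k)
  rw [Fin.card_filter_val_lt, Finset.card_univ, Fintype.card_fin] at h
  have h2 : lastCols k n = Finset.univ.filter fun c : Fin n => ¬ (c : ℕ) < n - k := by
    ext c; simp [lastCols]
  rw [h2]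
  omega

theorem card_genCols {k n : ℕ} (hkn : k ≤ n) (i : Fin k) (j : Fin (n - k)) :
    (genCols hkn i j).card = k := by
  have hi := i.isLt
  rw [genCols, Finset.card_insert_of_notMem, Finset.card_erase_of_mem, card_firstCols hkn]
  · omega
  · simp only [firstCols, revCol, Finset.mem_filter, Finset.mem_univ, true_and]
    exact i.rev.isLt
  · simp [firstCols, rightCol]

/-- The Plücker coordinate `[u]`, `u = {1, …, k}`. -/
def pluckerU (q : K) {k n : ℕ} (hkn : k ≤ n) : grass q k n :=
  plucker q (firstCols k n) (card_firstCols hkn)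

/-- The Plücker coordinate `[w]`, `w = {n-k+1, …, n}`. -/
def pluckerW (q : K) {k n : ℕ} (hkn : k ≤ n) : grass q k n :=
  plucker q (lastCols k n) (card_lastCols hkn)

/-- The multiplicative set `{[u]^s}`. -/
abbrev powersU (q : K) {k n : ℕ} (hkn : k ≤ n) : Submonoid (grass q k n) :=
  Submonoid.powers (pluckerU q hkn)

/-- The Ore localization `O_q(G(k,n))[[u]⁻¹]`. -/
abbrev grassLoc (q : K) {k n : ℕ} (hkn : k ≤ n) [OreLocalization.OreSet (powersU q hkn)] :
    Type _ :=
  OreLocalization (powersU q hkn) (grass q k n)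

/-- The canonical map `O_q(G(k,n)) → O_q(G(k,n))[[u]⁻¹]`. -/
abbrev toLoc (q : K) {k n : ℕ} (hkn : k ≤ n) [OreLocalization.OreSet (powersU q hkn)] :
    grass q k n →+* grassLoc q hkn :=
  OreLocalization.numeratorRingHom

/-- `y = [u]` as a unit of `O_q(G(k,n))[[u]⁻¹]`. -/
def locY (q : K) {k n : ℕ} (hkn : k ≤ n) [OreLocalization.OreSet (powersU q hkn)] :
    (grassLoc q hkn)ˣ :=
  OreLocalization.numeratorUnit
    (⟨pluckerU q hkn, Submonoid.mem_powers _⟩ : powersU q hkn)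

/-- With rows and columns numbered from `1`, the element
`x_{ij} = [1 ⋯ (k+1-i)^ ⋯ k, k+j] [u]⁻¹` of `O_q(G(k,n))[[u]⁻¹]` (hat: entry omitted). -/
def locX (q : K) {k n : ℕ} (hkn : k ≤ n) [OreLocalization.OreSet (powersU q hkn)]
    (i : Fin k) (j : Fin (n - k)) : grassLoc q hkn :=
  toLoc q hkn (plucker q (genCols hkn i j) (card_genCols hkn i j)) *
    ((locY q hkn)⁻¹ : (grassLoc q hkn)ˣ)

/-- `T = R[y^{±1}; σ]`, where `R` is viewed in `T` through `j`: one has `y r = σ(r) y` for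
`r ∈ R`, and every element of `T` is uniquely a finite sum `∑ r_s y^s` with `s ∈ ℤ`, `r_s ∈ R`. -/
structure IsSkewLaurentExtension {R T : Type*} [Ring R] [Algebra K R] [Ring T] [Algebra K T]
    (σ : R ≃ₐ[K] R) (j : R →ₐ[K] T) (y : Tˣ) : Prop where
  skew_comm : ∀ r : R, (y : T) * j r = j (σ r) * (y : T)
  bijective : Function.Bijective fun f : ℤ →₀ R => f.sum fun s r => j r * ((y ^ s : Tˣ) : T)

end QGrass

end

/-!
Write `u` and `w` for the sets of the first and of the last `k` columns, `y = [u]`,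
`R = QMat q k (n - k)` and `T` for the localization at the powers of `y`.

**The rigidity of `R` in `T`.** The elements `y` and `[w]` commute with all Plücker coordinates up to
powers of `q` (`pluckerU_mul_coord`, `pluckerW_mul_coord`), and conjugation with them is a pair of
gradings of `T`. Write `T` as the sum of the `R y ^ s`. Conjugation with `y` is the total degree on
`R`; conjugation with `[w]` is the degree in the last `k` columns on `R`, and it multiplies `y ^ s` by
`q ^ (-k s)`, because `u` and `w` are disjoint for `2 k ≤ n`. The extension of `ρ` to `T` fixes `y` and
`[w]`, so the image of a generator of `R` has the same two degrees as the generator: `1`, and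
`e ∈ {0, 1}`. A component `r y ^ s` of the image thus has `r` of total degree `1`, hence of degree `0`
or `1` in any set of columns (`eq_zero_or_one_of_twist_eq`; this needs that `q` is not a root of
unity), while the degree of `r` in the last columns is `e + k s`. As `1 < k`, this forces `s = 0`
(`mem_range_matHom`), so `ρ` maps `R` into itself, and so does `ρ⁻¹`.

**The structure of `T`.** All four families of relations of quantum matrices are instances of one
exchange relation (`IsQuantum`), which is what makes products of matrices, coactions and block
matrices tractable.

* `QMat q k n` is a domain (`QMat.noZeroDivisors`): it acts on the tensor product of its first column
  and its other columns, which shows that it is free over the other columns on the monomials in the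
  first one, and leading terms multiply well. So `y`, which is a normal element, generates an Ore set.
* The generators `locX` satisfy the relations of `R`. By Cramer's rule (`QMat.cramer`), `[u]` times the
  right block of the generic matrix is the product of the matrix of the minors
  `[u \ {c} ∪ {k + j}]` and the left block; cancelling the left block with the help of the quantum
  adjugate turns the relations of the blocks into relations of the minors (`isRevQuantum_of_cancel`).
* The `R y ^ s` span `T` (`laurentSum_surjective`): quantum Plücker relations express `[u][J]` by
  products of generators and of coordinates `[J']` with `J'` closer to `u` (`exists_exchange`).
* Their sum is direct (`laurentSum_injective`): the factorization of the right block is reversed to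
  let `QMat q k n` act on `R` (`QMat.act`), with the left block acting by triangular matrices. Then
  `[u]` acts invertibly and the elements of `R` by left multiplication up to an automorphism; a
  variable which records the degree in `QMat q k n` separates the `R y ^ s`.
-/

noncomputable section

namespace QGrass

variable {K : Type*} [Field K]

/-! ### The exchange relation of quantum matrices -/

/-- The exchange coefficients of the Hecke `R`-matrix: the operator `e_i ⊗ e_k ↦ e_k ⊗ e_i +
exch q i k • e_i ⊗ e_k` satisfies the braid relation and has eigenvalues `q` and `-q⁻¹`. -/
def exch (q : K) {ι : Type*} [LinearOrder ι] (i k : ι) : K :=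
  if i < k then q - q⁻¹ else if i = k then q - 1 else 0

section exch
variable (q : K) {ι : Type*} [LinearOrder ι]

theorem exch_of_lt {i k : ι} (h : i < k) : exch q i k = q - q⁻¹ := by simp [exch, h]

theorem exch_self (i : ι) : exch q i i = q - 1 := by simp [exch]

theorem exch_of_gt {i k : ι} (h : k < i) : exch q i k = 0 := by
  simp [exch, h.not_gt, h.ne']

theorem exch_rev {m : ℕ} (i k : Fin m) : exch q i.rev k.rev = exch q k i := by
  simp [exch, Fin.rev_lt_rev, eq_comm]

variable {q} in
theorem exch_congr {ι' : Type*} [LinearOrder ι'] {i k : ι} {i' k' : ι'} (hlt : i < k ↔ i' < k')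
    (heq : i = k ↔ i' = k') : exch q i k = exch q i' k' := by
  simp only [exch, hlt, heq]

end exch

variable {A : Type*} [Ring A] [Algebra K A]

/-- A matrix over a `K`-algebra is a quantum matrix if its entries satisfy the defining relations
of `QMat`. All four families of relations are instances of this single exchange relation, which
says that the tensor square of the matrix commutes with the Hecke `R`-matrix. -/
def IsQuantum (q : K) {ι κ : Type*} [LinearOrder ι] [LinearOrder κ] (x : ι → κ → A) : Prop :=
  ∀ i k j l, x k j * x i l - x i l * x k j = (exch q j l - exch q i k) • (x i j * x k l)

section
variable {q : K} {ι κ : Type*} [LinearOrder ι] [LinearOrder κ] {x : ι → κ → A}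

theorem IsQuantum.row (hx : IsQuantum q x) (i : ι) {j l : κ} (h : j < l) :
    x i j * x i l = q • (x i l * x i j) := by
  have := hx i i l j
  rw [exch_of_gt q h, exch_self] at this
  linear_combination (norm := module) -this

theorem IsQuantum.col (hx : IsQuantum q x) {i k : ι} (j : κ) (h : i < k) :
    x i j * x k j = q • (x k j * x i j) := by
  have := hx k i j j
  rw [exch_of_gt q h, exch_self] at this
  linear_combination (norm := module) this

theorem IsQuantum.anti (hx : IsQuantum q x) {i k : ι} {j l : κ} (hki : k < i) (hjl : j < l) :
    x i j * x k l = x k l * x i j := by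
  have := hx k i j l
  rw [exch_of_lt q hki, exch_of_lt q hjl] at this
  linear_combination (norm := module) this

theorem IsQuantum.diag (hx : IsQuantum q x) {i k : ι} {j l : κ} (hik : i < k) (hjl : j < l) :
    x i j * x k l - x k l * x i j = (q - q⁻¹) • (x i l * x k j) := by
  have := hx k i j l
  have h2 := hx i k l j
  rw [exch_of_gt q hik, exch_of_lt q hjl] at this
  rw [exch_of_lt q hik, exch_of_gt q hjl] at h2
  linear_combination (norm := module) -h2

theorem isQuantum_of_relations (hq0 : q ≠ 0)
    (row : ∀ i j l, j < l → x i j * x i l = q • (x i l * x i j))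
    (col : ∀ i k j, i < k → x i j * x k j = q • (x k j * x i j))
    (anti : ∀ i k j l, k < i → j < l → x i j * x k l = x k l * x i j)
    (diag : ∀ i k j l, i < k → j < l →
      x i j * x k l - x k l * x i j = (q - q⁻¹) • (x i l * x k j)) :
    IsQuantum q x := by
  intro i k j l
  rcases lt_trichotomy i k with hik | rfl | hik <;> rcases lt_trichotomy j l with hjl | rfl | hjl
  · rw [exch_of_lt q hik, exch_of_lt q hjl]
    linear_combination (norm := module) anti k i j l hik hjl
  · rw [exch_of_lt q hik, exch_self, col i k j hik, smul_smul]
    match_scalars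
    field_simp
    ring
  · rw [exch_of_lt q hik, exch_of_gt q hjl]
    linear_combination (norm := module) -diag i k l j hik hjl
  · rw [exch_self, exch_of_lt q hjl, row i j l hjl, smul_smul]
    match_scalars
    field_simp
    ring
  · simp [exch_self]
  · rw [exch_self, exch_of_gt q hjl]
    linear_combination (norm := module) -row i l j hjl
  · rw [exch_of_gt q hik, exch_of_lt q hjl]
    linear_combination (norm := module) diag k i j l hik hjl - (q - q⁻¹) • anti i k j l hik hjl
  · rw [exch_of_gt q hik, exch_self]
    linear_combination (norm := module) col k i j hik
  · rw [exch_of_gt q hik, exch_of_gt q hjl]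
    linear_combination (norm := module) -anti i k l j hik hjl

theorem IsQuantum.transpose (hq0 : q ≠ 0) (hx : IsQuantum q x) :
    IsQuantum q fun j i => x i j :=
  isQuantum_of_relations hq0 (fun _ _ _ h => hx.col _ h) (fun _ _ _ h => hx.row _ h)
    (fun _ _ _ _ h1 h2 => (hx.anti h2 h1).symm)
    (fun _ _ _ _ h1 h2 => by rw [hx.diag h2 h1, hx.anti h2 h1])

end

/-- The bilinear form of the fact that products of commuting quantum matrices are quantum matrices:
the array `a` of products of pairs of entries, and likewise `b`, satisfies the exchange relation. -/
theorem exchange_sum_mul {q : K} {ι κ ν : Type*} [LinearOrder ι] [LinearOrder κ] [LinearOrder ν]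
    [Fintype ν] {a : ι → ν → ι → ν → A} {b : ν → κ → ν → κ → A}
    (ha : ∀ i k j l, a k j i l - a i l k j = (exch q j l - exch q i k) • a i j k l)
    (hb : ∀ i k j l, b k j i l - b i l k j = (exch q j l - exch q i k) • b i j k l)
    (i k : ι) (j l : κ) :
    ∑ r, ∑ s, a k r i s * b r j s l - ∑ r, ∑ s, a i r k s * b r l s j =
      (exch q j l - exch q i k) • ∑ r, ∑ s, a i r k s * b r j s l := by
  have h1 : ∑ r, ∑ s, a k r i s * b r j s l =
      ∑ r, ∑ s, (a i r k s * b s j r l +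
        (exch q r s - exch q i k) • (a i r k s * b r j s l)) := by
    simp only [Finset.sum_add_distrib]
    rw [Finset.sum_comm (f := fun r s => a i r k s * b s j r l), ← Finset.sum_add_distrib]
    refine Finset.sum_congr rfl fun r _ => ?_
    rw [← Finset.sum_add_distrib]
    refine Finset.sum_congr rfl fun s _ => ?_
    have := ha i k r s
    rw [sub_eq_iff_eq_add] at this
    rw [this, add_mul, smul_mul_assoc, add_comm]
  rw [h1, Finset.smul_sum, ← Finset.sum_sub_distrib]
  refine Finset.sum_congr rfl fun r _ => ?_
  rw [Finset.smul_sum, ← Finset.sum_sub_distrib]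
  refine Finset.sum_congr rfl fun s _ => ?_
  have := hb r s j l
  rw [sub_eq_iff_eq_add] at this
  rw [this, mul_add, mul_smul_comm]
  module

/-- The product of two quantum matrices whose entries commute with each other is a quantum
matrix. -/
theorem IsQuantum.mul {q : K} {ι κ ν : Type*} [LinearOrder ι] [LinearOrder κ] [LinearOrder ν]
    [Fintype ν] {a : ι → ν → A} {b : ν → κ → A} (ha : IsQuantum q a) (hb : IsQuantum q b)
    (hab : ∀ i r s j, Commute (a i r) (b s j)) :
    IsQuantum q fun i j => ∑ r, a i r * b r j := by
  intro i k j l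
  have expand : ∀ i k j l, (∑ r, a i r * b r j) * (∑ s, a k s * b s l) =
      ∑ r, ∑ s, (a i r * a k s) * (b r j * b s l) := by
    intro i k j l
    simp only [Finset.sum_mul_sum]
    refine Finset.sum_congr rfl fun r _ => Finset.sum_congr rfl fun s _ => ?_
    rw [mul_assoc, ← mul_assoc (b r j), ← (hab k s r j).eq]
    simp only [mul_assoc]
  simp only [expand]
  exact exchange_sum_mul (a := fun i r k s => a i r * a k s) (b := fun r j s l => b r j * b s l)
    ha hb i k j l

/-- Scaling rows and columns by scalars preserves quantum matrices. -/
theorem IsQuantum.smul_row_col {q : K} {ι κ : Type*} [LinearOrder ι] [LinearOrder κ]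
    {x : ι → κ → A} (hx : IsQuantum q x) (c : ι → K) (d : κ → K) :
    IsQuantum q fun i j => (c i * d j) • x i j := by
  intro i k j l
  simp only [smul_mul_smul_comm]
  rw [show c k * d j * (c i * d l) = c i * d j * (c k * d l) by ring,
    show c i * d l * (c k * d j) = c i * d j * (c k * d l) by ring, ← smul_sub, hx i k j l,
    smul_comm]

theorem IsQuantum.submatrix {q : K} {ι κ ι' κ' : Type*} [LinearOrder ι] [LinearOrder κ]
    [LinearOrder ι'] [LinearOrder κ'] {x : ι → κ → A} (hx : IsQuantum q x) {f : ι' → ι}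
    {g : κ' → κ} (hf : StrictMono f) (hg : StrictMono g) :
    IsQuantum q fun i j => x (f i) (g j) := by
  intro i k j l
  have h1 : exch q (f i) (f k) = exch q i k := by
    simp [exch, hf.lt_iff_lt, hf.injective.eq_iff]
  have h2 : exch q (g j) (g l) = exch q j l := by
    simp [exch, hg.lt_iff_lt, hg.injective.eq_iff]
  simpa only [h1, h2] using hx (f i) (f k) (g j) (g l)

theorem IsQuantum.map {q : K} {B : Type*} [Ring B] [Algebra K B] {ι κ : Type*} [LinearOrder ι]
    [LinearOrder κ] {x : ι → κ → A} (hx : IsQuantum q x) (f : A →ₐ[K] B) :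
    IsQuantum q fun i j => f (x i j) := by
  intro i k j l
  rw [← map_mul, ← map_mul, ← map_sub, hx i k j l, map_smul, map_mul]

/-- A matrix split into two column blocks is a quantum matrix as soon as both blocks are and
the entries of the left block `a` and of the right block `y` satisfy the mixed relation. -/
theorem IsQuantum.of_blocks {q : K} {ι κ : Type*} [LinearOrder ι] [LinearOrder κ]
    {x : ι → κ → A} (p : κ → Prop) (hp : ∀ j l, p j → ¬ p l → j < l)
    (haa : ∀ i k j l, p j → p l →
      x k j * x i l - x i l * x k j = (exch q j l - exch q i k) • (x i j * x k l))
    (hyy : ∀ i k j l, ¬ p j → ¬ p l →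
      x k j * x i l - x i l * x k j = (exch q j l - exch q i k) • (x i j * x k l))
    (hay : ∀ i k j l, p j → ¬ p l →
      x i j * x k l = x k l * x i j + exch q i k • (x i l * x k j))
    (hq0 : q ≠ 0) : IsQuantum q x := by
  intro i k j l
  by_cases hj : p j <;> by_cases hl : p l
  · exact haa i k j l hj hl
  · have h1 := hay i k j l hj hl
    have h2 := hay k i j l hj hl
    rw [exch_of_lt q (hp j l hj hl)]
    rcases lt_trichotomy i k with h | rfl | h
    · rw [exch_of_lt q h] at h1 ⊢
      rw [exch_of_gt q h] at h2
      linear_combination (norm := module) h2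
    · rw [exch_self] at h1 h2 ⊢
      have h3 : x i j * x i l = q • (x i l * x i j) := by
        linear_combination (norm := module) h1
      rw [h3, smul_smul]
      match_scalars
      field_simp
      ring
    · rw [exch_of_lt q h] at h2
      rw [exch_of_gt q h] at h1 ⊢
      linear_combination (norm := module) h2 - (q - q⁻¹) • h1
  · have h1 := hay i k l j hl hj
    rw [exch_of_gt q (hp l j hl hj)]
    linear_combination (norm := module) -h1
  · exact hyy i k j l hj hl

/-- The mixed relation between two columns of a quantum matrix. -/
theorem IsQuantum.mixed {q : K} {ι κ : Type*} [LinearOrder ι] [LinearOrder κ]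
    {x : ι → κ → A} (hx : IsQuantum q x) (i k : ι) {j l : κ} (hjl : j < l) :
    x i j * x k l = x k l * x i j + exch q i k • (x i l * x k j) := by
  have := hx i k l j
  rw [exch_of_gt q hjl] at this
  linear_combination (norm := module) -this

/-! ### The algebra of quantum matrices -/

namespace QMat

variable {q : K} {m n : ℕ}

/-- The quotient map from the free algebra. -/
def mk (q : K) (m n : ℕ) : FreeAlgebra K (Fin m × Fin n) →ₐ[K] QMat q m n :=
  RingQuot.mkAlgHom K (QMatRel q m n)

theorem mk_ι (i : Fin m) (j : Fin n) : mk q m n (FreeAlgebra.ι K (i, j)) = X q i j := rfl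

theorem isQuantum_X (hq0 : q ≠ 0) : IsQuantum q (X q : Fin m → Fin n → QMat q m n) := by
  have key : ∀ {a b}, QMatRel q m n a b → mk q m n a = mk q m n b :=
    fun h => RingQuot.mkAlgHom_rel K h
  refine isQuantum_of_relations hq0 ?_ ?_ ?_ ?_
  · intro i j l h
    simpa only [map_mul, map_smul, mk_ι] using key (.row i j l h)
  · intro i k j h
    simpa only [map_mul, map_smul, mk_ι] using key (.col i k j h)
  · intro i k j l h1 h2
    simpa only [map_mul, map_smul, mk_ι] using key (.anti i k j l h1 h2)
  · intro i k j l h1 h2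
    simpa only [map_mul, map_smul, map_sub, mk_ι] using key (.diag i k j l h1 h2)

/-- The algebra homomorphism out of `QMat q m n` determined by a quantum matrix. -/
def lift (f : Fin m → Fin n → A) (hf : IsQuantum q f) : QMat q m n →ₐ[K] A :=
  RingQuot.liftAlgHom K ⟨FreeAlgebra.lift K fun p => f p.1 p.2, by
    intro a b h
    cases h with
    | row i j l h => simpa using hf.row i h
    | col i k j h => simpa using hf.col j h
    | anti i k j l h1 h2 => simpa using hf.anti h1 h2
    | diag i k j l h1 h2 => simpa using hf.diag h1 h2⟩

@[simp]
theorem lift_X (f : Fin m → Fin n → A) (hf : IsQuantum q f) (i : Fin m) (j : Fin n) :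
    lift f hf (X q i j) = f i j := by
  have : lift f hf (X q i j) = FreeAlgebra.lift K (fun p : Fin m × Fin n => f p.1 p.2)
      (FreeAlgebra.ι K (i, j)) := RingQuot.liftAlgHom_mkAlgHom_apply ..
  rw [this, FreeAlgebra.lift_ι_apply]

theorem hom_ext {f g : QMat q m n →ₐ[K] A} (h : ∀ i j, f (X q i j) = g (X q i j)) : f = g := by
  refine RingQuot.ringQuot_ext' (s := QMatRel q m n) K f g ?_
  refine FreeAlgebra.hom_ext ?_
  funext p
  exact h p.1 p.2

theorem adjoin_X : Algebra.adjoin K {a | ∃ i j, a = (X q i j : QMat q m n)} = ⊤ := by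
  set S := Algebra.adjoin K {a | ∃ i j, a = (X q i j : QMat q m n)} with hS
  have hmem : ∀ x : FreeAlgebra K (Fin m × Fin n),
      mk q m n x ∈ S := by
    intro x
    induction x using FreeAlgebra.induction with
    | grade0 r => rw [AlgHom.commutes]; exact S.algebraMap_mem r
    | grade1 p => exact Algebra.subset_adjoin ⟨p.1, p.2, rfl⟩
    | mul a b ha hb => rw [map_mul]; exact S.mul_mem ha hb
    | add a b ha hb => rw [map_add]; exact S.add_mem ha hb
  refine eq_top_iff.2 fun x _ => ?_
  obtain ⟨y, rfl⟩ := RingQuot.mkAlgHom_surjective K (QMatRel q m n) x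
  exact hmem y

theorem induction {P : QMat q m n → Prop} (alg : ∀ r, P (algebraMap K _ r))
    (gen : ∀ i j, P (X q i j)) (mul : ∀ a b, P a → P b → P (a * b))
    (add : ∀ a b, P a → P b → P (a + b)) (a : QMat q m n) : P a := by
  have h : a ∈ Algebra.adjoin K {a | ∃ i j, a = (X q i j : QMat q m n)} := by
    rw [adjoin_X]; trivial
  induction h using Algebra.adjoin_induction with
  | mem x hx => obtain ⟨i, j, rfl⟩ := hx; exact gen i j
  | algebraMap r => exact alg r
  | add a b _ _ ha hb => exact add a b ha hb
  | mul a b _ _ ha hb => exact mul a b ha hb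

/-- The automorphism of `QMat q m n` which multiplies row `i` by the unit `c i` and column `j` by
the unit `d j`. -/
def scale (hq0 : q ≠ 0) (c : Fin m → Kˣ) (d : Fin n → Kˣ) : QMat q m n ≃ₐ[K] QMat q m n :=
  AlgEquiv.ofAlgHom
    (lift _ ((isQuantum_X hq0).smul_row_col (fun i => (c i : K)) fun j => (d j : K)))
    (lift _ ((isQuantum_X hq0).smul_row_col (fun i => ((c i)⁻¹ : Kˣ)) fun j => ((d j)⁻¹ : Kˣ)))
    (hom_ext fun i j => by
      have h : (c i : K)⁻¹ * (d j : K)⁻¹ * ((c i : K) * d j) = 1 := by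
        field_simp
      simp [smul_smul, h])
    (hom_ext fun i j => by
      have h : (c i : K) * d j * ((c i : K)⁻¹ * (d j : K)⁻¹) = 1 := by
        field_simp
      simp [smul_smul, h])

@[simp]
theorem scale_X (hq0 : q ≠ 0) (c : Fin m → Kˣ) (d : Fin n → Kˣ) (i : Fin m) (j : Fin n) :
    scale hq0 c d (X q i j) = ((c i : K) * d j) • X q i j := by
  simp [scale]

instance : Nontrivial (QMat q m n) :=
  (lift (A := K) (fun _ _ => 0) (fun i k j l => by simp)).toRingHom.domain_nontrivial

/-! ### Matrix coactions -/

section Coaction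

variable {ι : Type*} [LinearOrder ι] [Fintype ι]

/-- The entries of an algebra homomorphism from the quantum matrices to matrices over them, as
operators; by `coactOp_mul`, they satisfy a twisted Leibniz rule. -/
def coactOp (f : QMat q m n →ₐ[K] Matrix ι ι (QMat q m n)) (i s : ι) :
    Module.End K (QMat q m n) where
  toFun r := f r i s
  map_add' := by simp
  map_smul' := by simp

variable (f : QMat q m n →ₐ[K] Matrix ι ι (QMat q m n))

theorem coactOp_mul (i s : ι) (a b : QMat q m n) :
    coactOp f i s (a * b) = ∑ u, coactOp f i u a * coactOp f u s b := by
  simp [coactOp, Matrix.mul_apply]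

theorem coactOp_algebraMap (i s : ι) (c : K) :
    coactOp f i s (algebraMap K _ c) = if i = s then algebraMap K _ c else 0 := by
  simp [coactOp, Matrix.algebraMap_matrix_apply]

theorem coactOp_one (i s : ι) : coactOp f i s 1 = if i = s then 1 else 0 := by
  simp [coactOp, Matrix.one_apply]

/-- The exchange relation for the operators `coactOp f i s` can be checked on generators. -/
theorem isQuantum_coactOp
    (h : ∀ b c i k j l, coactOp f k j (coactOp f i l (X q b c)) -
      coactOp f i l (coactOp f k j (X q b c)) =
      (exch q j l - exch q i k) • coactOp f i j (coactOp f k l (X q b c))) :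
    IsQuantum q (coactOp f) := by
  have key : ∀ (r : QMat q m n) (i k j l : ι), coactOp f k j (coactOp f i l r) -
      coactOp f i l (coactOp f k j r) =
      (exch q j l - exch q i k) • coactOp f i j (coactOp f k l r) := by
    intro r
    induction r using QMat.induction with
    | alg c =>
      intro i k j l
      simp only [coactOp_algebraMap]
      by_cases h1 : i = l <;> by_cases h2 : k = j <;> by_cases h3 : k = l <;>
        by_cases h4 : i = j <;> simp_all [coactOp_algebraMap]
    | gen b c => exact h b c
    | mul a b ha hb =>
      intro i k j l
      have expand : ∀ i k j l, coactOp f i j (coactOp f k l (a * b)) =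
          ∑ r, ∑ s, coactOp f i r (coactOp f k s a) * coactOp f r j (coactOp f s l b) := by
        intro i k j l
        rw [coactOp_mul, map_sum, Finset.sum_comm]
        exact Finset.sum_congr rfl fun s _ => coactOp_mul f i j _ _
      rw [expand, expand, expand]
      exact exchange_sum_mul (a := fun i r k s => coactOp f i r (coactOp f k s a))
        (b := fun i r k s => coactOp f i r (coactOp f k s b)) ha hb i k j l
    | add a b ha hb =>
      intro i k j l
      simp only [map_add]
      linear_combination (norm := module) ha i k j l + hb i k j l
  intro i k j l
  ext r
  exact key r i k j l

end Coaction

end QMat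

/-! ### Quantum minors -/

section Minor

variable {A : Type*} [Ring A] [Algebra K A]
variable {ι κ : Type*} [LinearOrder κ]

/-- The quantum minor with list of rows `rs` and set of columns `J`, defined by expansion along
the first row. The rows may come in any order and with repetitions, which makes
`minor_cons_swap` and `minor_cons_eq_zero` expressible. -/
def minor (q : K) (x : ι → κ → A) : List ι → Finset κ → A
  | [], J => if J = ∅ then 1 else 0
  | r :: rs, J => ∑ c ∈ J, (-q) ^ (J.filter (· < c)).card • (x r c * minor q x rs (J.erase c))

variable {q : K} {x : ι → κ → A}

theorem minor_nil (J : Finset κ) : minor q x [] J = if J = ∅ then 1 else 0 := rfl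

theorem minor_cons (r : ι) (rs : List ι) (J : Finset κ) : minor q x (r :: rs) J =
    ∑ c ∈ J, (-q) ^ (J.filter (· < c)).card • (x r c * minor q x rs (J.erase c)) := rfl

variable [LinearOrder ι]

theorem card_filter_lt_erase {J : Finset κ} {a b : κ} (ha : a ∈ J) (h : a < b) :
    (J.filter (· < b)).card = ((J.erase a).filter (· < b)).card + 1 := by
  rw [Finset.filter_erase, Finset.card_erase_add_one]
  simp [ha, h]

theorem filter_lt_erase {J : Finset κ} {a b : κ} (h : ¬ a < b) :
    (J.erase a).filter (· < b) = J.filter (· < b) := by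
  rw [Finset.filter_erase, Finset.erase_eq_of_notMem]
  simp [h]

theorem card_filter_gt_erase {J : Finset κ} {a b : κ} (ha : a ∈ J) (h : b < a) :
    (J.filter (b < ·)).card = ((J.erase a).filter (b < ·)).card + 1 := by
  rw [Finset.filter_erase, Finset.card_erase_add_one]
  simp [ha, h]

theorem filter_gt_erase {J : Finset κ} {a b : κ} (h : ¬ b < a) :
    (J.erase a).filter (b < ·) = J.filter (b < ·) := by
  rw [Finset.filter_erase, Finset.erase_eq_of_notMem]
  simp [h]

theorem sum_sum_erase_comm {M : Type*} [AddCommMonoid M] (J : Finset κ) (F : κ → κ → M) :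
    ∑ a ∈ J, ∑ b ∈ J.erase a, F a b = ∑ a ∈ J, ∑ b ∈ J.erase a, F b a := by
  refine Finset.sum_comm' fun a b => ?_
  simp only [Finset.mem_erase]
  tauto

theorem sum_sum_erase_eq {M : Type*} [AddCommMonoid M] (J : Finset κ) (F : κ → κ → M) :
    ∑ a ∈ J, ∑ b ∈ J.erase a, F a b =
      ∑ a ∈ J, ∑ b ∈ J.filter (a < ·), (F a b + F b a) := by
  have h1 : ∀ a ∈ J, ∑ b ∈ J.erase a, F a b =
      ∑ b ∈ J.filter (a < ·), F a b + ∑ b ∈ J.filter (· < a), F a b := by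
    intro a _
    rw [← Finset.sum_union]
    · congr 1
      ext b
      simp only [Finset.mem_erase, Finset.mem_union, Finset.mem_filter]
      constructor
      · rintro ⟨h1, h2⟩
        rcases lt_or_gt_of_ne h1 with h | h <;> simp [h, h2]
      · rintro (⟨h1, h2⟩ | ⟨h1, h2⟩)
        exacts [⟨h2.ne', h1⟩, ⟨h2.ne, h1⟩]
    · exact Finset.disjoint_filter.2 fun b _ h => h.not_gt
  rw [Finset.sum_congr rfl h1, Finset.sum_add_distrib]
  simp only [Finset.sum_add_distrib]
  congr 1
  refine Finset.sum_comm' fun a b => ?_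
  simp only [Finset.mem_filter]
  tauto

omit [LinearOrder ι] in
/-- Expansion of a quantum minor along its last row. -/
theorem minor_concat (rs : List ι) (r : ι) (J : Finset κ) : minor q x (rs ++ [r]) J =
    ∑ c ∈ J, (-q) ^ (J.filter (c < ·)).card • (minor q x rs (J.erase c) * x r c) := by
  induction rs generalizing J with
  | nil =>
    rw [List.nil_append, minor_cons]
    refine Finset.sum_congr rfl fun c hc => ?_
    rw [minor_nil]
    split_ifs with h
    · obtain rfl : J = {c} := by
        rw [← Finset.insert_erase hc, h]; rfl
      simp [Finset.filter_singleton]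
    · simp
  | cons r0 rs ih =>
    rw [List.cons_append, minor_cons]
    have h1 : ∀ c ∈ J, (-q) ^ (J.filter (· < c)).card •
        (x r0 c * minor q x (rs ++ [r]) (J.erase c)) = ∑ d ∈ J.erase c,
        (-q) ^ ((J.filter (· < c)).card + ((J.erase c).filter (d < ·)).card) •
          (x r0 c * minor q x rs ((J.erase c).erase d) * x r d) := by
      intro c _
      rw [ih, Finset.mul_sum, Finset.smul_sum]
      refine Finset.sum_congr rfl fun d _ => ?_
      rw [mul_smul_comm, smul_smul, pow_add, mul_assoc]
    have h2 : ∀ c ∈ J, (-q) ^ (J.filter (c < ·)).card •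
        (minor q x (r0 :: rs) (J.erase c) * x r c) = ∑ d ∈ J.erase c,
        (-q) ^ ((J.filter (c < ·)).card + ((J.erase c).filter (· < d)).card) •
          (x r0 d * minor q x rs ((J.erase c).erase d) * x r c) := by
      intro c _
      rw [minor_cons, Finset.sum_mul, Finset.smul_sum]
      refine Finset.sum_congr rfl fun d _ => ?_
      rw [smul_mul_assoc, smul_smul, pow_add]
    rw [Finset.sum_congr rfl h1, Finset.sum_congr rfl h2, sum_sum_erase_comm]
    refine Finset.sum_congr rfl fun c hc => Finset.sum_congr rfl fun d hd => ?_
    rw [Finset.erase_right_comm]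
    congr 2
    rcases lt_or_gt_of_ne (Finset.ne_of_mem_erase hd) with h | h
    · rw [filter_lt_erase h.not_gt, filter_gt_erase h.not_gt, add_comm]
    · rw [card_filter_gt_erase (Finset.mem_of_mem_erase hd) h, card_filter_lt_erase hc h]
      ring

omit [LinearOrder ι] in
/-- Expansion of a quantum minor along its first two rows, with the two orders of a pair of columns
collected into a `2 × 2` quantum minor. -/
theorem minor_cons_cons (r r' : ι) (L : List ι) (J : Finset κ) : minor q x (r :: r' :: L) J =
    ∑ a ∈ J, ∑ b ∈ J.filter (a < ·),
      (-q) ^ ((J.filter (· < a)).card + ((J.erase a).filter (· < b)).card) •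
        ((x r a * x r' b - q • (x r b * x r' a)) * minor q x L ((J.erase a).erase b)) := by
  rw [minor_cons]
  have h1 : ∀ a ∈ J, (-q) ^ (J.filter (· < a)).card •
      (x r a * minor q x (r' :: L) (J.erase a)) = ∑ b ∈ J.erase a,
      (-q) ^ ((J.filter (· < a)).card + ((J.erase a).filter (· < b)).card) •
        (x r a * x r' b * minor q x L ((J.erase a).erase b)) := by
    intro a _
    rw [minor_cons, Finset.mul_sum, Finset.smul_sum]
    refine Finset.sum_congr rfl fun d _ => ?_
    rw [mul_smul_comm, smul_smul, pow_add, mul_assoc]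
  rw [Finset.sum_congr rfl h1, sum_sum_erase_eq]
  refine Finset.sum_congr rfl fun a ha => Finset.sum_congr rfl fun b hb => ?_
  rw [Finset.mem_filter] at hb
  rw [filter_lt_erase hb.2.not_gt, card_filter_lt_erase ha hb.2, Finset.erase_right_comm (a := b)]
  rw [sub_mul, smul_mul_assoc]
  simp only [pow_add]
  module

/-- Quantum antisymmetry in the first two rows. -/
theorem minor_cons_swap (hx : IsQuantum q x) (hq0 : q ≠ 0) {r r' : ι} (h : r < r') (L : List ι)
    (J : Finset κ) : minor q x (r' :: r :: L) J = (-q) • minor q x (r :: r' :: L) J := by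
  rw [minor_cons_cons, minor_cons_cons]
  simp only [Finset.smul_sum]
  refine Finset.sum_congr rfl fun a ha => Finset.sum_congr rfl fun b hb => ?_
  rw [Finset.mem_filter] at hb
  rw [smul_comm (-q)]
  congr 1
  have h1 := hx.diag h hb.2
  rw [sub_eq_iff_eq_add] at h1
  rw [hx.anti h hb.2, h1]
  simp only [smul_mul_assoc, sub_mul, add_mul]
  match_scalars
  · field_simp
    ring
  · ring

theorem minor_cons_cons_self (hx : IsQuantum q x) (r : ι) (L : List ι) (J : Finset κ) :
    minor q x (r :: r :: L) J = 0 := by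
  rw [minor_cons_cons]
  refine Finset.sum_eq_zero fun a ha => Finset.sum_eq_zero fun b hb => ?_
  rw [Finset.mem_filter] at hb
  rw [hx.row r hb.2, sub_self, zero_mul, smul_zero]

omit [LinearOrder ι] in
theorem minor_cons_congr {r : ι} {L L' : List ι} {t : K}
    (h : ∀ J, minor q x L J = t • minor q x L' J) (J : Finset κ) :
    minor q x (r :: L) J = t • minor q x (r :: L') J := by
  rw [minor_cons, minor_cons, Finset.smul_sum]
  refine Finset.sum_congr rfl fun c _ => ?_
  rw [h, mul_smul_comm, smul_comm]

/-- A quantum minor vanishes if its first row is repeated. -/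
theorem minor_cons_eq_zero (hx : IsQuantum q x) (hq0 : q ≠ 0) {r : ι} {L : List ι} (h : r ∈ L)
    (J : Finset κ) : minor q x (r :: L) J = 0 := by
  induction L generalizing J with
  | nil => simp at h
  | cons a L ih =>
    rcases lt_trichotomy r a with hlt | rfl | hlt
    · have hr : r ∈ L := (List.mem_cons.1 h).resolve_left hlt.ne
      have h0 := minor_cons_congr (q := q) (x := x) (r := a) (L := r :: L) (L' := [])
        (t := 0) (fun J => by rw [ih hr, zero_smul]) J
      rw [minor_cons_swap hx hq0 hlt, zero_smul] at h0
      exact (smul_eq_zero.1 h0).resolve_left (neg_ne_zero.2 hq0)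
    · exact minor_cons_cons_self hx r L J
    · have hr : r ∈ L := (List.mem_cons.1 h).resolve_left hlt.ne'
      rw [minor_cons_swap hx hq0 hlt, minor_cons_congr (L' := []) (t := 0)
        (fun J => by rw [ih hr, zero_smul]) J, zero_smul, smul_zero]

/-- A quantum minor vanishes if its last row is repeated. -/
theorem minor_concat_eq_zero (hx : IsQuantum q x) (hq0 : q ≠ 0) {r : ι} {L : List ι} (h : r ∈ L)
    (J : Finset κ) : minor q x (L ++ [r]) J = 0 := by
  induction L generalizing J with
  | nil => simp at h
  | cons a L ih =>
    rw [List.cons_append]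
    rcases List.mem_cons.1 h with rfl | h
    · exact minor_cons_eq_zero hx hq0 (by simp) J
    · rw [minor_cons_congr (L' := []) (t := 0) (fun J => by rw [ih h, zero_smul]) J, zero_smul]

/-- The last row is moved to the front, past larger rows. -/
theorem minor_concat_of_lt (hx : IsQuantum q x) (hq0 : q ≠ 0) {r : ι} {L : List ι}
    (h : ∀ a ∈ L, r < a) (J : Finset κ) :
    minor q x (L ++ [r]) J = (-q) ^ L.length • minor q x (r :: L) J := by
  induction L generalizing J with
  | nil => simp
  | cons a L ih =>
    rw [List.cons_append, minor_cons_congr (fun J => ih (fun b hb => h b (by simp [hb])) J) J,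
      minor_cons_swap hx hq0 (h a (by simp)), smul_smul, List.length_cons, pow_succ]

/-- The first row is moved into its place. -/
theorem minor_cons_sort (hx : IsQuantum q x) (hq0 : q ≠ 0) (I : Finset ι) {l : ι} (hl : l ∈ I)
    (J : Finset κ) : minor q x (l :: (I.erase l).sort) J =
      (-q) ^ (I.filter (· < l)).card • minor q x I.sort J := by
  induction I using Finset.induction_on_min generalizing J with
  | empty => simp at hl
  | insert r I' hr ih =>
    have hrI : r ∉ I' := fun h => (hr r h).ne rfl
    rw [Finset.sort_insert _ (fun b hb => (hr b hb).le) hrI]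
    rcases Finset.mem_insert.1 hl with rfl | hl'
    · rw [Finset.erase_insert hrI, Finset.filter_eq_empty_iff.2]
      · simp
      · intro a ha
        rcases Finset.mem_insert.1 ha with rfl | ha
        exacts [lt_irrefl _, (hr a ha).not_gt]
    · have hne : r ≠ l := (hr l hl').ne
      rw [Finset.erase_insert_of_ne hne, Finset.sort_insert _
        (fun b hb => (hr b (Finset.mem_of_mem_erase hb)).le) (by simp [hrI]),
        minor_cons_swap hx hq0 (hr l hl'), minor_cons_congr (fun J => ih hl' J) J, smul_smul,
        Finset.filter_insert, if_pos (hr l hl'), Finset.card_insert_of_notMem (by simp [hrI]),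
        pow_succ']

/-- The last row is moved into its place. -/
theorem minor_sort_concat (hx : IsQuantum q x) (hq0 : q ≠ 0) (I : Finset ι) {l : ι} (hl : l ∈ I)
    (J : Finset κ) : minor q x ((I.erase l).sort ++ [l]) J =
      (-q) ^ (I.filter (l < ·)).card • minor q x I.sort J := by
  induction I using Finset.induction_on_min generalizing J with
  | empty => simp at hl
  | insert r I' hr ih =>
    have hrI : r ∉ I' := fun h => (hr r h).ne rfl
    rw [Finset.sort_insert _ (fun b hb => (hr b hb).le) hrI]
    rcases Finset.mem_insert.1 hl with rfl | hl'
    · rw [Finset.erase_insert hrI, minor_concat_of_lt hx hq0 (fun a ha => hr a (by simpa using ha)),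
        Finset.filter_insert, if_neg (lt_irrefl _), Finset.filter_true_of_mem hr,
        Finset.length_sort]
    · have hne : r ≠ l := (hr l hl').ne
      rw [Finset.erase_insert_of_ne hne, Finset.sort_insert _
        (fun b hb => (hr b (Finset.mem_of_mem_erase hb)).le) (by simp [hrI]), List.cons_append,
        minor_cons_congr (fun J => ih hl' J) J, Finset.filter_insert, if_neg (hr l hl').not_gt]

/-- The recursion step for `minor_sort_eq`: the first row and the first column are expanded. -/
theorem minor_expand_row_col {r : ι} {I : Finset ι} (hr : ∀ a ∈ I, r < a) {c₀ : κ}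
    {J : Finset κ} (hc : ∀ a ∈ J, c₀ < a)
    (ih : ∀ c ∈ J, minor q x I.sort (insert c₀ (J.erase c)) =
      minor q (fun j i => x i j) (insert c₀ (J.erase c)).sort I) :
    minor q x (insert r I).sort (insert c₀ J) = x r c₀ * minor q x I.sort J +
      ∑ c ∈ J, ∑ l ∈ I, (-q) ^ ((J.filter (· < c)).card + 1 + (I.filter (· < l)).card) •
        (x r c * x l c₀ * minor q (fun j i => x i j) (J.erase c).sort (I.erase l)) := by
  have hrI : r ∉ I := fun h => (hr r h).ne rfl
  have hcJ : c₀ ∉ J := fun h => (hc c₀ h).ne rfl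
  rw [Finset.sort_insert _ (fun b hb => (hr b hb).le) hrI, minor_cons, Finset.sum_insert hcJ,
    Finset.erase_insert hcJ, Finset.filter_insert, if_neg (lt_irrefl _),
    Finset.filter_false_of_mem (fun a ha => (hc a ha).not_gt)]
  congr 1
  · simp
  refine Finset.sum_congr rfl fun c hcc => ?_
  rw [Finset.erase_insert_of_ne (hc c hcc).ne, ih c hcc, Finset.sort_insert _
    (fun b hb => (hc b (Finset.mem_of_mem_erase hb)).le) (by simp [hcJ]), minor_cons,
    Finset.mul_sum, Finset.smul_sum, Finset.filter_insert, if_pos (hc c hcc),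
    Finset.card_insert_of_notMem (by simp [hcJ])]
  refine Finset.sum_congr rfl fun l _ => ?_
  rw [mul_smul_comm, smul_smul, mul_assoc, ← pow_add]

/-- Row expansion and column expansion define the same quantum minors. -/
theorem minor_sort_eq (hx : IsQuantum q x) (I : Finset ι) (J : Finset κ) (h : I.card = J.card) :
    minor q x I.sort J = minor q (fun j i => x i j) J.sort I := by
  obtain ⟨t, ht⟩ : ∃ t, I.card = t := ⟨_, rfl⟩
  induction t using Nat.strong_induction_on generalizing I J with
  | h t ih =>
  induction I using Finset.induction_on_min with
  | empty =>
    obtain rfl : J = ∅ := by simpa [eq_comm] using h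
    simp [minor_nil]
  | insert r I hr _ =>
  induction J using Finset.induction_on_min with
  | empty => simp at h
  | insert c₀ J hc _ =>
  have hrI : r ∉ I := fun h => (hr r h).ne rfl
  have hcJ : c₀ ∉ J := fun h => (hc c₀ h).ne rfl
  rw [Finset.card_insert_of_notMem hrI] at h ht
  rw [Finset.card_insert_of_notMem hcJ] at h
  have hcard : ∀ c ∈ J, (insert c₀ (J.erase c)).card = J.card := fun c hcc => by
    rw [Finset.card_insert_of_notMem (by simp [hcJ]), Finset.card_erase_add_one hcc]
  have hcard' : ∀ c ∈ I, (insert r (I.erase c)).card = I.card := fun c hcc => by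
    rw [Finset.card_insert_of_notMem (by simp [hrI]), Finset.card_erase_add_one hcc]
  rw [minor_expand_row_col hr hc fun c hcc =>
      ih I.card (by omega) I _ (by have := hcard c hcc; omega) rfl,
    minor_expand_row_col (x := fun j i => x i j) hc hr fun c hcc =>
      (ih I.card (by omega) (insert r (I.erase c)) J (by have := hcard' c hcc; omega)
        (hcard' c hcc)).symm,
    ih I.card (by omega) I J (by omega) rfl, Finset.sum_comm]
  congr 1
  refine Finset.sum_congr rfl fun l hl => Finset.sum_congr rfl fun c hcc => ?_
  have e1 := Finset.card_erase_add_one hl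
  have e2 := Finset.card_erase_add_one hcc
  rw [ih (I.erase l).card (by omega) (I.erase l) (J.erase c) (by omega) rfl,
    hx.anti (hr l hl) (hc c hcc)]
  congr 2
  ring

omit [LinearOrder ι] in
theorem minor_eq_zero_of_card_ne (rs : List ι) (J : Finset κ) (h : rs.length ≠ J.card) :
    minor q x rs J = 0 := by
  induction rs generalizing J with
  | nil =>
    rw [minor_nil, if_neg]
    rintro rfl
    simp at h
  | cons r rs ih =>
    rw [minor_cons]
    refine Finset.sum_eq_zero fun c hc => ?_
    rw [ih, mul_zero, smul_zero]
    have := Finset.card_erase_add_one hc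
    simp at h
    omega

/-! ### Commutation of a quantum minor with matrix entries in its rows -/

/-- An entry lying in one of the rows of a minor and in one of its columns commutes with it. -/
theorem minor_commute (hx : IsQuantum q x) (hq0 : q ≠ 0) {I : Finset ι} {J : Finset κ}
    (hIJ : I.card = J.card) {l : ι} (hl : l ∈ I) {m : κ} (hm : m ∈ J) :
    x l m * minor q x I.sort J = minor q x I.sort J * x l m := by
  have hq0' : -q ≠ 0 := neg_ne_zero.2 hq0
  -- both sides are evaluations of the triple product of matrix, adjugate and matrix
  have key : ∑ i ∈ I, ∑ c ∈ J, ((-q) ^ (J.filter (· < c)).card *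
      ((-q) ^ (I.filter (· < i)).card)⁻¹) •
      (x l c * minor q x (I.erase i).sort (J.erase c) * x i m) =
      minor q x I.sort J * x l m := by
    have : ∀ i ∈ I, ∑ c ∈ J, ((-q) ^ (J.filter (· < c)).card *
      ((-q) ^ (I.filter (· < i)).card)⁻¹) •
      (x l c * minor q x (I.erase i).sort (J.erase c) * x i m) =
      ((-q) ^ (I.filter (· < i)).card)⁻¹ • (minor q x (l :: (I.erase i).sort) J * x i m) := by
      intro i _
      rw [minor_cons, Finset.sum_mul, Finset.smul_sum]
      refine Finset.sum_congr rfl fun c _ => ?_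
      rw [smul_mul_assoc, smul_smul, mul_comm]
    rw [Finset.sum_congr rfl this, Finset.sum_eq_single_of_mem l hl]
    · rw [minor_cons_sort hx hq0 I hl, smul_mul_assoc, smul_smul,
        inv_mul_cancel₀ (pow_ne_zero _ hq0'), one_smul]
    · intro i _ hil
      rw [minor_cons_eq_zero hx hq0, zero_mul, smul_zero]
      simp [hl, hil.symm]
  rw [← key, Finset.sum_comm]
  have hcol : ∀ c ∈ J, ∑ i ∈ I, ((-q) ^ (J.filter (· < c)).card *
      ((-q) ^ (I.filter (· < i)).card)⁻¹) •
      (x l c * minor q x (I.erase i).sort (J.erase c) * x i m) =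
      ((-q) ^ (J.filter (· < c)).card * ((-q) ^ (I.card - 1))⁻¹) •
        (x l c * minor q (fun j i => x i j) ((J.erase c).sort ++ [m]) I) := by
    intro c hc
    rw [minor_concat, Finset.mul_sum, Finset.smul_sum]
    refine Finset.sum_congr rfl fun i hi => ?_
    have e1 := Finset.card_erase_add_one hi
    have e2 := Finset.card_erase_add_one hc
    rw [minor_sort_eq hx _ _ (by omega), mul_smul_comm, smul_smul, mul_assoc (x l c)]
    congr 1
    have e3 : I.card - 1 = (I.filter (· < i)).card + (I.filter (i < ·)).card := by
      have h1 := Finset.card_filter_add_card_filter_not (s := I.erase i) (· < i)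
      rw [Finset.filter_erase, Finset.erase_eq_of_notMem (by simp)] at h1
      have h2 : (I.erase i).filter (fun a => ¬ a < i) = I.filter (i < ·) := by
        ext a
        simp only [Finset.mem_filter, Finset.mem_erase, not_lt]
        constructor
        · rintro ⟨⟨h1, h2⟩, h3⟩
          exact ⟨h2, lt_of_le_of_ne h3 h1.symm⟩
        · rintro ⟨h1, h2⟩
          exact ⟨⟨h2.ne', h1⟩, h2.le⟩
      rw [h2] at h1
      omega
    rw [e3, pow_add]
    field_simp
  rw [Finset.sum_congr rfl hcol, Finset.sum_eq_single_of_mem m hm]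
  · rw [minor_sort_concat (hx.transpose hq0) hq0 J hm, mul_smul_comm, smul_smul,
      ← minor_sort_eq hx I J hIJ]
    have e3 : I.card - 1 = (J.filter (· < m)).card + (J.filter (m < ·)).card := by
      have h1 := Finset.card_filter_add_card_filter_not (s := J.erase m) (· < m)
      rw [Finset.filter_erase, Finset.erase_eq_of_notMem (by simp)] at h1
      have h2 : (J.erase m).filter (fun a => ¬ a < m) = J.filter (m < ·) := by
        ext a
        simp only [Finset.mem_filter, Finset.mem_erase, not_lt]
        constructor
        · rintro ⟨⟨h1, h2⟩, h3⟩
          exact ⟨h2, lt_of_le_of_ne h3 h1.symm⟩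
        · rintro ⟨h1, h2⟩
          exact ⟨⟨h2.ne', h1⟩, h2.le⟩
      have e1 := Finset.card_erase_add_one hm
      rw [h2] at h1
      omega
    rw [e3, pow_add]
    have : (-q) ^ (J.filter (· < m)).card * ((-q) ^ (J.filter (· < m)).card *
        (-q) ^ (J.filter (m < ·)).card)⁻¹ * (-q) ^ (J.filter (m < ·)).card = 1 := by
      field_simp
    rw [this, one_smul]
  · intro c _ hcm
    rw [minor_concat_eq_zero (hx.transpose hq0) hq0, mul_zero, smul_zero]
    simp [hm, hcm.symm]

/-- An entry to the right of a minor, in one of its rows, `q`-commutes with it. -/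
theorem minor_mul_right (hx : IsQuantum q x) (hq0 : q ≠ 0) {rs : List ι}
    (hrs : rs.Pairwise (· < ·)) {i : ι} (hi : i ∈ rs) {m : κ} {J : Finset κ}
    (hm : ∀ c ∈ J, c < m) : minor q x rs J * x i m = q • (x i m * minor q x rs J) := by
  obtain ⟨t, ht⟩ : ∃ t, rs.length = t := ⟨_, rfl⟩
  induction t generalizing rs J with
  | zero => simp_all
  | succ t ih =>
  obtain ⟨r, rs', rfl⟩ := List.exists_cons_of_ne_nil (List.ne_nil_of_mem hi)
  by_cases hi' : i ∈ rs'
  · have hri : r < i := List.rel_of_pairwise_cons hrs hi'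
    -- the correction terms form an expansion of a minor with the repeated row `i`
    have h0 : ∑ c ∈ J, (-q) ^ (J.filter (· < c)).card •
        (x r m * (x i c * minor q x rs' (J.erase c))) = 0 := by
      have := minor_cons_eq_zero hx hq0 hi' J
      rw [minor_cons] at this
      have h1 := congrArg (x r m * ·) this
      simpa only [Finset.mul_sum, mul_smul_comm, mul_zero] using h1
    rw [minor_cons, Finset.sum_mul, Finset.mul_sum, Finset.smul_sum,
      ← add_zero (∑ c ∈ J, q • _), ← smul_zero (q * (q - q⁻¹)), ← h0, Finset.smul_sum,
      ← Finset.sum_add_distrib]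
    refine Finset.sum_congr rfl fun c hc => ?_
    have e1 := ih (J := J.erase c) (List.Pairwise.of_cons hrs) hi'
      (fun d hd => hm d (Finset.mem_of_mem_erase hd)) (by simpa using ht)
    have e2 := hx.diag hri (hm c hc)
    rw [sub_eq_iff_eq_add] at e2
    rw [smul_mul_assoc, mul_assoc, e1, mul_smul_comm, ← mul_assoc, e2, add_mul, smul_mul_assoc,
      mul_smul_comm]
    simp only [mul_assoc]
    module
  · obtain rfl : i = r := (List.mem_cons.1 hi).resolve_right hi'
    rcases List.eq_nil_or_concat rs' with rfl | ⟨L, r, rfl⟩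
    · rw [minor_cons, Finset.sum_mul, Finset.mul_sum, Finset.smul_sum]
      refine Finset.sum_congr rfl fun c hc => ?_
      rw [minor_nil]
      split_ifs with h
      · rw [mul_one, smul_mul_assoc, hx.row i (hm c hc), mul_smul_comm, smul_comm]
      · simp
    · have hir : i < r := List.rel_of_pairwise_cons hrs (by simp)
      have hrs' : (i :: L).Pairwise (· < ·) := by
        refine hrs.sublist ?_
        simp
      rw [List.concat_eq_append, ← List.cons_append, minor_concat, Finset.sum_mul, Finset.mul_sum,
        Finset.smul_sum]
      refine Finset.sum_congr rfl fun c hc => ?_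
      have e1 := ih (J := J.erase c) hrs' (by simp)
        (fun d hd => hm d (Finset.mem_of_mem_erase hd)) (by simpa using ht)
      rw [smul_mul_assoc, mul_assoc, hx.anti hir (hm c hc), ← mul_assoc, e1, smul_mul_assoc,
        mul_smul_comm, smul_comm, mul_assoc]

/-- An entry to the left of a minor, in one of its rows, `q`-commutes with it. -/
theorem minor_mul_left (hx : IsQuantum q x) (hq0 : q ≠ 0) {rs : List ι}
    (hrs : rs.Pairwise (· < ·)) {i : ι} (hi : i ∈ rs) {m : κ} {J : Finset κ}
    (hm : ∀ c ∈ J, m < c) : x i m * minor q x rs J = q • (minor q x rs J * x i m) := by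
  obtain ⟨t, ht⟩ : ∃ t, rs.length = t := ⟨_, rfl⟩
  induction t generalizing rs J with
  | zero => simp_all
  | succ t ih =>
  obtain ⟨r, rs', rfl⟩ := List.exists_cons_of_ne_nil (List.ne_nil_of_mem hi)
  by_cases hi' : i ∈ rs'
  swap
  · obtain rfl : i = r := (List.mem_cons.1 hi).resolve_right hi'
    rcases List.eq_nil_or_concat rs' with rfl | ⟨L, r, rfl⟩
    · rw [minor_cons, Finset.sum_mul, Finset.mul_sum, Finset.smul_sum]
      refine Finset.sum_congr rfl fun c hc => ?_
      rw [minor_nil]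
      split_ifs with h
      · rw [mul_one, mul_smul_comm, hx.row i (hm c hc), smul_mul_assoc, smul_comm]
      · simp
    · have hir : i < r := List.rel_of_pairwise_cons hrs (by simp)
      have hrs' : (i :: L).Pairwise (· < ·) := by
        refine hrs.sublist ?_
        simp
      have h0 : ∑ c ∈ J, (-q) ^ (J.filter (c < ·)).card •
          (minor q x (i :: L) (J.erase c) * x i c * x r m) = 0 := by
        have := minor_concat_eq_zero hx hq0 (r := i) (L := i :: L) (by simp) J
        rw [minor_concat] at this
        have h1 := congrArg (· * x r m) this
        simpa only [Finset.sum_mul, smul_mul_assoc, zero_mul] using h1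
      rw [List.concat_eq_append, ← List.cons_append, minor_concat, Finset.sum_mul, Finset.mul_sum,
        Finset.smul_sum, ← add_zero (∑ c ∈ J, q • _), ← smul_zero (q * (q - q⁻¹)), ← h0,
        Finset.smul_sum, ← Finset.sum_add_distrib]
      refine Finset.sum_congr rfl fun c hc => ?_
      have e1 := ih (J := J.erase c) hrs' (by simp)
        (fun d hd => hm d (Finset.mem_of_mem_erase hd)) (by simpa using ht)
      have e2 := hx.diag hir (hm c hc)
      rw [sub_eq_iff_eq_add] at e2
      rw [mul_smul_comm, ← mul_assoc, e1, smul_mul_assoc, smul_mul_assoc, mul_assoc, e2, mul_add,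
        mul_smul_comm]
      simp only [mul_assoc]
      module
  · have hri : r < i := List.rel_of_pairwise_cons hrs hi'
    rw [minor_cons, Finset.sum_mul, Finset.mul_sum, Finset.smul_sum]
    refine Finset.sum_congr rfl fun c hc => ?_
    have e1 := ih (J := J.erase c) (List.Pairwise.of_cons hrs) hi'
      (fun d hd => hm d (Finset.mem_of_mem_erase hd)) (by simpa using ht)
    rw [mul_smul_comm, ← mul_assoc, hx.anti hri (hm c hc), mul_assoc, e1, mul_smul_comm,
      smul_mul_assoc, smul_comm, mul_assoc]

end Minor

/-! ### The quantum determinant as a quantum minor -/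

section Laplace

variable {A : Type*} [Ring A] [Algebra K A]

/-- The permutation of `Fin (t + 1)` which sends `0` to `c` and is order isomorphic to `s` on the
other points. -/
def permCons {t : ℕ} (c : Fin (t + 1)) (s : Equiv.Perm (Fin t)) : Equiv.Perm (Fin (t + 1)) :=
  (finSuccEquiv' 0).trans ((Equiv.optionCongr s).trans (finSuccEquiv' c).symm)

theorem permCons_zero {t : ℕ} (c : Fin (t + 1)) (s : Equiv.Perm (Fin t)) :
    permCons c s 0 = c := by
  simp [permCons]

theorem permCons_succ {t : ℕ} (c : Fin (t + 1)) (s : Equiv.Perm (Fin t)) (i : Fin t) :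
    permCons c s i.succ = c.succAbove (s i) := by
  have : finSuccEquiv' (0 : Fin (t + 1)) i.succ = some i := by
    rw [← Fin.succAbove_zero_apply, finSuccEquiv'_succAbove]
  simp [permCons, this]

theorem permCons_bijective (t : ℕ) :
    Function.Bijective fun p : Fin (t + 1) × Equiv.Perm (Fin t) => permCons p.1 p.2 := by
  rw [Fintype.bijective_iff_injective_and_card]
  constructor
  · rintro ⟨c, s⟩ ⟨c', s'⟩ h
    have h0 : c = c' := by
      simpa [permCons_zero] using DFunLike.congr_fun h 0
    subst h0
    have : s = s' := by
      ext i
      have := DFunLike.congr_fun h i.succ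
      simp only [permCons_succ, Fin.succAbove_right_inj] at this
      rw [this]
    rw [this]
  · simp [Fintype.card_perm, Nat.factorial_succ]

theorem permLength_permCons {t : ℕ} (c : Fin (t + 1)) (s : Equiv.Perm (Fin t)) :
    permLength (permCons c s) = c + permLength s := by
  have h0 : ∑ j, (if c.succAbove (s j) < c then 1 else 0) = (c : ℕ) := by
    rw [Equiv.sum_comp s (fun j => if c.succAbove j < c then 1 else 0), ← Finset.card_filter]
    have := Fin.card_filter_val_lt (n := t) (m := c)
    rw [min_eq_right (by omega)] at this
    rw [← this]
    congr 1
    ext j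
    simp only [Fin.succAbove_lt_iff_castSucc_lt, Finset.mem_filter, Finset.mem_univ, true_and]
    rfl
  unfold permLength
  rw [Finset.card_filter, Finset.card_filter, Fintype.sum_prod_type, Fintype.sum_prod_type,
    Fin.sum_univ_succ, Fin.sum_univ_succ]
  simp only [permCons_zero, permCons_succ, Fin.succ_pos, true_and, lt_irrefl, false_and,
    if_false, zero_add, h0]
  congr 1
  refine Finset.sum_congr rfl fun i _ => ?_
  rw [Fin.sum_univ_succ]
  simp [permCons_succ, (Fin.strictMono_succAbove c).lt_iff_lt]

/-- Expansion of the quantum determinant along its first row. -/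
theorem qDet_succ (q : K) {t : ℕ} (f : Fin (t + 1) → Fin (t + 1) → A) :
    qDet q f = ∑ c : Fin (t + 1), (-q) ^ (c : ℕ) •
      (f 0 c * qDet q fun i j => f i.succ (c.succAbove j)) := by
  unfold qDet
  rw [← (permCons_bijective t).sum_comp, Fintype.sum_prod_type]
  refine Finset.sum_congr rfl fun c _ => ?_
  rw [Finset.mul_sum, Finset.smul_sum]
  refine Finset.sum_congr rfl fun s _ => ?_
  rw [permLength_permCons, List.ofFn_succ, List.prod_cons, permCons_zero, mul_smul_comm, smul_smul,
    pow_add]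
  simp only [permCons_succ]

theorem qDet_eq_minor (q : K) {ι κ : Type*} [LinearOrder ι] [LinearOrder κ]
    (x : ι → κ → A) {t : ℕ}
    (r : Fin t → ι) (J : Finset κ) (hJ : J.card = t) :
    qDet q (fun i j => x (r i) (J.orderEmbOfFin hJ j)) = minor q x (List.ofFn r) J := by
  induction t generalizing J with
  | zero =>
    rw [List.ofFn_zero, minor_nil, if_pos (Finset.card_eq_zero.1 hJ)]
    simp [qDet, permLength]
  | succ t ih =>
    rw [qDet_succ, List.ofFn_succ, minor_cons, ← Finset.sum_coe_sort J,
      ← (J.orderIsoOfFin hJ).toEquiv.sum_comp]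
    refine Finset.sum_congr rfl fun c _ => ?_
    have hc : ((J.orderIsoOfFin hJ).toEquiv c : κ) = J.orderEmbOfFin hJ c := by simp
    have hmem := Finset.orderEmbOfFin_mem J hJ c
    rw [hc]
    have hcard : (J.erase (J.orderEmbOfFin hJ c)).card = t := by
      rw [Finset.card_erase_of_mem hmem, hJ]; rfl
    rw [← ih (fun i => r i.succ) _ hcard, ← Finset.orderEmbOfFin_unique hcard
      (f := fun j => J.orderEmbOfFin hJ (c.succAbove j))
      (fun j => Finset.mem_erase.2 ⟨fun h => Fin.succAbove_ne c j
        ((J.orderEmbOfFin hJ).injective h), Finset.orderEmbOfFin_mem J hJ _⟩)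
      ((J.orderEmbOfFin hJ).strictMono.comp (Fin.strictMono_succAbove c))]
    congr 2
    have : J.filter (· < J.orderEmbOfFin hJ c) =
        (Finset.univ.filter (· < c)).map (J.orderEmbOfFin hJ).toEmbedding := by
      ext a
      simp only [Finset.mem_filter, Finset.mem_map, Finset.mem_univ, true_and]
      constructor
      · rintro ⟨h1, h2⟩
        rw [← Finset.mem_coe, ← Finset.range_orderEmbOfFin J hJ] at h1
        obtain ⟨d, rfl⟩ := h1
        exact ⟨d, (J.orderEmbOfFin hJ).lt_iff_lt.1 h2, rfl⟩
      · rintro ⟨d, hd, rfl⟩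
        exact ⟨Finset.orderEmbOfFin_mem J hJ d, (J.orderEmbOfFin hJ).lt_iff_lt.2 hd⟩
    rw [this, Finset.card_map]
    exact (min_eq_right c.isLt.le).symm.trans (Fin.card_filter_val_lt (m := c)).symm

theorem maxMinor_eq (q : K) {k n : ℕ} (J : Finset (Fin n)) (hJ : J.card = k) :
    maxMinor q J hJ = minor q (QMat.X q) (Finset.univ : Finset (Fin k)).sort J := by
  rw [Fin.sort_univ, ← List.ofFn_id, maxMinor]
  exact qDet_eq_minor q (QMat.X q) id J hJ

end Laplace

/-! ### Splitting off the first column -/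

open scoped TensorProduct

namespace QMat

variable {q : K} {k n : ℕ}

/-- The matrix of the coaction on the quantum affine space `QMat q k 1` at its generator `b`. -/
def planeCoactMatrix (q : K) (k : ℕ) (b : Fin k) : Matrix (Fin k) (Fin k) (QMat q k 1) :=
  Matrix.of fun i s => (if i = s then X q b 0 else 0) +
    (if s = b then (exch q i b - (q - q⁻¹)) • X q i 0 else 0)

theorem exch_sub_of_lt (q : K) {ι : Type*} [LinearOrder ι] {i k : ι} (h : i < k) :
    exch q i k - (q - q⁻¹) = 0 := by rw [exch_of_lt q h, sub_self]

theorem planeCoactMatrix_mul (b c : Fin k) (i s : Fin k) :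
    (planeCoactMatrix q k b * planeCoactMatrix q k c) i s =
      (if i = s then X q b 0 * X q c 0 else 0) +
      (if s = c then (exch q i c - (q - q⁻¹)) • (X q b 0 * X q i 0) else 0) +
      (if s = b then (exch q i b - (q - q⁻¹)) • (X q i 0 * X q c 0) else 0) +
      (if s = c then ((exch q i b - (q - q⁻¹)) * (exch q b c - (q - q⁻¹))) •
        (X q i 0 * X q b 0) else 0) := by
  simp only [planeCoactMatrix, Matrix.mul_apply, Matrix.of_apply]
  by_cases h : s = c
  · simp only [h, if_true, add_mul, mul_add, Finset.sum_add_distrib, ite_mul, mul_ite, zero_mul,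
      mul_zero, smul_mul_assoc, mul_smul_comm, Finset.sum_ite_eq, Finset.sum_ite_eq',
      Finset.mem_univ, smul_add, smul_ite, smul_zero, smul_smul]
    split_ifs <;> simp_all [mul_comm] <;> abel
  · simp only [h, if_false, add_mul, add_zero, ite_mul, mul_ite, zero_mul, mul_zero,
      smul_mul_assoc, Finset.sum_ite_eq', Finset.mem_univ, if_true]

theorem isQuantum_planeCoactMatrix (hq0 : q ≠ 0) :
    IsQuantum q fun (b : Fin k) (_ : Fin 1) => planeCoactMatrix q k b := by
  refine isQuantum_of_relations hq0 (fun _ _ _ h => absurd h (by simp)) ?_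
    (fun _ _ _ _ _ h => absurd h (by simp)) (fun _ _ _ _ _ h => absurd h (by simp))
  intro b c _ hbc
  have col : ∀ {i k : Fin k}, i < k → X q i (0 : Fin 1) * X q k 0 = q • (X q k 0 * X q i 0) :=
    fun h => (isQuantum_X hq0).col 0 h
  ext a s
  rw [Matrix.smul_apply, planeCoactMatrix_mul, planeCoactMatrix_mul, exch_sub_of_lt q hbc,
    exch_of_gt q hbc]
  have h1 : (exch q a c - (q - q⁻¹)) • (X q b (0 : Fin 1) * X q a 0) =
      q • (exch q a c - (q - q⁻¹)) • (X q a 0 * X q b 0) := by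
    rcases lt_trichotomy a c with h | rfl | h
    · simp [exch_sub_of_lt q h]
    · rw [col hbc, smul_comm]
    · rw [col (hbc.trans h), smul_comm]
  have h2 : (exch q a b - (q - q⁻¹)) • (X q a (0 : Fin 1) * X q c 0) =
      q • (exch q a b - (q - q⁻¹)) • (X q c 0 * X q a 0) +
      q • ((exch q a c - (q - q⁻¹)) * (0 - (q - q⁻¹))) • (X q a 0 * X q c 0) := by
    rcases lt_trichotomy a c with h | rfl | h
    · rw [exch_sub_of_lt q h, col h]
      module
    · rw [exch_of_gt q hbc, exch_self]
      match_scalars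
      field_simp
      ring
    · rw [col h, exch_of_gt q h, exch_of_gt q (hbc.trans h)]
      match_scalars
      field_simp
      ring
  by_cases e1 : s = b
  · subst e1
    simp only [if_true, if_neg hbc.ne, h2]
    split_ifs
    · rw [col hbc]
      module
    · module
  · by_cases e2 : s = c
    · subst e2
      simp only [if_true, if_neg hbc.ne', h1]
      split_ifs
      · rw [col hbc]
        module
      · module
    · simp only [if_neg e1, if_neg e2]
      split_ifs
      · rw [col hbc]
        module
      · module

/-- The coaction on the quantum affine space `QMat q k 1`. Its entries are the operators `L` with
`x_{ij} v = ∑ L_{il}(v) x_{lj}`, by which the entries `x_{ij}` of a column are moved past an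
element `v` of an earlier column. -/
def planeCoact (hq0 : q ≠ 0) : QMat q k 1 →ₐ[K] Matrix (Fin k) (Fin k) (QMat q k 1) :=
  lift _ (isQuantum_planeCoactMatrix hq0)

theorem coactOp_planeCoact_X (hq0 : q ≠ 0) (i s b : Fin k) (c : Fin 1) :
    coactOp (planeCoact hq0) i s (X q b c) = (if i = s then X q b 0 else 0) +
      (if s = b then (exch q i b - (q - q⁻¹)) • X q i 0 else 0) := by
  change planeCoact hq0 (X q b c) i s = _
  rw [planeCoact, lift_X]
  rfl

/-- The identities among the coefficients `d i b` under which the operators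
`v b ↦ δ_{is} v b + δ_{sb} d_{ib} v i` satisfy the exchange relation on the basis vector `v b`; see
`exchange_of_coeff`. -/
structure IsExchangeCoeff (q : K) {ι : Type*} [LinearOrder ι] (b : ι) (d : ι → ι → K) : Prop where
  left : ∀ {i k}, i ≠ k → d i b * d k i = (exch q i b - exch q i k) * d k b
  right : ∀ {i k}, i ≠ k → b ≠ k → -(d k b * d i k) = (exch q b k - exch q i k) * d i b
  right_self : ∀ {i k}, i ≠ k → b = k →
    -(d k b * d i k) = (exch q b k - exch q i k) * (d i b + d k b * d i k)
  off_diag : ∀ {i k}, i ≠ k → b ≠ k → 0 = (exch q k b - exch q i k) * (d k b * d i k)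
  row_left : ∀ {i}, b ≠ i → d i b * d i i = (exch q i b - exch q i i) * (d i b + d i b * d i i)
  row_right : ∀ {i}, b ≠ i → -(d i b * d i i) = (exch q b i - exch q i i) * d i b

set_option maxHeartbeats 1000000 in
-- each identity is checked for all relative orders of the indices
theorem isExchangeCoeff_exch (hq0 : q ≠ 0) {ι : Type*} [LinearOrder ι] (b : ι) :
    IsExchangeCoeff q b fun i k => exch q i k := by
  constructor <;> intros <;> simp only [exch] <;>
    split_ifs <;> first | (exfalso; order) | ring1 | (field_simp; ring1)

set_option maxHeartbeats 1000000 in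
-- each identity is checked for all relative orders of the indices
theorem isExchangeCoeff_exch_sub (hq0 : q ≠ 0) {ι : Type*} [LinearOrder ι] (b : ι) :
    IsExchangeCoeff q b fun i k => exch q i k - (q - q⁻¹) := by
  constructor <;> intros <;> simp only [exch] <;>
    split_ifs <;> first | (exfalso; order) | ring1 | (field_simp; ring1)

theorem smul_congr {K V : Type*} [SMul K V] {s t : K} (h : s = t) (v : V) : s • v = t • v := by
  rw [h]

/-- The exchange relation for the operators `v b ↦ δ_{is} v b + δ_{sb} d_{ib} v i`, with the sums
over the basis vectors written out. -/
theorem exchange_of_coeff {t : ℕ} {V : Type*} [AddCommGroup V] [Module K V] (v : Fin t → V)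
    (b : Fin t) (d : Fin t → Fin t → K)
    (hd : IsExchangeCoeff q b d)
    {F : Fin t → Fin t → Fin t → Fin t → V}
    (form : ∀ i k j l, F k j i l = ((if i = l then 1 else 0) * (if k = j then 1 else 0) : K) • v b +
      ((if i = l then 1 else 0) * (if j = b then 1 else 0) * d k b) • v k +
      ((if l = b then 1 else 0) * (if k = j then 1 else 0) * d i b) • v i +
      ((if l = b then 1 else 0) * (if j = i then 1 else 0) * (d i b * d k i)) • v k)
    (i k j l : Fin t) : F k j i l - F i l k j = (exch q j l - exch q i k) • F i j k l := by
  rw [form, form, form]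
  rcases eq_or_ne i k with rfl | hik
  · by_cases hj : j = i <;> by_cases hl : l = i
    · subst hj hl
      simp only [sub_self]
      module
    · subst hj
      by_cases hb : l = b
      · subst hb
        simp only [if_neg hl, if_neg (Ne.symm hl), if_true]
        linear_combination (norm := module) smul_congr (hd.row_left hl) (v j)
      · simp only [if_neg hl, if_neg (Ne.symm hl), if_neg hb]
        module
    · subst hl
      by_cases hb : j = b
      · subst hb
        simp only [if_neg hj, if_neg (Ne.symm hj), if_true]
        linear_combination (norm := module) smul_congr (hd.row_right hj) (v l)
      · simp only [if_neg hj, if_neg (Ne.symm hj), if_neg hb]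
        module
    · simp only [if_neg hj, if_neg (Ne.symm hj), if_neg hl, if_neg (Ne.symm hl)]
      module
  · by_cases hj : j = i <;> by_cases hl : l = k
    · subst hj hl
      have h1 : l = b → d j b * d l j = 0 := fun h => by
        rw [hd.left hik, ← h, sub_self, zero_mul]
      have h2 : j = b → d l b * d j l = 0 := fun h => by
        rw [← neg_eq_zero, hd.right hik (by rw [← h]; exact hik), ← h, sub_self, zero_mul]
      simp only [sub_self, if_true, if_neg hik, if_neg hik.symm]
      by_cases hl : l = b <;> by_cases hj : j = b
      · exact absurd (hj.trans hl.symm) hik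
      · rw [h1 hl, if_neg hj]
        module
      · rw [h2 hj, if_neg hl]
        module
      · rw [if_neg hj, if_neg hl]
        module
    · subst hj
      simp only [if_true, if_neg hik, if_neg hik.symm, if_neg hl, if_neg (Ne.symm hl)]
      by_cases hb : l = b
      · subst hb
        simp only [if_true]
        linear_combination (norm := module) smul_congr (hd.left hik) (v k)
      · simp only [if_neg hb]
        module
    · subst hl
      simp only [if_true, if_neg hik, if_neg hj, if_neg (Ne.symm hj)]
      by_cases hb : j = b
      · subst hb
        simp only [if_true]
        by_cases hjl : j = l
        · simp only [if_pos hjl, if_pos hjl.symm]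
          linear_combination (norm := module) smul_congr (hd.right_self hik hjl) (v i)
        · simp only [if_neg hjl, if_neg (Ne.symm hjl)]
          linear_combination (norm := module) smul_congr (hd.right hik hjl) (v i)
      · have h1 : ¬ (l = b ∧ j = l) := fun h => hb (h.2.trans h.1)
        by_cases hlb : l = b
        · simp only [if_neg hb, if_neg (fun h => h1 ⟨hlb, h⟩)]
          module
        · simp only [if_neg hb, if_neg hlb]
          module
    · simp only [if_neg hj, if_neg (Ne.symm hj), if_neg hl, if_neg (Ne.symm hl)]
      by_cases hlb : l = b <;> by_cases hjk : j = k
      · subst hlb hjk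
        simp only [if_true]
        linear_combination (norm := module) smul_congr (hd.off_diag hik hl) (v i)
      all_goals
        simp only [hlb, hjk, if_false]
        module

theorem isQuantum_planeCoact (hq0 : q ≠ 0) :
    IsQuantum q (coactOp (planeCoact (q := q) (k := k) hq0)) := by
  refine isQuantum_coactOp _ fun b c i k j l => ?_
  refine exchange_of_coeff (fun b => X q b (0 : Fin 1)) b (fun i k => exch q i k - (q - q⁻¹))
    (isExchangeCoeff_exch_sub hq0 b)
    (F := fun k j i l => coactOp (planeCoact hq0) k j (coactOp (planeCoact hq0) i l (X q b c)))
    ?_ i k j l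
  intro i k j l
  simp only [coactOp_planeCoact_X, map_add, apply_ite (coactOp (planeCoact hq0) k j), map_smul,
    map_zero]
  split_ifs <;> module

end QMat

open scoped TensorProduct

namespace QMat

variable {q : K} {k n : ℕ}

/-- The space on which `QMat q k (n + 1)` acts: quantum affine `k`-space, which carries the first
column, tensored with the quantum matrices formed by the other columns. -/
abbrev ColSpace (q : K) (k n : ℕ) : Type _ := QMat q k 1 ⊗[K] QMat q k n

/-- Operators on the first tensor factor. -/
def onLeft (q : K) (k n : ℕ) :
    Module.End K (QMat q k 1) →ₐ[K] Module.End K (ColSpace q k n) :=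
  Module.End.rTensorAlgHom K (QMat q k 1) (QMat q k n)

/-- Operators on the second tensor factor. -/
def onRight (q : K) (k n : ℕ) :
    Module.End K (QMat q k n) →ₐ[K] Module.End K (ColSpace q k n) :=
  Module.End.lTensorAlgHom K (QMat q k n) (QMat q k 1)

theorem onLeft_tmul (f : Module.End K (QMat q k 1)) (a : QMat q k 1) (b : QMat q k n) :
    onLeft q k n f (a ⊗ₜ b) = f a ⊗ₜ b := rfl

theorem onRight_tmul (f : Module.End K (QMat q k n)) (a : QMat q k 1) (b : QMat q k n) :
    onRight q k n f (a ⊗ₜ b) = a ⊗ₜ f b := rfl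

theorem lmul_apply {A : Type*} [Ring A] [Algebra K A] (a b : A) :
    Algebra.lmul K A a b = a * b := rfl

theorem onLeft_comm_onRight (f : Module.End K (QMat q k 1)) (g : Module.End K (QMat q k n)) :
    Commute (onLeft q k n f) (onRight q k n g) := by
  refine TensorProduct.ext' fun a b => ?_
  simp only [Module.End.mul_apply, onLeft_tmul, onRight_tmul]

/-- The mixed relation between the operators of the coaction and the variables of the quantum affine
space on which they act. -/
theorem planeCoact_mul_X (hq0 : q ≠ 0) (i s b : Fin k) :
    coactOp (planeCoact hq0) i s * Algebra.lmul K (QMat q k 1) (X q b 0) =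
      Algebra.lmul K (QMat q k 1) (X q b 0) * coactOp (planeCoact hq0) i s +
      (exch q i b - (q - q⁻¹)) •
        (Algebra.lmul K (QMat q k 1) (X q i 0) * coactOp (planeCoact hq0) b s) := by
  ext r
  simp only [Module.End.mul_apply, lmul_apply, LinearMap.add_apply,
    LinearMap.smul_apply, coactOp_mul, coactOp_planeCoact_X]
  simp only [add_mul, ite_mul, zero_mul, Finset.sum_add_distrib, Finset.sum_ite_eq,
    Finset.sum_ite_eq', Finset.mem_univ, if_true, smul_mul_assoc]

/-- The action of the entries of a quantum matrix with `n + 1` columns: the first column acts by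
multiplication on the first factor, the others by the coaction on the first factor, followed by
multiplication on the second one. -/
def colMatrix (hq0 : q ≠ 0) (i : Fin k) : Fin (n + 1) → Module.End K (ColSpace q k n) :=
  Fin.cons (onLeft q k n (Algebra.lmul K _ (X q i 0)))
    (fun j => ∑ l, onLeft q k n (coactOp (planeCoact hq0) i l) *
      onRight q k n (Algebra.lmul K _ (X q l j)))

theorem isQuantum_colMatrix (hq0 : q ≠ 0) :
    IsQuantum q (colMatrix (q := q) (k := k) (n := n) hq0) := by
  have hyy : IsQuantum q fun (i : Fin k) (j : Fin n) =>
      ∑ l, onLeft q k n (coactOp (planeCoact hq0) i l) *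
        onRight q k n (Algebra.lmul K _ (X q l j)) :=
    ((isQuantum_planeCoact hq0).map (onLeft q k n)).mul
      (((isQuantum_X hq0).map (Algebra.lmul K _)).map (onRight q k n))
      fun _ _ _ _ => onLeft_comm_onRight _ _
  have hxx : IsQuantum q fun (i : Fin k) (j : Fin 1) =>
      onLeft q k n (Algebra.lmul K _ (X q i j)) :=
    ((isQuantum_X hq0).map (Algebra.lmul K _)).map (onLeft q k n)
  refine IsQuantum.of_blocks (fun j => j = 0) ?_ ?_ ?_ ?_ hq0
  · rintro j l rfl hl
    exact Fin.pos_of_ne_zero hl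
  · rintro i p j l rfl rfl
    have := hxx i p 0 0
    rw [exch_self] at this ⊢
    exact this
  · intro i p j l hj hl
    obtain ⟨j, rfl⟩ := Fin.exists_succ_eq_of_ne_zero hj
    obtain ⟨l, rfl⟩ := Fin.exists_succ_eq_of_ne_zero hl
    have h1 : exch q j.succ l.succ = exch q j l := by
      simp [exch]
    rw [h1]
    exact hyy i p j l
  · intro i p j l hj hl
    subst hj
    obtain ⟨l, rfl⟩ := Fin.exists_succ_eq_of_ne_zero hl
    simp only [colMatrix, Fin.cons_zero, Fin.cons_succ]
    rw [Finset.mul_sum, Finset.sum_mul, Finset.sum_mul, Finset.smul_sum, ← Finset.sum_add_distrib]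
    refine Finset.sum_congr rfl fun t _ => ?_
    rw [mul_assoc _ (onRight q k n _), mul_assoc _ (onRight q k n _),
      ← (onLeft_comm_onRight _ _).eq, ← (onLeft_comm_onRight _ _).eq, ← mul_assoc, ← mul_assoc,
      ← mul_assoc, ← smul_mul_assoc, ← add_mul]
    congr 1
    rw [← map_mul, ← map_mul, ← map_mul, planeCoact_mul_X, planeCoact_mul_X, ← map_smul, ← map_add]
    congr 1
    rcases lt_trichotomy i p with h | rfl | h
    · rw [exch_of_lt q h, exch_of_gt q h]
      module
    · rw [exch_self]
      match_scalars
      · field_simp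
        ring
    · rw [exch_of_lt q h, exch_of_gt q h]
      module

/-- The action of `QMat q k (n + 1)` on `ColSpace q k n`. It shows that the products of an element
of the first column and of an element of the other columns are as independent as they can be; see
`colAction_apply_one`. -/
def colAction (hq0 : q ≠ 0) : QMat q k (n + 1) →ₐ[K] Module.End K (ColSpace q k n) :=
  lift _ (isQuantum_colMatrix hq0)

theorem isQuantum_firstCol (hq0 : q ≠ 0) :
    IsQuantum q fun (i : Fin k) (_ : Fin 1) => (X q i 0 : QMat q k (n + 1)) := by
  intro i k j l
  have := isQuantum_X (n := n + 1) hq0 i k 0 0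
  obtain rfl : j = l := Subsingleton.elim _ _
  rwa [exch_self, ← exch_self q j] at this

/-- The inclusion of the first column. -/
def firstCol (hq0 : q ≠ 0) (k n : ℕ) : QMat q k 1 →ₐ[K] QMat q k (n + 1) :=
  lift _ (isQuantum_firstCol hq0)

/-- The inclusion of the other columns. -/
def otherCols (hq0 : q ≠ 0) (k n : ℕ) : QMat q k n →ₐ[K] QMat q k (n + 1) :=
  lift (fun i j => X q i j.succ)
    ((isQuantum_X hq0).submatrix (f := id) strictMono_id Fin.strictMono_succ)

theorem colAction_otherCols (hq0 : q ≠ 0) (f m : QMat q k n) :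
    colAction hq0 (otherCols hq0 k n f) (1 ⊗ₜ m) = 1 ⊗ₜ (f * m) := by
  induction f using QMat.induction generalizing m with
  | alg c => simp [Algebra.algebraMap_eq_smul_one]
  | gen i j =>
    rw [otherCols, lift_X, colAction, lift_X, colMatrix, Fin.cons_succ, LinearMap.sum_apply]
    rw [Finset.sum_eq_single i]
    · simp [coactOp_one, onLeft_tmul, onRight_tmul]
    · intro b _ hb
      simp [coactOp_one, onLeft_tmul, onRight_tmul, hb.symm]
    · simp
  | mul a b ha hb => rw [map_mul, map_mul, Module.End.mul_apply, hb, ha, mul_assoc]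
  | add a b ha hb => rw [map_add, map_add, LinearMap.add_apply, ha, hb, add_mul,
      TensorProduct.tmul_add]

theorem colAction_firstCol (hq0 : q ≠ 0) (c : QMat q k 1) :
    colAction hq0 (firstCol hq0 k n c) = onLeft q k n (Algebra.lmul K _ c) := by
  have : (colAction hq0).comp (firstCol hq0 k n) =
      (onLeft q k n).comp (Algebra.lmul K (QMat q k 1)) := by
    refine hom_ext fun i j => ?_
    obtain rfl : j = 0 := Subsingleton.elim _ _
    rw [AlgHom.comp_apply, AlgHom.comp_apply, firstCol, lift_X, colAction, lift_X]
    rfl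
  exact DFunLike.congr_fun this c

theorem colAction_apply_one (hq0 : q ≠ 0) (c : QMat q k 1) (f : QMat q k n) :
    colAction hq0 (firstCol hq0 k n c * otherCols hq0 k n f) (1 ⊗ₜ 1) = c ⊗ₜ f := by
  rw [map_mul, Module.End.mul_apply, colAction_otherCols, colAction_firstCol]
  simp [onLeft_tmul]

end QMat

open scoped TensorProduct

/-! ### Ordered monomials in a column -/

section Monomial

variable {A : Type*} [Ring A] [Algebra K A] {q : K}

/-- Exponents of monomials in one column, ordered lexicographically. -/
abbrev Expo (k : ℕ) : Type := Lex (Fin k → ℕ)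

/-- The exponent of the `i`-th variable. -/
def expoSingle {k : ℕ} (i : Fin k) : Expo k := toLex (Pi.single i 1)

/-- The power of `q⁻¹` that arises when the `i`-th variable is moved into its place. -/
def moveCoeff (q : K) {k : ℕ} (i : Fin k) (α : Fin k → ℕ) : K :=
  q⁻¹ ^ ∑ l, if l < i then α l else 0

theorem moveCoeff_ne_zero (hq0 : q ≠ 0) {k : ℕ} (i : Fin k) (α : Fin k → ℕ) :
    moveCoeff q i α ≠ 0 := pow_ne_zero _ (inv_ne_zero hq0)

/-- The ordered monomial with exponent `α`. -/
def orderedMono {k : ℕ} (v : Fin k → A) (α : Fin k → ℕ) : A :=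
  (List.ofFn fun i => v i ^ α i).prod

theorem orderedMono_zero {k : ℕ} (v : Fin k → A) : orderedMono v 0 = 1 := by
  simp [orderedMono]

theorem map_orderedMono {B : Type*} [Ring B] [Algebra K B] (f : A →ₐ[K] B) {k : ℕ}
    (v : Fin k → A) (α : Fin k → ℕ) :
    f (orderedMono v α) = orderedMono (fun i => f (v i)) α := by
  simp only [orderedMono, map_list_prod, List.map_ofFn]
  congr 2
  funext i
  simp

theorem orderedMono_succ {k : ℕ} (v : Fin (k + 1) → A) (α : Fin (k + 1) → ℕ) :
    orderedMono v α = v 0 ^ α 0 * orderedMono (fun i => v i.succ) (fun i => α i.succ) := by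
  simp [orderedMono, List.ofFn_succ]

/-- Multiplication of an ordered monomial by a variable. -/
theorem mul_orderedMono (hq0 : q ≠ 0) {k : ℕ} (v : Fin k → A)
    (hv : ∀ i l, i < l → v i * v l = q • (v l * v i)) (i : Fin k) (α : Fin k → ℕ) :
    v i * orderedMono v α = moveCoeff q i α • orderedMono v (α + Pi.single i 1) := by
  induction k with
  | zero => exact i.elim0
  | succ k ih =>
    rw [orderedMono_succ, orderedMono_succ]
    induction i using Fin.cases with
    | zero =>
      have h : (fun j : Fin k => (α + Pi.single 0 1 : Fin (k + 1) → ℕ) j.succ) =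
          fun j => α j.succ := by
        funext j
        simp
      rw [h, ← mul_assoc, ← pow_succ']
      simp [moveCoeff]
    | succ i =>
      have hpow : ∀ t : ℕ, v i.succ * v 0 ^ t = q⁻¹ ^ t • (v 0 ^ t * v i.succ) := by
        intro t
        induction t with
        | zero => simp
        | succ t iht =>
          have h1 : v i.succ * v 0 = q⁻¹ • (v 0 * v i.succ) := by
            rw [hv 0 i.succ (Fin.succ_pos i), smul_smul, inv_mul_cancel₀ hq0, one_smul]
          rw [pow_succ (v 0), ← mul_assoc, iht, smul_mul_assoc, mul_assoc, h1, mul_smul_comm,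
            smul_smul, ← pow_succ, mul_assoc]
      have h : (fun j : Fin k => (α + Pi.single i.succ 1 : Fin (k + 1) → ℕ) j.succ) =
          (fun j => α j.succ) + Pi.single i 1 := by
        funext j
        by_cases hj : j = i
        · simp [hj]
        · have : j.succ ≠ i.succ := fun h => hj (Fin.succ_injective _ h)
          simp [hj]
      have h2 : moveCoeff q i.succ α = q⁻¹ ^ α 0 * moveCoeff q i fun j => α j.succ := by
        simp [moveCoeff, Fin.sum_univ_succ, pow_add]
      rw [← mul_assoc, hpow, smul_mul_assoc, mul_assoc,
        ih (fun i => v i.succ) (fun i l hil => hv _ _ (Fin.succ_lt_succ_iff.2 hil)) i, h, h2,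
        mul_smul_comm, smul_smul]
      simp

/-- Exponents are built up from `0` by raising one exponent at a time. -/
theorem expo_induction {k : ℕ} {P : (Fin k → ℕ) → Prop} (zero : P 0)
    (step : ∀ i α, P α → P (α + Pi.single i 1)) (α : Fin k → ℕ) : P α := by
  obtain ⟨t, ht⟩ : ∃ t, ∑ i, α i = t := ⟨_, rfl⟩
  induction t generalizing α with
  | zero =>
    have : α = 0 := by
      funext i
      exact (Finset.sum_eq_zero_iff.1 ht) i (Finset.mem_univ i)
    rwa [this]
  | succ t ih =>
    obtain ⟨i, hi⟩ : ∃ i, α i ≠ 0 := by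
      by_contra! h
      simp [h] at ht
    have h1 : α = Function.update α i (α i - 1) + Pi.single i 1 := by
      funext j
      by_cases hj : j = i
      · subst hj
        simp
        omega
      · simp [hj]
    rw [h1]
    refine step i _ (ih _ ?_)
    have h2 := congrArg (fun β : Fin k → ℕ => ∑ i, β i) h1
    simp only [Pi.add_apply, Finset.sum_add_distrib, Finset.sum_pi_single', Finset.mem_univ,
      if_true] at h2
    omega

end Monomial

namespace QMat

variable {q : K} {k n : ℕ}

theorem moveCoeff_add_single (i l : Fin k) (α : Fin k → ℕ) :
    moveCoeff q i (α + Pi.single l 1) = moveCoeff q i α * if l < i then q⁻¹ else 1 := by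
  have : ∑ j, (if j < i then (α + Pi.single l 1 : Fin k → ℕ) j else 0) =
      (∑ j, if j < i then α j else 0) + if l < i then 1 else 0 := by
    have h1 : ∀ j, (if j < i then (α + Pi.single l 1 : Fin k → ℕ) j else 0) =
        (if j < i then α j else 0) + if j = l then (if l < i then 1 else 0) else 0 := by
      intro j
      by_cases hj : j = l
      · subst hj
        by_cases h : j < i <;> simp [h]
      · by_cases h : j < i <;> simp [h, hj]
    simp only [h1, Finset.sum_add_distrib, Finset.sum_ite_eq', Finset.mem_univ, if_true]
  rw [moveCoeff, this, pow_add, moveCoeff]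
  split_ifs <;> simp

/-- The `i`-th variable of quantum affine space, acting on the span of the ordered monomials. -/
def planeOp (q : K) (i : Fin k) : Module.End K (Expo k →₀ K) :=
  Finsupp.linearCombination K fun α =>
    Finsupp.single (α + expoSingle i) (moveCoeff q i (ofLex α))

theorem planeOp_single (i : Fin k) (α : Expo k) : planeOp q i (Finsupp.single α 1) =
    moveCoeff q i (ofLex α) • Finsupp.single (α + expoSingle i) 1 := by
  simp [planeOp]

theorem planeOp_mul (hq0 : q ≠ 0) (i l : Fin k) (h : i < l) :
    planeOp q i * planeOp q l = q • (planeOp q l * planeOp q i) := by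
  refine Finsupp.lhom_ext' fun α => LinearMap.ext_ring ?_
  simp only [LinearMap.comp_apply, Finsupp.lsingle_apply, Module.End.mul_apply,
    LinearMap.smul_apply, planeOp_single, map_smul]
  rw [add_right_comm α]
  have h1 : moveCoeff q i (ofLex (α + expoSingle l)) = moveCoeff q i (ofLex α) := by
    have := moveCoeff_add_single (q := q) i l (ofLex α)
    rw [if_neg h.not_gt, mul_one] at this
    exact this
  have h2 : moveCoeff q l (ofLex (α + expoSingle i)) = moveCoeff q l (ofLex α) * q⁻¹ := by
    have := moveCoeff_add_single (q := q) l i (ofLex α)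
    rw [if_pos h] at this
    exact this
  rw [h1, h2, smul_smul, smul_smul, smul_smul]
  congr 1
  field_simp

theorem isQuantum_planeOp (hq0 : q ≠ 0) :
    IsQuantum q fun (i : Fin k) (_ : Fin 1) => planeOp q i :=
  isQuantum_of_relations hq0 (fun _ _ _ h => absurd h (by simp))
    (fun i l _ h => planeOp_mul hq0 i l h)
    (fun _ _ _ _ _ h => absurd h (by simp)) (fun _ _ _ _ _ h => absurd h (by simp))

/-- The coefficients of an element of quantum affine space on the ordered monomials. -/
def planeCoeff (hq0 : q ≠ 0) : QMat q k 1 →ₗ[K] (Expo k →₀ K) :=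
  LinearMap.applyₗ (Finsupp.single 0 1) ∘ₗ (lift _ (isQuantum_planeOp hq0)).toLinearMap

theorem planeCoeff_orderedMono (hq0 : q ≠ 0) (α : Fin k → ℕ) :
    planeCoeff hq0 (orderedMono (fun i => X q i 0) α) = Finsupp.single (toLex α) 1 := by
  have hmul : ∀ (i : Fin k) (a : QMat q k 1), planeCoeff hq0 (X q i (0 : Fin 1) * a) =
      planeOp q i (planeCoeff hq0 a) := by
    intro i a
    simp [planeCoeff]
  induction α using expo_induction with
  | zero => rw [orderedMono_zero]; simp [planeCoeff]
  | step i α ih =>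
    have h1 := mul_orderedMono (A := QMat q k 1) hq0 (fun i => X q i 0)
      (fun i l h => (isQuantum_X hq0).col 0 h) i α
    have h2 := congrArg (planeCoeff hq0) h1
    rw [hmul, ih, planeOp_single, map_smul] at h2
    exact (smul_right_injective _ (moveCoeff_ne_zero hq0 i α) h2).symm

/-- The element `v^α f` of `QMat q k (n + 1)`, where `v` is the first column and `f` is a
polynomial in the other columns. -/
def colTerm (hq0 : q ≠ 0) (α : Expo k) (f : QMat q k n) : QMat q k (n + 1) :=
  orderedMono (fun i => X q i 0) (ofLex α) * otherCols hq0 k n f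

/-- The coefficients, in the other columns, of an element of `QMat q k (n + 1)` on the ordered
monomials in the first column. -/
def colCoeff (hq0 : q ≠ 0) : QMat q k (n + 1) →ₗ[K] (Expo k →₀ QMat q k n) :=
  (TensorProduct.finsuppScalarLeft K (QMat q k n) (Expo k)).toLinearMap ∘ₗ
    (planeCoeff hq0).rTensor (QMat q k n) ∘ₗ LinearMap.applyₗ (1 ⊗ₜ 1) ∘ₗ
      (colAction hq0).toLinearMap

/-- The elements `v^α f` with different `α` are independent over the other columns. -/
theorem colCoeff_colTerm (hq0 : q ≠ 0) (α : Expo k) (f : QMat q k n) :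
    colCoeff hq0 (colTerm hq0 α f) = Finsupp.single α f := by
  have h1 : orderedMono (fun i => (X q i 0 : QMat q k (n + 1))) (ofLex α) =
      firstCol hq0 k n (orderedMono (fun i => X q i 0) (ofLex α)) := by
    rw [map_orderedMono]
    simp [firstCol]
  have h2 : colAction hq0 (colTerm hq0 α f) (1 ⊗ₜ 1) =
      orderedMono (fun i => X q i 0) (ofLex α) ⊗ₜ f := by
    rw [colTerm, h1, colAction_apply_one]
  simp only [colCoeff, LinearMap.comp_apply, AlgHom.toLinearMap_apply, LinearMap.applyₗ_apply_apply,
    h2, LinearMap.rTensor_tmul, planeCoeff_orderedMono, LinearEquiv.coe_coe]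
  ext β
  rw [TensorProduct.finsuppScalarLeft_apply_tmul, Finsupp.sum_single_index] <;> simp

end QMat

/-! ### Quantum matrix algebras are domains -/

namespace QMat

variable {q : K} {k n : ℕ}

theorem expoSingle_lt {i l : Fin k} (h : i < l) : expoSingle l < expoSingle i := by
  refine ⟨i, fun j hj => ?_, ?_⟩
  · change (Pi.single l 1 : Fin k → ℕ) j = (Pi.single i 1 : Fin k → ℕ) j
    rw [Pi.single_eq_of_ne (hj.trans h).ne, Pi.single_eq_of_ne hj.ne]
  · change (Pi.single l 1 : Fin k → ℕ) i < (Pi.single i 1 : Fin k → ℕ) i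
    rw [Pi.single_eq_of_ne h.ne, Pi.single_eq_same]
    exact one_pos

theorem X_mul_colTerm (hq0 : q ≠ 0) (i : Fin k) (α : Expo k) (f : QMat q k n) :
    X q i 0 * colTerm hq0 α f = moveCoeff q i (ofLex α) • colTerm hq0 (α + expoSingle i) f := by
  rw [colTerm, ← mul_assoc, mul_orderedMono hq0 _ (fun i l h => (isQuantum_X hq0).col 0 h),
    smul_mul_assoc]
  rfl

theorem colTerm_mul (hq0 : q ≠ 0) (α : Expo k) (f g : QMat q k n) :
    colTerm hq0 α f * otherCols hq0 k n g = colTerm hq0 α (f * g) := by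
  rw [colTerm, mul_assoc, ← map_mul, colTerm]

theorem colTerm_zero (hq0 : q ≠ 0) (f : QMat q k n) :
    colTerm hq0 0 f = otherCols hq0 k n f := by
  rw [colTerm]
  exact (congrArg (· * _) (orderedMono_zero _)).trans (one_mul _)

theorem smul_colTerm (hq0 : q ≠ 0) (α : Expo k) (c : K) (f : QMat q k n) :
    c • colTerm hq0 α f = colTerm hq0 α (c • f) := by
  rw [colTerm, colTerm, map_smul, mul_smul_comm]

/-- The span of the `v^α f` with `α < γ`. -/
def colFilt (hq0 : q ≠ 0) (n : ℕ) (γ : Expo k) : Submodule K (QMat q k (n + 1)) :=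
  Submodule.span K {a | ∃ α < γ, ∃ f : QMat q k n, a = colTerm hq0 α f}

theorem colTerm_mem (hq0 : q ≠ 0) {α γ : Expo k} (h : α < γ) (f : QMat q k n) :
    colTerm hq0 α f ∈ colFilt hq0 n γ := Submodule.subset_span ⟨α, h, f, rfl⟩

theorem colFilt_mono (hq0 : q ≠ 0) {γ δ : Expo k} (h : γ ≤ δ) :
    colFilt hq0 n γ ≤ colFilt hq0 n δ :=
  Submodule.span_mono fun _ ⟨α, hα, f, hf⟩ => ⟨α, hα.trans_le h, f, hf⟩

theorem colFilt_mul_otherCols (hq0 : q ≠ 0) {γ : Expo k} {a : QMat q k (n + 1)}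
    (ha : a ∈ colFilt hq0 n γ) (g : QMat q k n) :
    a * otherCols hq0 k n g ∈ colFilt hq0 n γ := by
  induction ha using Submodule.span_induction with
  | mem a h =>
    obtain ⟨α, hα, f, rfl⟩ := h
    rw [colTerm_mul]
    exact colTerm_mem hq0 hα _
  | zero => rw [zero_mul]; exact zero_mem _
  | add a b _ _ ha hb => rw [add_mul]; exact add_mem ha hb
  | smul c a _ ha => rw [smul_mul_assoc]; exact Submodule.smul_mem _ c ha

theorem X_mul_colFilt (hq0 : q ≠ 0) {γ : Expo k} {a : QMat q k (n + 1)}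
    (ha : a ∈ colFilt hq0 n γ) (i : Fin k) :
    X q i 0 * a ∈ colFilt hq0 n (γ + expoSingle i) := by
  induction ha using Submodule.span_induction with
  | mem a h =>
    obtain ⟨α, hα, f, rfl⟩ := h
    rw [X_mul_colTerm]
    exact Submodule.smul_mem _ _ (colTerm_mem hq0 (add_lt_add_left hα _) _)
  | zero => rw [mul_zero]; exact zero_mem _
  | add a b _ _ ha hb => rw [mul_add]; exact add_mem ha hb
  | smul c a _ ha => rw [mul_smul_comm]; exact Submodule.smul_mem _ c ha

theorem colCoeff_colFilt (hq0 : q ≠ 0) {γ : Expo k} {a : QMat q k (n + 1)}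
    (ha : a ∈ colFilt hq0 n γ) : colCoeff hq0 a γ = 0 := by
  induction ha using Submodule.span_induction with
  | mem a h =>
    obtain ⟨α, hα, f, rfl⟩ := h
    rw [colCoeff_colTerm, Finsupp.single_eq_of_ne hα.ne']
  | zero => simp
  | add a b _ _ ha hb => simp [ha, hb]
  | smul c a _ ha => simp [ha]

/-- The automorphism dividing the `i`-th row by `q`. -/
def rowInv (hq0 : q ≠ 0) (i : Fin k) : QMat q k n ≃ₐ[K] QMat q k n :=
  scale hq0 (fun a => if a = i then (Units.mk0 q hq0)⁻¹ else 1) 1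

/-- Moving an element of the other columns past the `i`-th entry of the first column produces, up
to `rowInv`, only terms involving lower entries of the first column. -/
theorem otherCols_mul_X (hq0 : q ≠ 0) (f : QMat q k n) (i : Fin k) :
    otherCols hq0 k n f * X q i 0 - X q i 0 * otherCols hq0 k n (rowInv hq0 i f) ∈
      Submodule.span K {a | ∃ l > i, ∃ g : QMat q k n, a = X q l 0 * otherCols hq0 k n g} := by
  induction f using QMat.induction generalizing i with
  | alg r =>
    rw [AlgEquiv.commutes, AlgHom.commutes, Algebra.commutes, sub_self]
    exact zero_mem _
  | gen a b =>
    have hX := isQuantum_X (m := k) (n := n + 1) hq0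
    have h := hX.mixed i a (Fin.succ_pos b)
    simp only [rowInv, scale_X, Pi.one_apply, Units.val_one, mul_one, map_smul]
    simp only [otherCols, lift_X]
    rcases lt_trichotomy i a with hia | rfl | hia
    · rw [exch_of_lt q hia, ← hX.anti hia (Fin.succ_pos b)] at h
      rw [if_neg hia.ne']
      have h2 : X q a b.succ * X q i 0 - X q i 0 * ((1 : Kˣ) : K) • X q a b.succ =
          -(q - q⁻¹) • (X q a 0 * otherCols hq0 k n (X q i b)) := by
        simp only [otherCols, lift_X]
        rw [Units.val_one, one_smul]
        linear_combination (norm := module) -h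
      rw [h2]
      exact Submodule.smul_mem _ _ (Submodule.subset_span ⟨a, hia, _, rfl⟩)
    · rw [if_pos rfl, mul_smul_comm, hX.row i (Fin.succ_pos b), smul_smul,
        Units.val_inv_eq_inv_val, Units.val_mk0, inv_mul_cancel₀ hq0, one_smul, sub_self]
      exact zero_mem _
    · rw [exch_of_gt q hia, zero_smul, add_zero] at h
      rw [if_neg hia.ne, Units.val_one, one_smul, h, sub_self]
      exact zero_mem _
  | add a b ha hb =>
    simp only [map_add, mul_add, add_mul]
    rw [add_sub_add_comm]
    exact add_mem (ha i) (hb i)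
  | mul a b ha hb =>
    simp only [map_mul]
    set N := Submodule.span K {a | ∃ l > i, ∃ g : QMat q k n, a = X q l 0 * otherCols hq0 k n g}
      with hN
    have h1 : ∀ z ∈ N, ∀ g : QMat q k n, z * otherCols hq0 k n g ∈ N := by
      intro z hz g
      induction hz using Submodule.span_induction with
      | mem z h =>
        obtain ⟨l, hl, f, rfl⟩ := h
        rw [mul_assoc, ← map_mul]
        exact Submodule.subset_span ⟨l, hl, _, rfl⟩
      | zero => rw [zero_mul]; exact zero_mem _
      | add a b _ _ ha hb => rw [add_mul]; exact add_mem ha hb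
      | smul c a _ ha => rw [smul_mul_assoc]; exact Submodule.smul_mem _ c ha
    have h2 : ∀ z ∈ N, otherCols hq0 k n a * z ∈ N := by
      intro z hz
      induction hz using Submodule.span_induction with
      | mem z h =>
        obtain ⟨l, hl, f, rfl⟩ := h
        have h3 : otherCols hq0 k n a * X q l 0 ∈ N := by
          rw [← sub_add_cancel (otherCols hq0 k n a * X q l 0) (X q l 0 * otherCols hq0 k n
            (rowInv hq0 l a))]
          refine add_mem (Submodule.span_mono ?_ (ha l)) (Submodule.subset_span ⟨l, hl, _, rfl⟩)
          rintro _ ⟨m, hm, g, rfl⟩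
          exact ⟨m, hl.trans hm, g, rfl⟩
        rw [← mul_assoc]
        exact h1 _ h3 f
      | zero => rw [mul_zero]; exact zero_mem _
      | add a b _ _ ha hb => rw [mul_add]; exact add_mem ha hb
      | smul c a _ ha => rw [mul_smul_comm]; exact Submodule.smul_mem _ c ha
    have h4 := add_mem (h2 _ (hb i)) (h1 _ (ha i) (rowInv hq0 i b))
    convert h4 using 1
    noncomm_ring

/-- An element of the other columns is moved past a monomial in the first column, up to an
automorphism and modulo smaller monomials. -/
theorem otherCols_mul_orderedMono (hq0 : q ≠ 0) (β : Fin k → ℕ) :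
    ∃ τ : QMat q k n ≃ₐ[K] QMat q k n, ∀ f : QMat q k n,
      otherCols hq0 k n f * orderedMono (fun i => X q i 0) β -
        orderedMono (fun i => X q i 0) β * otherCols hq0 k n (τ f) ∈
        colFilt hq0 n (toLex β) := by
  induction β using expo_induction with
  | zero => exact ⟨AlgEquiv.refl, fun f => by
      rw [orderedMono_zero]; simp⟩
  | step i β ih =>
    obtain ⟨τ, hτ⟩ := ih
    refine ⟨(rowInv hq0 i).trans τ, fun f => ?_⟩
    have hm : ∀ l, X q l 0 * orderedMono (fun i => (X q i 0 : QMat q k (n + 1))) β =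
      moveCoeff q l β • orderedMono (fun i => X q i 0) (β + Pi.single l 1) := fun l =>
        mul_orderedMono hq0 _ (fun i l h => (isQuantum_X hq0).col 0 h) l β
    set M := orderedMono (fun i => (X q i 0 : QMat q k (n + 1))) β with hM
    have hM' : orderedMono (fun i => (X q i 0 : QMat q k (n + 1))) (β + Pi.single i 1) =
        (moveCoeff q i β)⁻¹ • (X q i 0 * M) := by
      rw [hm, smul_smul, inv_mul_cancel₀ (moveCoeff_ne_zero hq0 i β), one_smul]
    have hXF : ∀ l ≥ i, ∀ z ∈ colFilt hq0 n (toLex β),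
        X q l 0 * z ∈ colFilt hq0 n (toLex (β + Pi.single i 1)) := by
      intro l hl z hz
      refine colFilt_mono hq0 ?_ (X_mul_colFilt hq0 hz l)
      change toLex β + expoSingle l ≤ toLex β + expoSingle i
      refine add_le_add_right ?_ _
      rcases hl.lt_or_eq with h | h
      · exact (expoSingle_lt h).le
      · rw [h]
    have h1 : ∀ z ∈ Submodule.span K {a | ∃ l > i, ∃ g : QMat q k n,
        a = X q l 0 * otherCols hq0 k n g}, z * M ∈ colFilt hq0 n (toLex (β + Pi.single i 1)) := by
      intro z hz
      induction hz using Submodule.span_induction with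
      | mem z h =>
        obtain ⟨l, hl, g, rfl⟩ := h
        rw [mul_assoc, ← sub_add_cancel (otherCols hq0 k n g * M) (M * otherCols hq0 k n (τ g)),
          mul_add]
        refine add_mem (hXF l hl.le _ (hτ g)) ?_
        have h2 := X_mul_colTerm hq0 l (toLex β) (τ g)
        rw [colTerm] at h2
        erw [h2]
        refine Submodule.smul_mem _ _ (colTerm_mem hq0 ?_ _)
        exact add_lt_add_right (expoSingle_lt hl) (toLex β)
      | zero => rw [zero_mul]; exact zero_mem _
      | add a b _ _ ha hb => rw [add_mul]; exact add_mem ha hb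
      | smul c a _ ha => rw [smul_mul_assoc]; exact Submodule.smul_mem _ c ha
    have h5 := add_mem (h1 _ (otherCols_mul_X hq0 f i)) (hXF i le_rfl _ (hτ (rowInv hq0 i f)))
    rw [hM', mul_smul_comm, smul_mul_assoc, ← smul_sub]
    refine Submodule.smul_mem _ _ ?_
    convert h5 using 1
    rw [AlgEquiv.trans_apply]
    noncomm_ring

theorem orderedMono_mul (hq0 : q ≠ 0) (α β : Fin k → ℕ) : ∃ c : K, c ≠ 0 ∧
    orderedMono (fun i => (X q i 0 : QMat q k (n + 1))) α * orderedMono (fun i => X q i 0) β =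
      c • orderedMono (fun i => X q i 0) (α + β) := by
  have hm := fun l γ => mul_orderedMono (A := QMat q k (n + 1)) hq0 (fun i => X q i 0)
      (fun i l h => (isQuantum_X hq0).col 0 h) l γ
  induction α using expo_induction with
  | zero => exact ⟨1, one_ne_zero, by rw [orderedMono_zero]; simp⟩
  | step i α ih =>
    obtain ⟨c, hc, h⟩ := ih
    refine ⟨(moveCoeff q i α)⁻¹ * c * moveCoeff q i (α + β), mul_ne_zero (mul_ne_zero
      (inv_ne_zero (moveCoeff_ne_zero hq0 i α)) hc) (moveCoeff_ne_zero hq0 i _), ?_⟩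
    have hM' : orderedMono (fun i => (X q i 0 : QMat q k (n + 1))) (α + Pi.single i 1) =
        (moveCoeff q i α)⁻¹ • (X q i 0 * orderedMono (fun i => X q i 0) α) := by
      rw [hm, smul_smul, inv_mul_cancel₀ (moveCoeff_ne_zero hq0 i α), one_smul]
    rw [hM', smul_mul_assoc, mul_assoc, h, mul_smul_comm, hm, smul_smul, smul_smul,
      add_right_comm]

/-- Leading terms multiply, up to a nonzero scalar and an automorphism of the coefficients. -/
theorem colTerm_mul_colTerm (hq0 : q ≠ 0) (α β : Expo k) : ∃ c : K, c ≠ 0 ∧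
    ∃ τ : QMat q k n ≃ₐ[K] QMat q k n, ∀ f g : QMat q k n,
      colTerm hq0 α f * colTerm hq0 β g - c • colTerm hq0 (α + β) (τ f * g) ∈
        colFilt hq0 n (α + β) := by
  obtain ⟨c, hc, h⟩ := orderedMono_mul (n := n) hq0 (ofLex α) (ofLex β)
  obtain ⟨τ, hτ⟩ := otherCols_mul_orderedMono (n := n) hq0 (ofLex β)
  refine ⟨c, hc, τ, fun f g => ?_⟩
  have h1 : ∀ z ∈ colFilt hq0 n β, orderedMono (fun i => (X q i 0 : QMat q k (n + 1))) (ofLex α) * z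
      ∈ colFilt hq0 n (α + β) := by
    intro z hz
    induction hz using Submodule.span_induction with
    | mem z hz =>
      obtain ⟨δ, hδ, f, rfl⟩ := hz
      obtain ⟨d, -, h⟩ := orderedMono_mul (n := n) hq0 (ofLex α) (ofLex δ)
      rw [colTerm, ← mul_assoc, h, smul_mul_assoc]
      exact Submodule.smul_mem _ _ (colTerm_mem hq0 (add_lt_add_right hδ α) f)
    | zero => rw [mul_zero]; exact zero_mem _
    | add a b _ _ ha hb => rw [mul_add]; exact add_mem ha hb
    | smul c a _ ha => rw [mul_smul_comm]; exact Submodule.smul_mem _ c ha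
  have h2 := colFilt_mul_otherCols hq0 (h1 _ (hτ f)) g
  convert h2 using 1
  have h3 : colTerm hq0 (α + β) (τ f * g) =
    orderedMono (fun i => X q i 0) (ofLex α + ofLex β) * otherCols hq0 k n (τ f * g) := rfl
  rw [h3, ← smul_mul_assoc, ← h, colTerm, colTerm, map_mul]
  noncomm_ring

theorem span_colTerm (hq0 : q ≠ 0) :
    Submodule.span K {a | ∃ α, ∃ f : QMat q k n, a = colTerm hq0 α f} = ⊤ := by
  set V := Submodule.span K {a | ∃ α, ∃ f : QMat q k n, a = colTerm hq0 α f} with hV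
  have hle : ∀ γ, colFilt hq0 n γ ≤ V := fun γ =>
    Submodule.span_mono fun _ ⟨α, _, f, hf⟩ => ⟨α, f, hf⟩
  have key : ∀ a, ∀ z ∈ V, a * z ∈ V := by
    intro a
    induction a using QMat.induction with
    | alg r =>
      intro z hz
      rw [← Algebra.smul_def]
      exact Submodule.smul_mem _ _ hz
    | add a b ha hb => intro z hz; rw [add_mul]; exact add_mem (ha z hz) (hb z hz)
    | mul a b ha hb => intro z hz; rw [mul_assoc]; exact ha _ (hb z hz)
    | gen i j =>
      intro z hz
      induction hz using Submodule.span_induction with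
      | mem z hz =>
        obtain ⟨α, f, rfl⟩ := hz
        induction j using Fin.cases with
        | zero =>
          rw [X_mul_colTerm]
          exact Submodule.smul_mem _ _ (Submodule.subset_span ⟨_, _, rfl⟩)
        | succ j =>
          have h1 : X q i j.succ = colTerm hq0 0 (X q i j) := by
            rw [colTerm_zero]; simp [otherCols]
          obtain ⟨c, -, τ, h⟩ := colTerm_mul_colTerm (n := n) hq0 0 α
          rw [h1, ← sub_add_cancel (colTerm hq0 0 (X q i j) * colTerm hq0 α f)
            (c • colTerm hq0 (0 + α) (τ (X q i j) * f))]
          exact add_mem (hle _ (h _ _)) (Submodule.smul_mem _ _ (Submodule.subset_span ⟨_, _, rfl⟩))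
      | zero => rw [mul_zero]; exact zero_mem _
      | add a b _ _ ha hb => rw [mul_add]; exact add_mem ha hb
      | smul c a _ ha => rw [mul_smul_comm]; exact Submodule.smul_mem _ c ha
  rw [eq_top_iff]
  intro a _
  have h1 : (1 : QMat q k (n + 1)) ∈ V :=
    Submodule.subset_span ⟨0, 1, by rw [colTerm_zero, map_one]⟩
  simpa using key a 1 h1

/-- Every nonzero element has a leading term with respect to the monomials in the first column. -/
theorem exists_leading (hq0 : q ≠ 0) {a : QMat q k (n + 1)} (ha : a ≠ 0) :
    ∃ (α : Expo k) (f : QMat q k n), f ≠ 0 ∧ a - colTerm hq0 α f ∈ colFilt hq0 n α := by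
  obtain ⟨F, hF⟩ : ∃ F : Expo k →₀ QMat q k n, a = F.sum fun α f => colTerm hq0 α f := by
    have hadd : ∀ (α : Expo k) (f g : QMat q k n),
        colTerm hq0 α (f + g) = colTerm hq0 α f + colTerm hq0 α g := by
      intro α f g; simp [colTerm, mul_add]
    have hz : ∀ α : Expo k, colTerm (n := n) hq0 α 0 = 0 := by intro α; simp [colTerm]
    replace ha : a ∈ Submodule.span K {a | ∃ α, ∃ f : QMat q k n, a = colTerm hq0 α f} := by
      rw [span_colTerm]; trivial
    induction ha using Submodule.span_induction with
    | mem z hz' =>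
      obtain ⟨α, f, rfl⟩ := hz'
      exact ⟨Finsupp.single α f, (Finsupp.sum_single_index (hz α)).symm⟩
    | zero => exact ⟨0, by simp⟩
    | add a b _ _ ha hb =>
      obtain ⟨F, rfl⟩ := ha
      obtain ⟨G, rfl⟩ := hb
      exact ⟨F + G, (Finsupp.sum_add_index' hz hadd).symm⟩
    | smul c a _ ha =>
      obtain ⟨F, rfl⟩ := ha
      refine ⟨c • F, ?_⟩
      rw [Finsupp.sum_smul_index' hz, Finsupp.smul_sum]
      exact Finset.sum_congr rfl fun α _ => smul_colTerm hq0 α c _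
  have hne : F.support.Nonempty := by
    rw [Finset.nonempty_iff_ne_empty]
    intro h
    rw [Finsupp.support_eq_empty] at h
    rw [h, Finsupp.sum_zero_index] at hF
    exact ha hF
  refine ⟨F.support.max' hne, F (F.support.max' hne),
    Finsupp.mem_support_iff.1 (Finset.max'_mem _ hne), ?_⟩
  rw [hF, Finsupp.sum, ← Finset.add_sum_erase _ _ (Finset.max'_mem _ hne), add_sub_cancel_left]
  refine Submodule.sum_mem _ fun β hβ => colTerm_mem hq0 ?_ _
  exact lt_of_le_of_ne (Finset.le_max' _ _ (Finset.mem_of_mem_erase hβ)) (Finset.ne_of_mem_erase hβ)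

theorem colFilt_mul_colTerm (hq0 : q ≠ 0) {α : Expo k} {a : QMat q k (n + 1)}
    (ha : a ∈ colFilt hq0 n α) (β : Expo k) (g : QMat q k n) :
    a * colTerm hq0 β g ∈ colFilt hq0 n (α + β) := by
  induction ha using Submodule.span_induction with
  | mem z hz =>
    obtain ⟨δ, hδ, f, rfl⟩ := hz
    have hlt : δ + β < α + β := add_lt_add_left hδ β
    obtain ⟨c, -, τ, h⟩ := colTerm_mul_colTerm (n := n) hq0 δ β
    rw [← sub_add_cancel (colTerm hq0 δ f * _) (c • colTerm hq0 (δ + β) (τ f * g))]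
    exact add_mem (colFilt_mono hq0 hlt.le (h f g)) (Submodule.smul_mem _ _ (colTerm_mem hq0 hlt _))
  | zero => rw [zero_mul]; exact zero_mem _
  | add a b _ _ ha hb => rw [add_mul]; exact add_mem ha hb
  | smul c a _ ha => rw [smul_mul_assoc]; exact Submodule.smul_mem _ c ha

theorem colTerm_mul_colFilt (hq0 : q ≠ 0) {β : Expo k} {b : QMat q k (n + 1)}
    (hb : b ∈ colFilt hq0 n β) (α : Expo k) (f : QMat q k n) :
    colTerm hq0 α f * b ∈ colFilt hq0 n (α + β) := by
  induction hb using Submodule.span_induction with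
  | mem z hz =>
    obtain ⟨δ, hδ, g, rfl⟩ := hz
    have hlt : α + δ < α + β := add_lt_add_right hδ α
    obtain ⟨c, -, τ, h⟩ := colTerm_mul_colTerm (n := n) hq0 α δ
    rw [← sub_add_cancel (colTerm hq0 α f * _) (c • colTerm hq0 (α + δ) (τ f * g))]
    exact add_mem (colFilt_mono hq0 hlt.le (h f g)) (Submodule.smul_mem _ _ (colTerm_mem hq0 hlt _))
  | zero => rw [mul_zero]; exact zero_mem _
  | add a b _ _ ha hb => rw [mul_add]; exact add_mem ha hb
  | smul c a _ ha => rw [mul_smul_comm]; exact Submodule.smul_mem _ c ha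

theorem colFilt_mul (hq0 : q ≠ 0) {α β : Expo k} {a b : QMat q k (n + 1)}
    (ha : a ∈ colFilt hq0 n α) (hb : b ∈ colFilt hq0 n β) :
    a * b ∈ colFilt hq0 n (α + β) := by
  induction hb using Submodule.span_induction with
  | mem z hz =>
    obtain ⟨δ, hδ, g, rfl⟩ := hz
    exact colFilt_mono hq0 (add_lt_add_right hδ α).le (colFilt_mul_colTerm hq0 ha δ g)
  | zero => rw [mul_zero]; exact zero_mem _
  | add a b _ _ ha hb => rw [mul_add]; exact add_mem ha hb
  | smul c a _ ha => rw [mul_smul_comm]; exact Submodule.smul_mem _ c ha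

/-- Quantum matrices form a domain: by induction on the number of columns, the product of the
leading terms of two nonzero elements does not vanish. -/
theorem noZeroDivisors (hq0 : q ≠ 0) (k n : ℕ) : NoZeroDivisors (QMat q k n) := by
  induction n with
  | zero =>
    have h : ∀ a : QMat q k 0, ∃ r, a = algebraMap K _ r := by
      intro a
      induction a using QMat.induction with
      | alg r => exact ⟨r, rfl⟩
      | gen i j => exact j.elim0
      | mul a b ha hb =>
        obtain ⟨r, rfl⟩ := ha
        obtain ⟨s, rfl⟩ := hb
        exact ⟨r * s, (map_mul _ _ _).symm⟩
      | add a b ha hb =>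
        obtain ⟨r, rfl⟩ := ha
        obtain ⟨s, rfl⟩ := hb
        exact ⟨r + s, (map_add _ _ _).symm⟩
    refine ⟨fun {a b} hab => ?_⟩
    obtain ⟨r, rfl⟩ := h a
    obtain ⟨s, rfl⟩ := h b
    rw [← map_mul, FaithfulSMul.algebraMap_eq_zero_iff, mul_eq_zero] at hab
    rcases hab with rfl | rfl <;> simp
  | succ n ih =>
    refine ⟨fun {a b} hab => ?_⟩
    by_contra! h
    obtain ⟨α, f, hf, ha⟩ := exists_leading hq0 h.1
    obtain ⟨β, g, hg, hb⟩ := exists_leading hq0 h.2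
    obtain ⟨c, hc, τ, hτ⟩ := colTerm_mul_colTerm (n := n) hq0 α β
    have hmem : a * b - c • colTerm hq0 (α + β) (τ f * g) ∈ colFilt hq0 n (α + β) := by
      have h1 := add_mem (add_mem (hτ f g) (colFilt_mul_colTerm hq0 ha β g))
        (add_mem (colTerm_mul_colFilt hq0 hb α f) (colFilt_mul hq0 ha hb))
      convert h1 using 1
      noncomm_ring
    -- the coefficient of the product at `α + β` is `c • (τ f * g)`
    have h2 := colCoeff_colFilt hq0 hmem
    rw [hab, zero_sub, map_neg, map_smul, colCoeff_colTerm] at h2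
    simp only [Finsupp.coe_neg, Finsupp.coe_smul, Pi.neg_apply, Pi.smul_apply,
      Finsupp.single_eq_same, neg_eq_zero, smul_eq_zero, hc, mul_eq_zero, hg, or_false,
      EmbeddingLike.map_eq_zero_iff, hf] at h2

end QMat

/-! ### Factorizations of quantum matrices -/

section Factor

variable {A : Type*} [Ring A] [Algebra K A] {q : K}
variable {κ ν : Type*} [LinearOrder κ] [LinearOrder ν]

/-- The relations of a quantum matrix whose rows are numbered in the reverse order. -/
def IsRevQuantum (q : K) (B : κ → ν → A) : Prop :=
  ∀ i k j l, B k j * B i l - B i l * B k j = (exch q j l - exch q k i) • (B i j * B k l)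

theorem IsRevQuantum.isQuantum_rev {m : ℕ} {B : Fin m → ν → A} (hB : IsRevQuantum q B) :
    IsQuantum q fun (i : Fin m) j => B i.rev j := by
  intro i p j l
  have := hB i.rev p.rev j l
  rwa [exch_rev] at this

variable {ι : Type*} [LinearOrder ι] [Fintype κ] {a : ι → κ → A} {B : κ → ν → A}

omit [LinearOrder ν] in
/-- The product of two entries of `B a`, with the entries of `a` moved to the right. -/
theorem factor_mul_factor (ha : IsQuantum q a)
    (hM : ∀ i j p l, a i j * (∑ c, B c l * a p c) = (∑ c, B c l * a p c) * a i j +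
      exch q i p • ((∑ c, B c l * a i c) * a p j)) (p i : ι) (j l : ν) :
    (∑ c, B c j * a p c) * (∑ c, B c l * a i c) =
      ∑ c, ∑ b, (B c j * B b l * (a p c * a i b) +
        exch q b c • (B c j * B b l * (a p b * a i c))) := by
  rw [Finset.sum_mul]
  refine Finset.sum_congr rfl fun c _ => ?_
  rw [mul_assoc, hM p c i l, mul_add, mul_smul_comm, Finset.sum_mul, Finset.mul_sum,
    Finset.sum_mul, Finset.mul_sum, Finset.smul_sum, ← Finset.sum_add_distrib]
  refine Finset.sum_congr rfl fun b _ => ?_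
  have h := congrArg (B c j * B b l * ·) (ha p i b c)
  simp only [mul_sub, mul_smul_comm] at h
  simp only [mul_assoc] at h ⊢
  linear_combination (norm := module) h

/-- The exchange relations of the rows `b` and `c` of `B`, in the combination in which they enter
the exchange relations of the product of `B` and a quantum matrix. -/
def exchDefect (q : K) (B : κ → ν → A) (j l : ν) (b c : κ) : A :=
  (1 + exch q b c ^ 2 - exch q j l * exch q b c) • (B c j * B b l) +
    (exch q b c + exch q c b - exch q j l) • (B b j * B c l) - B b l * B c j -
    exch q b c • (B c l * B b j)

/-- The failure of the exchange relation for `B a` is the sandwich of the exchange relations of `B`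
with `a`. -/
theorem factor_exchange (ha : IsQuantum q a)
    (hM : ∀ i j p l, a i j * (∑ c, B c l * a p c) = (∑ c, B c l * a p c) * a i j +
      exch q i p • ((∑ c, B c l * a i c) * a p j)) (p i : ι) (j l : ν) :
    (∑ c, B c j * a p c) * (∑ c, B c l * a i c) - (∑ c, B c l * a i c) * (∑ c, B c j * a p c) -
      (exch q j l - exch q i p) • ((∑ c, B c j * a i c) * (∑ c, B c l * a p c)) =
      ∑ c, (∑ b, exchDefect q B j l b c * a i b) * a p c := by
  have h1 : ∑ c, (∑ b, exchDefect q B j l b c * a i b) * a p c =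
      ∑ c, ∑ b, ((1 + exch q b c ^ 2 - exch q j l * exch q b c) • (B c j * B b l *
        (a i b * a p c)) - exch q b c • (B c l * B b j * (a i b * a p c))) +
      ∑ c, ∑ b, ((exch q b c + exch q c b - exch q j l) • (B b j * B c l * (a i b * a p c)) -
        B b l * B c j * (a i b * a p c)) := by
    rw [← Finset.sum_add_distrib]
    refine Finset.sum_congr rfl fun c _ => ?_
    rw [Finset.sum_mul, ← Finset.sum_add_distrib]
    refine Finset.sum_congr rfl fun b _ => ?_
    simp only [exchDefect, sub_mul, add_mul, smul_mul_assoc, mul_assoc]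
    abel
  rw [h1, Finset.sum_comm (f := fun c b =>
      ((exch q b c + exch q c b - exch q j l) • (B b j * B c l * (a i b * a p c)) -
        B b l * B c j * (a i b * a p c))), factor_mul_factor ha hM, factor_mul_factor ha hM,
    factor_mul_factor ha hM, ← Finset.sum_sub_distrib, Finset.smul_sum, ← Finset.sum_sub_distrib,
    ← Finset.sum_add_distrib]
  refine Finset.sum_congr rfl fun c _ => ?_
  rw [← Finset.sum_sub_distrib, Finset.smul_sum, ← Finset.sum_sub_distrib,
    ← Finset.sum_add_distrib]
  refine Finset.sum_congr rfl fun b _ => ?_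
  have h2 := congrArg (B c j * B b l * ·) (ha i p c b)
  have h3 := congrArg (B c j * B b l * ·) (ha i p b c)
  simp only [mul_sub, mul_smul_comm] at h2 h3
  linear_combination (norm := module) h2 + exch q b c • h3

omit [Fintype κ] in
theorem exchDefect_eq (j l : ν) (b c : κ) : exchDefect q B j l b c =
    (B c j * B b l - B b l * B c j - (exch q j l - exch q c b) • (B b j * B c l)) +
      exch q b c • (B b j * B c l - B c l * B b j -
        (exch q j l - exch q b c) • (B c j * B b l)) := by
  rw [exchDefect]
  module

omit [Fintype κ] in
theorem isRevQuantum_of_exchDefect (hq0 : q ≠ 0) (h : ∀ j l b c, exchDefect q B j l b c = 0) :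
    IsRevQuantum q B := by
  intro b c j l
  have h1 := h j l b c
  have h2 := h j l c b
  rw [exchDefect_eq] at h1 h2
  rw [← sub_eq_zero]
  rcases lt_trichotomy b c with hbc | rfl | hbc
  · rw [exch_of_gt q hbc] at h1 h2 ⊢
    rw [zero_smul, add_zero] at h2
    rw [h2, smul_zero, add_zero] at h1
    exact h1
  · rw [exch_self] at h1 ⊢
    have h3 : q • (B b j * B b l - B b l * B b j - (exch q j l - (q - 1)) • (B b j * B b l)) =
        0 := by
      linear_combination (norm := module) h1
    exact (smul_eq_zero.1 h3).resolve_left hq0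
  · rw [exch_of_gt q hbc, zero_smul, add_zero] at h1
    exact h1

omit [Fintype κ] in
theorem IsRevQuantum.exchDefect_eq_zero (hB : IsRevQuantum q B) (j l : ν) (b c : κ) :
    exchDefect q B j l b c = 0 := by
  rw [exchDefect_eq, sub_eq_zero.2 (hB b c j l), sub_eq_zero.2 (hB c b j l), smul_zero, add_zero]

/-- If `a` and `B a` are quantum matrices satisfying the mixed relations, and `a` can be cancelled
on the right, then `B` satisfies the relations of a quantum matrix with reversed rows. -/
theorem isRevQuantum_of_cancel
    (hcancel : ∀ z : κ → A, (∀ p, ∑ c, z c * a p c = 0) → z = 0) (hq0 : q ≠ 0) (ha : IsQuantum q a)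
    (hM : ∀ i j p l, a i j * (∑ c, B c l * a p c) = (∑ c, B c l * a p c) * a i j +
      exch q i p • ((∑ c, B c l * a i c) * a p j))
    (hy : IsQuantum q fun i l => ∑ c, B c l * a i c) : IsRevQuantum q B := by
  refine isRevQuantum_of_exchDefect hq0 fun j l b c => ?_
  refine congrFun (hcancel (fun b => exchDefect q B j l b c) fun i => ?_) b
  refine congrFun (hcancel (fun c => ∑ b, exchDefect q B j l b c * a i b) fun p => ?_) c
  rw [← factor_exchange ha hM, sub_eq_zero]
  exact hy i p j l

omit [LinearOrder ν] in
/-- The mixed relations between `a` and `B a`, from the commutation relations `hS` between `a` and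
`B`. -/
theorem mul_factor (ha : IsQuantum q a)
    (hS : ∀ i j c l, a i j * B c l = B c l * a i j +
      if c = j then ∑ m, exch q m j • (B m l * a i m) else 0) (i : ι) (j : κ) (p : ι) (l : ν) :
    a i j * (∑ c, B c l * a p c) = (∑ c, B c l * a p c) * a i j +
      exch q i p • ((∑ c, B c l * a i c) * a p j) := by
  have h1 : a i j * (∑ c, B c l * a p c) = ∑ c, B c l * a i j * a p c +
      ∑ m, exch q m j • (B m l * a i m) * a p j := by
    rw [Finset.mul_sum]
    simp only [← mul_assoc, hS, add_mul, ite_mul, zero_mul, Finset.sum_add_distrib,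
      Finset.sum_ite_eq', Finset.mem_univ, if_true, Finset.sum_mul]
  rw [h1, Finset.sum_mul, Finset.sum_mul, Finset.smul_sum, ← Finset.sum_add_distrib,
    ← Finset.sum_add_distrib]
  refine Finset.sum_congr rfl fun c _ => ?_
  have h2 := congrArg (B c l * ·) (ha i p c j)
  simp only [mul_sub, mul_smul_comm] at h2
  simp only [smul_mul_assoc, mul_assoc]
  linear_combination (norm := module) -h2

/-- Conversely to `isRevQuantum_of_cancel`, the product `B a` is a quantum matrix if `a` is one, `B`
is one with reversed rows, and the two satisfy the commutation relations `hS`. -/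
theorem isQuantum_factor (ha : IsQuantum q a) (hB : IsRevQuantum q B)
    (hS : ∀ i j c l, a i j * B c l = B c l * a i j +
      if c = j then ∑ m, exch q m j • (B m l * a i m) else 0) :
    IsQuantum q fun i l => ∑ c, B c l * a i c := by
  intro i p j l
  have h := factor_exchange ha (mul_factor ha hS) p i j l
  simp only [hB.exchDefect_eq_zero, zero_mul, Finset.sum_const_zero] at h
  exact sub_eq_zero.1 h

end Factor

/-! ### Maximal minors: triangular matrices, Cramer's rule -/

theorem perm_eq_one_of_le {t : ℕ} {s : Equiv.Perm (Fin t)} (h : ∀ i, s i ≤ i) : s = 1 := by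
  ext1 i
  induction i using WellFoundedLT.induction with
  | ind i ih =>
    rcases (h i).lt_or_eq with hlt | heq
    · exact absurd (s.injective (ih (s i) hlt)) hlt.ne
    · exact heq

theorem qDet_of_upper_triangular {A : Type*} [Ring A] [Algebra K A] (q : K) {t : ℕ}
    (f : Fin t → Fin t → A) (hf : ∀ i j, j < i → f i j = 0) :
    qDet q f = (List.ofFn fun i => f i i).prod := by
  rw [qDet, Finset.sum_eq_single 1]
  · have : permLength (1 : Equiv.Perm (Fin t)) = 0 := by
      rw [permLength, Finset.card_eq_zero, Finset.filter_eq_empty_iff]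
      exact fun p _ h => lt_asymm h.1 h.2
    rw [this, pow_zero, one_smul]
    rfl
  · intro s _ hs
    obtain ⟨i, hi⟩ : ∃ i, s i < i := by
      by_contra! h
      refine hs (inv_eq_one.1 (perm_eq_one_of_le fun i => ?_))
      simpa using h (s⁻¹ i)
    rw [List.prod_eq_zero, smul_zero]
    rw [List.mem_ofFn]
    exact ⟨i, hf _ _ hi⟩
  · simp

/-- If an element commutes up to scalars with the entries of a matrix, it does so with the
minors. -/
theorem mul_minor_of_mul_entry {A : Type*} [Ring A] [Algebra K A] {q : K} {ι κ : Type*}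
    [LinearOrder κ] {x : ι → κ → A} {z : A} {e : κ → K}
    (h : ∀ i c, z * x i c = e c • (x i c * z)) (rs : List ι) (J : Finset κ) :
    z * minor q x rs J = (∏ c ∈ J, e c) • (minor q x rs J * z) := by
  induction rs generalizing J with
  | nil =>
    rw [minor_nil]
    split_ifs with hJ
    · simp [hJ]
    · simp
  | cons r rs ih =>
    rw [minor_cons, Finset.mul_sum, Finset.sum_mul, Finset.smul_sum]
    refine Finset.sum_congr rfl fun c hc => ?_
    rw [mul_smul_comm, ← mul_assoc, h, smul_mul_assoc, mul_assoc, ih, mul_smul_comm, smul_mul_assoc,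
      smul_smul, smul_smul, smul_smul, ← Finset.mul_prod_erase J e hc, mul_assoc (x r c)]
    congr 1
    ring

namespace QMat

variable {q : K} {k n : ℕ}

/-- The maximal minor of the generic matrix with set of columns `J`; it is `0` unless `J` has `k`
elements. -/
def fullMinor (q : K) {k n : ℕ} (J : Finset (Fin n)) : QMat q k n :=
  minor q (X q) (Finset.univ : Finset (Fin k)).sort J

theorem firstCols_eq_map (hkn : k ≤ n) :
    firstCols k n = Finset.univ.map (Fin.castLEEmb hkn) := by
  ext c
  simp only [firstCols, Finset.mem_filter, Finset.mem_univ, true_and, Finset.mem_map,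
    Fin.coe_castLEEmb]
  exact ⟨fun h => ⟨⟨c, h⟩, rfl⟩, by rintro ⟨a, rfl⟩; exact a.isLt⟩

theorem mem_firstCols {c : Fin n} : c ∈ firstCols k n ↔ (c : ℕ) < k := by simp [firstCols]

theorem mem_lastCols {c : Fin n} : c ∈ lastCols k n ↔ n - k ≤ (c : ℕ) := by simp [lastCols]

theorem firstCols_mul_X (hq0 : q ≠ 0) (hkn : k ≤ n) (i : Fin k) (c : Fin n) :
    fullMinor q (firstCols k n) * X q i c =
      (if (c : ℕ) < k then (1 : K) else q) • (X q i c * fullMinor q (firstCols k n)) := by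
  have hX := isQuantum_X (m := k) (n := n) hq0
  split_ifs with h
  · rw [one_smul]
    exact (minor_commute hX hq0 (by rw [Finset.card_univ, card_firstCols hkn, Fintype.card_fin])
      (Finset.mem_univ i) (mem_firstCols.2 h)).symm
  · refine minor_mul_right hX hq0 (Finset.sortedLT_sort _).pairwise
      ((Finset.mem_sort _).2 (Finset.mem_univ i)) fun d hd => ?_
    exact Fin.lt_def.2 ((mem_firstCols.1 hd).trans_le (not_lt.1 h))

theorem lastCols_mul_X (hq0 : q ≠ 0) (hkn : k ≤ n) (i : Fin k) (c : Fin n) :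
    fullMinor q (lastCols k n) * X q i c =
      (if n - k ≤ (c : ℕ) then (1 : K) else q⁻¹) • (X q i c * fullMinor q (lastCols k n)) := by
  have hX := isQuantum_X (m := k) (n := n) hq0
  split_ifs with h
  · rw [one_smul]
    exact (minor_commute hX hq0 (by rw [Finset.card_univ, card_lastCols hkn, Fintype.card_fin])
      (Finset.mem_univ i) (mem_lastCols.2 h)).symm
  · have h1 : X q i c * fullMinor q (lastCols k n) = q • (fullMinor q (lastCols k n) * X q i c) :=
      minor_mul_left hX hq0 (Finset.sortedLT_sort _).pairwise
        ((Finset.mem_sort _).2 (Finset.mem_univ i)) fun d hd =>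
          Fin.lt_def.2 ((not_le.1 h).trans_le (mem_lastCols.1 hd))
    rw [h1, smul_smul, inv_mul_cancel₀ hq0, one_smul]

theorem firstCols_mul_fullMinor (hq0 : q ≠ 0) (hkn : k ≤ n) (J : Finset (Fin n)) :
    (fullMinor q (firstCols k n) : QMat q k n) * fullMinor q J =
      q ^ (J \ firstCols k n).card • (fullMinor q J * fullMinor q (firstCols k n)) := by
  have h := mul_minor_of_mul_entry (q := q) (firstCols_mul_X hq0 hkn)
    (Finset.univ : Finset (Fin k)).sort J
  rw [Finset.prod_ite, Finset.prod_const_one, one_mul, Finset.prod_const] at h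
  rw [← Finset.filter_notMem_eq_sdiff]
  simp only [mem_firstCols]
  exact h

theorem lastCols_mul_fullMinor (hq0 : q ≠ 0) (hkn : k ≤ n) (J : Finset (Fin n)) :
    (fullMinor q (lastCols k n) : QMat q k n) * fullMinor q J =
      q⁻¹ ^ (J \ lastCols k n).card • (fullMinor q J * fullMinor q (lastCols k n)) := by
  have h := mul_minor_of_mul_entry (q := q) (lastCols_mul_X hq0 hkn)
    (Finset.univ : Finset (Fin k)).sort J
  rw [Finset.prod_ite, Finset.prod_const_one, one_mul, Finset.prod_const] at h
  rw [← Finset.filter_notMem_eq_sdiff]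
  simp only [mem_lastCols]
  exact h

theorem map_fullMinor_of_upper_triangular {A : Type*} [Ring A] [Algebra K A] {J : Finset (Fin n)}
    (hJ : J.card = k) (f : QMat q k n →ₐ[K] A)
    (hf : ∀ i j : Fin k, j < i → f (X q i (J.orderEmbOfFin hJ j)) = 0) :
    f (fullMinor q J) = (List.ofFn fun i : Fin k => f (X q i (J.orderEmbOfFin hJ i))).prod := by
  have h2 : f (fullMinor q J) = qDet q fun i j : Fin k => f (X q i (J.orderEmbOfFin hJ j)) := by
    rw [fullMinor, ← maxMinor_eq q _ hJ, maxMinor]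
    simp only [qDet, map_sum, map_smul, map_list_prod, List.map_ofFn]
    rfl
  rw [h2, qDet_of_upper_triangular q _ hf]

theorem orderEmbOfFin_firstCols (hkn : k ≤ n) (i : Fin k) :
    (firstCols k n).orderEmbOfFin (card_firstCols hkn) i = Fin.castLE hkn i := by
  have h2 : ∀ x : Fin k, Fin.castLE hkn x ∈ firstCols k n := fun x => mem_firstCols.2 x.isLt
  have h3 : StrictMono (Fin.castLE hkn) := fun a b h => h
  exact (congrFun (Finset.orderEmbOfFin_unique _ h2 h3) i).symm

/-- Maximal minors do not vanish: they specialize to the minors of a permutation matrix. -/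
theorem fullMinor_ne_zero {J : Finset (Fin n)} (hJ : J.card = k) :
    (fullMinor q J : QMat q k n) ≠ 0 := by
  set g := J.orderEmbOfFin hJ with hg
  have hq : IsQuantum q fun (i : Fin k) (c : Fin n) => if c = g i then (1 : K) else 0 := by
    intro i p c d
    by_cases h1 : c = g i
    · by_cases h2 : d = g p
      · subst h1 h2
        simp only [exch, OrderEmbedding.lt_iff_lt, EmbeddingLike.apply_eq_iff_eq, sub_self,
          zero_smul, sub_eq_zero]
        simp only [eq_comm]
      · by_cases h3 : d = g i
        · subst h1 h3
          have h4 : ¬ i = p := fun h => h2 (by rw [h])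
          simp [h4]
        · simp [h2, h3]
    · by_cases h2 : c = g p
      · by_cases h3 : d = g i
        · have h4 : ¬ i = p := fun h => h1 (by rw [h, h2])
          subst h2 h3
          simp [Ne.symm h4, h4]
        · simp [h1, h3]
      · simp [h1, h2]
  intro h0
  have h := map_fullMinor_of_upper_triangular hJ (lift _ hq) (fun i j hij => by
    simp [lift_X, ← hg, hij.ne])
  rw [h0] at h
  simp [lift_X, ← hg] at h

/-- The coefficients in Cramer's rule `[u] x_{l,k+j} = ∑_c B_{cj} x_{lc}`; up to a scalar, these
are the maximal minors which generate a copy of the quantum matrices. -/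
def cramerCoeff (q : K) {k n : ℕ} (hkn : k ≤ n) (c : Fin k) (j : Fin (n - k)) : QMat q k n :=
  (-(-q) ^ (((firstCols k n).filter (Fin.castLE hkn c < ·)).card + 1)) •
    fullMinor q (genCols hkn c.rev j)

theorem genCols_rev (hkn : k ≤ n) (c : Fin k) (j : Fin (n - k)) :
    genCols hkn c.rev j = insert (rightCol j) ((firstCols k n).erase (Fin.castLE hkn c)) := by
  have : revCol hkn c.rev = Fin.castLE hkn c := Fin.ext (by simp [revCol])
  rw [genCols, this]

theorem cramer (hq0 : q ≠ 0) (hkn : k ≤ n) (l : Fin k) (j : Fin (n - k)) :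
    fullMinor q (firstCols k n) * X q l (rightCol j) =
      ∑ c, cramerCoeff q hkn c j * X q l (Fin.castLE hkn c) := by
  have hX := isQuantum_X (m := k) (n := n) hq0
  have h := minor_concat_eq_zero hX hq0 (r := l) (L := (Finset.univ : Finset (Fin k)).sort)
    ((Finset.mem_sort _).2 (Finset.mem_univ l)) (insert (rightCol j) (firstCols k n))
  have hlt : ∀ c ∈ firstCols k n, c < rightCol j := fun c hc =>
    Fin.lt_def.2 ((mem_firstCols.1 hc).trans_le (by simp [rightCol]))
  have hm : rightCol j ∉ firstCols k n := fun h => lt_irrefl _ (hlt _ h)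
  rw [minor_concat, Finset.sum_insert hm, Finset.erase_insert hm] at h
  have h1 : (insert (rightCol j) (firstCols k n)).filter (rightCol j < ·) = ∅ := by
    rw [Finset.filter_eq_empty_iff]
    intro c hc
    rcases Finset.mem_insert.1 hc with rfl | hc
    · exact lt_irrefl _
    · exact (hlt c hc).not_gt
  have h2 : ∀ c ∈ firstCols k n, ((insert (rightCol j) (firstCols k n)).filter (c < ·)).card =
      ((firstCols k n).filter (c < ·)).card + 1 := by
    intro c hc
    rw [Finset.filter_insert, if_pos (hlt c hc), Finset.card_insert_of_notMem]
    exact fun h => hm (Finset.mem_filter.1 h).1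
  rw [h1, Finset.card_empty, pow_zero, one_smul, Finset.sum_congr rfl fun c hc => by rw [h2 c hc],
    ← eq_neg_iff_add_eq_zero] at h
  refine h.trans ?_
  rw [← Finset.sum_neg_distrib, Finset.sum_congr (firstCols_eq_map hkn) fun _ _ => rfl,
    Finset.sum_map]
  refine Finset.sum_congr rfl fun c _ => ?_
  have hc : Fin.castLE hkn c ∈ firstCols k n := mem_firstCols.2 c.isLt
  rw [cramerCoeff, genCols_rev, smul_mul_assoc, neg_smul, fullMinor, Fin.coe_castLEEmb,
    Finset.erase_insert_of_ne fun h : rightCol j = Fin.castLE hkn c => hm (by rw [h]; exact hc)]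

theorem transpose_minor_cons (hq0 : q ≠ 0) {I : Finset (Fin n)} (hI : I.card = k) {m : Fin n}
    (hm : m ∈ I) : minor q (fun j i => (X q i j : QMat q k n)) (m :: (I.erase m).sort)
      Finset.univ = (-q) ^ (I.filter (· < m)).card • fullMinor q I := by
  have hX := isQuantum_X (m := k) (n := n) hq0
  rw [minor_cons_sort (hX.transpose hq0) hq0 I hm, fullMinor, minor_sort_eq hX]
  rw [hI, Finset.card_univ, Fintype.card_fin]

/-- Right cancellation of the first `k` columns, up to `[u]`, in any algebra over the quantum
matrices: `z` is multiplied by the columns of the quantum adjugate, which turns the entries of the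
first columns into expansions of `[u]` and of minors of the transpose with a repeated row. -/
theorem mul_firstCols_of_sum_eq_zero {A : Type*} [Ring A] [Algebra K A] (hq0 : q ≠ 0) (hkn : k ≤ n)
    (f : QMat q k n →ₐ[K] A) (z : Fin k → A)
    (hz : ∀ p, ∑ c, z c * f (X q p (Fin.castLE hkn c)) = 0) (d : Fin k) :
    z d * f (fullMinor q (firstCols k n)) = 0 := by
  have hX := isQuantum_X (m := k) (n := n) hq0
  set D := (firstCols k n).erase (Fin.castLE hkn d) with hD
  have hd : Fin.castLE hkn d ∈ firstCols k n := mem_firstCols.2 d.isLt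
  have h1 : ∑ c, z c * f (minor q (fun j i => (X q i j : QMat q k n))
      (Fin.castLE hkn c :: D.sort) Finset.univ) = 0 := by
    simp only [minor_cons, map_sum, map_smul, map_mul, Finset.mul_sum]
    rw [Finset.sum_comm]
    refine Finset.sum_eq_zero fun p _ => ?_
    simp only [mul_smul_comm, ← mul_assoc]
    rw [← Finset.smul_sum, ← Finset.sum_mul, hz p, zero_mul, smul_zero]
  rw [Finset.sum_eq_single d] at h1
  · rw [hD, transpose_minor_cons hq0 (card_firstCols hkn) hd, map_smul, mul_smul_comm,
      smul_eq_zero] at h1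
    exact h1.resolve_left (pow_ne_zero _ (neg_ne_zero.2 hq0))
  · intro c _ hc
    rw [minor_cons_eq_zero (hX.transpose hq0) hq0, map_zero, mul_zero]
    rw [Finset.mem_sort, hD, Finset.mem_erase]
    exact ⟨fun h => hc ((Fin.castLE_injective hkn) h), mem_firstCols.2 c.isLt⟩
  · simp

/-- The hypothesis of `isRevQuantum_of_cancel` for the first `k` columns. -/
theorem cancel_firstCols (hq0 : q ≠ 0) (hkn : k ≤ n) (z : Fin k → QMat q k n)
    (hz : ∀ p, ∑ c, z c * X q p (Fin.castLE hkn c) = 0) : z = 0 := by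
  have := noZeroDivisors hq0 k n
  funext d
  exact (mul_eq_zero.1 (mul_firstCols_of_sum_eq_zero hq0 hkn (AlgHom.id K _) z hz d)).resolve_right
    (fullMinor_ne_zero (card_firstCols hkn))

/-- By Cramer's rule, the matrix of the coefficients is the quotient of two blocks of columns of the
generic matrix, up to the factor `[u]`. -/
theorem isRevQuantum_cramerCoeff (hq0 : q ≠ 0) (hkn : k ≤ n) :
    IsRevQuantum q (cramerCoeff q hkn) := by
  have hX := isQuantum_X (m := k) (n := n) hq0
  have hU := fun (i : Fin k) (j : Fin (n - k)) => firstCols_mul_X hq0 hkn i (rightCol j)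
  have hU' := fun (i j : Fin k) => firstCols_mul_X hq0 hkn i (Fin.castLE hkn j)
  simp only [rightCol, Fin.val_castLE, Fin.is_lt, if_true, one_smul, add_lt_iff_neg_left,
    Nat.not_lt_zero, if_false] at hU hU'
  set U : QMat q k n := fullMinor q (firstCols k n) with hUdef
  refine isRevQuantum_of_cancel (a := fun i c => X q i (Fin.castLE hkn c))
    (cancel_firstCols hq0 hkn) hq0 (hX.submatrix strictMono_id fun a b h => h) ?_ ?_
  · intro i j p l
    simp only [← cramer hq0 hkn]
    have h := hX.mixed i p (j := Fin.castLE hkn j) (l := rightCol l)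
      (Fin.lt_def.2 (by simp [rightCol]; omega))
    rw [← mul_assoc, ← hU', mul_assoc, h, mul_add, mul_smul_comm, mul_assoc, mul_assoc]
  · simp only [← cramer hq0 hkn]
    intro i p j l
    have h := hX i p (rightCol j) (rightCol l)
    have h2 : exch q (rightCol j : Fin n) (rightCol l) = exch q j l := by
      refine exch_congr ?_ ?_ <;> simp [rightCol, Fin.ext_iff]
    rw [h2] at h
    have hswap : ∀ (a b : Fin k) (c d : Fin (n - k)), U * X q a (rightCol c) *
        (U * X q b (rightCol d)) = q⁻¹ • (U * U * (X q a (rightCol c) * X q b (rightCol d))) := by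
      intro a b c d
      have h3 : X q a (rightCol c) * U = q⁻¹ • (U * X q a (rightCol c)) := by
        have := hU a c
        rw [rightCol, this, smul_smul, inv_mul_cancel₀ hq0, one_smul]
      rw [mul_assoc U, ← mul_assoc (X q a (rightCol c)), h3, smul_mul_assoc, mul_smul_comm]
      simp only [mul_assoc]
    rw [hswap, hswap, hswap, ← smul_sub, ← mul_sub, h, mul_smul_comm, smul_comm]

/-- The minors `genCols i j` satisfy the relations of a quantum matrix. -/
theorem isQuantum_genCols (hq0 : q ≠ 0) (hkn : k ≤ n) :
    IsQuantum q fun i j => (fullMinor q (genCols hkn i j) : QMat q k n) := by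
  have h := (isRevQuantum_cramerCoeff hq0 hkn).isQuantum_rev
  convert h.smul_row_col (fun i : Fin k => (-(-q) ^ (((firstCols k n).filter
    (Fin.castLE hkn i.rev < ·)).card + 1))⁻¹) 1 using 3 with i j
  rw [cramerCoeff, Fin.rev_rev, Pi.one_apply, mul_one, smul_smul, inv_mul_cancel₀, one_smul]
  exact neg_ne_zero.2 (pow_ne_zero _ (neg_ne_zero.2 hq0))

/-- The quantum Plücker relation which exchanges the column `m` of `I` with columns of `u`. -/
theorem plucker_exchange (hq0 : q ≠ 0) (hkn : k ≤ n) (j : Fin (n - k)) (L : List (Fin n)) :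
    fullMinor q (firstCols k n) *
        minor q (fun j i => (X q i j : QMat q k n)) (rightCol j :: L) Finset.univ =
      ∑ c, cramerCoeff q hkn c j *
        minor q (fun j i => X q i j) (Fin.castLE hkn c :: L) Finset.univ := by
  simp only [minor_cons, Finset.mul_sum]
  rw [Finset.sum_comm]
  refine Finset.sum_congr rfl fun p _ => ?_
  simp only [mul_smul_comm, ← mul_assoc]
  rw [cramer hq0, Finset.sum_mul, Finset.smul_sum]

end QMat

/-! ### The action of `QMat q k n` on `QMat q k (n - k)` -/

namespace QMat

variable {q : K} {k p : ℕ}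

/-- The generators of the quantum matrices with the rows numbered from the bottom. -/
def revX (q : K) {k p : ℕ} (c : Fin k) (l : Fin p) : QMat q k p := X q c.rev l

theorem isRevQuantum_revX (hq0 : q ≠ 0) :
    IsRevQuantum q (revX q : Fin k → Fin p → QMat q k p) := by
  intro i a j l
  have := isQuantum_X (m := k) (n := p) hq0 i.rev a.rev j l
  rwa [exch_rev] at this

/-- The matrix of the coaction on `QMat q k p` at the generator `revX q c l`. -/
def revCoactMatrix (q : K) {k p : ℕ} (c : Fin k) (l : Fin p) :
    Matrix (Fin k) (Fin k) (QMat q k p) :=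
  Matrix.of fun j m => (if j = m then revX q c l else 0) +
    if j = c then exch q m c • revX q m l else 0

theorem revCoactMatrix_mul (c b : Fin k) (l s : Fin p) (j m : Fin k) :
    (revCoactMatrix q c l * revCoactMatrix q b s) j m =
      (if j = m then revX q c l * revX q b s else 0) +
      (if j = b then exch q m b • (revX q c l * revX q m s) else 0) +
      (if j = c then exch q m c • (revX q m l * revX q b s) else 0) +
      (if j = c then (exch q b c * exch q m b) • (revX q b l * revX q m s) else 0) := by
  simp only [revCoactMatrix, Matrix.mul_apply, Matrix.of_apply]
  by_cases h : j = c
  · simp only [h, if_true, add_mul, mul_add, Finset.sum_add_distrib, ite_mul, mul_ite, zero_mul,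
      mul_zero, smul_mul_assoc, mul_smul_comm, Finset.sum_ite_eq',
      Finset.mem_univ, smul_add, smul_ite, smul_zero, smul_smul, if_true]
    split_ifs <;> simp_all [mul_comm] <;> abel
  · simp only [h, if_false, add_zero, mul_add, ite_mul, mul_ite, zero_mul, mul_zero,
      mul_smul_comm, Finset.sum_add_distrib]
    simp

theorem isRevQuantum_revCoactMatrix (hq0 : q ≠ 0) :
    IsRevQuantum q (revCoactMatrix q : Fin k → Fin p → Matrix (Fin k) (Fin k) (QMat q k p)) := by
  have hB := isRevQuantum_revX (k := k) (p := p) hq0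
  intro i c s t
  ext j m
  rw [Matrix.sub_apply, Matrix.smul_apply, revCoactMatrix_mul, revCoactMatrix_mul,
    revCoactMatrix_mul]
  have h0 := hB i c s t
  rcases eq_or_ne i c with rfl | hic
  · by_cases hj : j = i
    · subst hj
      simp only [if_true, exch_self] at h0 ⊢
      have h1 := hB j m s t
      have h2 := hB m j s t
      rcases lt_trichotomy m j with hmj | rfl | hmj
      · rw [exch_of_lt q hmj] at h1 ⊢
        rw [exch_of_gt q hmj] at h2
        simp only [if_neg hmj.ne']
        linear_combination (norm := skip) ((q - q⁻¹) * q) • h1 + (q - q⁻¹) • h2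
        match_scalars <;> field_simp <;> ring
      · simp only [exch_self, if_true] at h1 ⊢
        linear_combination (norm := module) (1 + (q - 1) + (q - 1) + (q - 1) * (q - 1)) • h0
      · simp only [exch_of_gt q hmj, if_neg hmj.ne]
        module
    · simp only [if_neg hj]
      split_ifs
      · linear_combination (norm := module) h0
      · module
  · by_cases hj : j = i
    · subst hj
      simp only [if_neg hic, if_true]
      have key : exch q m j • (revX q c s * revX q m t) - exch q m j • (revX q m t * revX q c s) -
          (exch q c j * exch q m c) • (revX q c t * revX q m s) =
          (exch q s t - exch q c j) • (exch q m j • (revX q m s * revX q c t) +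
            (exch q c j * exch q m c) • (revX q c s * revX q m t)) := by
        have h1 := hB m c s t
        have h2 := hB c m s t
        rcases eq_or_ne m c with rfl | hmc
        · have hs : exch q m j * (exch q m j - 2 * (q - 1) + (q - 1) * exch q m j -
              (q - 1) * (q - 1)) = 0 := by
            simp only [exch]
            split_ifs <;> first | (exfalso; order) | ring1 | (field_simp; ring1)
          rw [exch_self] at h1 ⊢
          linear_combination (norm := module) (exch q m j + exch q m j * (q - 1)) • h1 +
            smul_congr hs (revX q m s * revX q m t)
        · have hs1 : exch q m j * exch q c m + exch q c j * exch q m c =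
              exch q m j * exch q c j := by
            simp only [exch]
            split_ifs <;> first | (exfalso; order) | ring1
          have hs2 : exch q c j * exch q m c * (exch q m c - exch q c j) = 0 := by
            simp only [exch]
            split_ifs <;> first | (exfalso; order) | ring1
          linear_combination (norm := module) exch q m j • h1 + (exch q c j * exch q m c) • h2 -
            smul_congr hs1 (revX q m s * revX q c t) - smul_congr hs2 (revX q c s * revX q m t)
      split_ifs
      · linear_combination (norm := module) h0 + key
      · linear_combination (norm := module) key
    · by_cases hc : j = c
      · subst hc
        simp only [if_neg hj, if_true]
        have key : exch q m j • (revX q m s * revX q i t) - exch q m j • (revX q i t * revX q m s) +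
            (exch q i j * exch q m i) • (revX q i s * revX q m t) =
            ((exch q s t - exch q j i) * exch q m j) • (revX q i s * revX q m t) := by
          have h1 := hB i m s t
          have hs : exch q m j * exch q j i + exch q i j * exch q m i =
              exch q m j * exch q m i := by
            simp only [exch]
            split_ifs <;> first | (exfalso; order) | ring1
          linear_combination (norm := module) exch q m j • h1 +
            smul_congr hs (revX q i s * revX q m t)
        split_ifs
        · linear_combination (norm := module) h0 + key
        · linear_combination (norm := module) key
      · simp only [if_neg hj, if_neg hc]
        split_ifs
        · linear_combination (norm := module) h0
        · module

/-- The coaction of the upper triangular quantum matrices on `QMat q k p`. -/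
def revCoact (hq0 : q ≠ 0) : QMat q k p →ₐ[K] Matrix (Fin k) (Fin k) (QMat q k p) :=
  lift _ (isRevQuantum_revCoactMatrix hq0).isQuantum_rev

theorem revCoact_revX (hq0 : q ≠ 0) (c : Fin k) (l : Fin p) :
    revCoact hq0 (revX q c l) = revCoactMatrix q c l := by
  rw [revCoact, revX, lift_X, Fin.rev_rev]

/-- The action on `QMat q k p` of the entries in the first `k` columns; it is upper triangular by
`leftOp_of_gt`. -/
def leftOp (hq0 : q ≠ 0) (k p : ℕ) (i j : Fin k) : Module.End K (QMat q k p) :=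
  coactOp (revCoact hq0) j i

theorem leftOp_revX (hq0 : q ≠ 0) (i j b : Fin k) (c : Fin p) :
    leftOp hq0 k p i j (revX q b c) = (if j = i then revX q b c else 0) +
      (if j = b then exch q i b • revX q i c else 0) := by
  change revCoact hq0 (revX q b c) j i = _
  rw [revCoact_revX]
  rfl

theorem leftOp_mul (hq0 : q ≠ 0) (i j : Fin k) (a b : QMat q k p) :
    leftOp hq0 k p i j (a * b) = ∑ u, leftOp hq0 k p u j a * leftOp hq0 k p i u b :=
  coactOp_mul _ _ _ _ _

/-- The entries of the `L`-operator of the vector representation. -/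
def vecOp (q : K) {k : ℕ} (i s : Fin k) : Module.End K (Fin k → K) :=
  (if i = s then 1 else 0) + exch q i s • LinearMap.single K (fun _ => K) i ∘ₗ LinearMap.proj s

theorem vecOp_single (i s b : Fin k) : vecOp q i s (Pi.single b 1) =
    (if i = s then Pi.single b 1 else 0) + if s = b then exch q i b • Pi.single i 1 else 0 := by
  rw [vecOp, LinearMap.add_apply]
  congr 1
  · split_ifs <;> simp
  · by_cases h : s = b
    · subst h
      simp
    · simp [h]

theorem isQuantum_vecOp (hq0 : q ≠ 0) : IsQuantum q (vecOp q : Fin k → Fin k → _) := by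
  intro i a j l
  refine LinearMap.pi_ext' fun b => LinearMap.ext_ring ?_
  refine exchange_of_coeff (fun b : Fin k => (Pi.single b 1 : Fin k → K)) b (fun i k => exch q i k)
    (isExchangeCoeff_exch hq0 b)
    (F := fun a j i l => vecOp q a j (vecOp q i l (Pi.single b 1))) ?_ i a j l
  intro i a j l
  simp only [vecOp_single, map_add, apply_ite (vecOp q a j), map_smul, map_zero]
  split_ifs <;> module

theorem isQuantum_leftOp (hq0 : q ≠ 0) : IsQuantum q (leftOp (q := q) hq0 k p) := by
  refine IsQuantum.transpose (x := fun j i => leftOp (q := q) hq0 k p i j) hq0 ?_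
  refine isQuantum_coactOp _ fun b c i a j l => ?_
  -- on the span of the generators in one column the operators are those of `vecOp`
  set φ : (Fin k → K) →ₗ[K] QMat q k p :=
    Fintype.linearCombination K fun b => revX q b c with hφ
  have h1 : ∀ b, φ (Pi.single b 1) = revX q b c := fun b => by
    rw [hφ, Fintype.linearCombination_apply_single, one_smul]
  have h2 : ∀ i j v, leftOp hq0 k p i j (φ v) = φ (vecOp q i j v) := by
    intro i j v
    rw [← LinearMap.comp_apply, ← LinearMap.comp_apply]
    congr 1
    refine LinearMap.pi_ext' fun b => LinearMap.ext_ring ?_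
    simp only [LinearMap.comp_apply, LinearMap.single_apply, h1, leftOp_revX, vecOp_single, map_add,
      apply_ite φ, map_smul, map_zero, eq_comm]
  have h3 : X q b c = φ (Pi.single b.rev 1) := by rw [h1, revX, Fin.rev_rev]
  change leftOp hq0 k p j a (leftOp hq0 k p l i _) - leftOp hq0 k p l i (leftOp hq0 k p j a _) =
    _ • leftOp hq0 k p j i (leftOp hq0 k p l a _)
  rw [h3]
  simp only [h2]
  rw [← map_sub, ← map_smul]
  congr 1
  exact LinearMap.congr_fun ((isQuantum_vecOp hq0).transpose hq0 i a j l) (Pi.single b.rev 1)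

/-- The commutation relations needed for `isQuantum_factor`. -/
theorem leftOp_mul_revX (hq0 : q ≠ 0) (i j c : Fin k) (l : Fin p) :
    leftOp hq0 k p i j * Algebra.lmul K _ (revX q c l) =
      Algebra.lmul K _ (revX q c l) * leftOp hq0 k p i j +
      if c = j then ∑ m, exch q m j • (Algebra.lmul K _ (revX q m l) * leftOp hq0 k p i m)
      else 0 := by
  refine LinearMap.ext fun r => ?_
  have h : leftOp hq0 k p i j (revX q c l * r) = revX q c l * leftOp hq0 k p i j r +
      if c = j then ∑ m, exch q m j • (revX q m l * leftOp hq0 k p i m r) else 0 := by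
    rw [leftOp_mul]
    simp only [leftOp_revX, add_mul, ite_mul, zero_mul, Finset.sum_add_distrib, Finset.sum_ite_eq,
      Finset.mem_univ, if_true]
    by_cases hc : c = j
    · subst hc
      simp
    · simp [hc, Ne.symm hc]
  refine h.trans ?_
  by_cases hc : c = j
  · simp [hc, LinearMap.sum_apply]
  · simp [hc]

theorem leftOp_of_gt (hq0 : q ≠ 0) {i j : Fin k} (h : j < i) : leftOp hq0 k p i j = 0 := by
  refine LinearMap.ext fun r => ?_
  induction r using QMat.induction generalizing i j with
  | alg r => exact (coactOp_algebraMap _ _ _ _).trans (if_neg h.ne)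
  | gen a b =>
    have h1 := leftOp_revX hq0 i j a.rev b
    rw [revX, Fin.rev_rev, if_neg h.ne, zero_add] at h1
    rw [h1]
    split_ifs with h2
    · rw [exch_of_gt q (h2 ▸ h), zero_smul, LinearMap.zero_apply]
    · rfl
  | mul a b ha hb =>
    rw [leftOp_mul]
    refine Finset.sum_eq_zero fun u _ => ?_
    rcases lt_or_ge j u with hu | hu
    · rw [ha hu, LinearMap.zero_apply, zero_mul]
    · rw [hb (hu.trans_lt h), LinearMap.zero_apply, mul_zero]
  | add a b ha hb => rw [map_add, ha h, hb h]; simp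

theorem leftOp_self (hq0 : q ≠ 0) (i : Fin k) : leftOp hq0 k p i i =
    (scale hq0 (fun a : Fin k => if a = i.rev then Units.mk0 q hq0 else 1) (1 : Fin p → Kˣ)
      ).toLinearMap := by
  refine LinearMap.ext fun r => ?_
  rw [AlgEquiv.toLinearMap_apply]
  induction r using QMat.induction with
  | alg r =>
    rw [AlgEquiv.commutes]
    exact (coactOp_algebraMap _ _ _ _).trans (if_pos rfl)
  | gen a b =>
    have h1 := leftOp_revX hq0 i i a.rev b
    rw [revX, Fin.rev_rev, if_pos rfl] at h1
    rw [h1, scale_X, Pi.one_apply, Units.val_one, mul_one]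
    by_cases h : a = i.rev
    · subst h
      rw [Fin.rev_rev, if_pos rfl, if_pos rfl, exch_self, revX, Units.val_mk0]
      module
    · rw [if_neg h, if_neg fun h' => h (by rw [h', Fin.rev_rev]), add_zero, Units.val_one, one_smul]
  | mul a b ha hb =>
    rw [leftOp_mul, Finset.sum_eq_single i, ha, hb, map_mul]
    · intro u _ hu
      rcases lt_or_gt_of_ne hu with hu | hu
      · rw [leftOp_of_gt hq0 hu, LinearMap.zero_apply, mul_zero]
      · rw [leftOp_of_gt hq0 hu, LinearMap.zero_apply, zero_mul]
    · simp
  | add a b ha hb => rw [map_add, map_add, ha, hb]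

variable {n : ℕ}

/-- The action on `QMat q k (n - k)` of the generators of `QMat q k n`. -/
def actMatrix (hq0 : q ≠ 0) (k n : ℕ) (i : Fin k) (c : Fin n) :
    Module.End K (QMat q k (n - k)) :=
  if h : (c : ℕ) < k then leftOp hq0 k (n - k) i ⟨c, h⟩
  else ∑ m, Algebra.lmul K _ (revX q m (⟨c - k, by omega⟩ : Fin (n - k))) *
    leftOp hq0 k (n - k) i m

theorem isRevQuantum_lmul_revX (hq0 : q ≠ 0) :
    IsRevQuantum q fun (c : Fin k) (l : Fin p) => Algebra.lmul K (QMat q k p) (revX q c l) := by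
  intro i a j l
  dsimp only
  rw [← map_mul, ← map_mul, ← map_sub, isRevQuantum_revX hq0, map_smul, map_mul]

theorem isQuantum_actMatrix (hq0 : q ≠ 0) : IsQuantum q (actMatrix (q := q) hq0 k n) := by
  have ha := isQuantum_leftOp (q := q) (k := k) (p := n - k) hq0
  have hS := leftOp_mul_revX (q := q) (k := k) (p := n - k) hq0
  refine IsQuantum.of_blocks (fun c => (c : ℕ) < k) (fun j l hj hl => ?_) ?_ ?_ ?_ hq0
  · exact Fin.lt_def.2 (hj.trans_le (not_lt.1 hl))
  · intro i a j l hj hl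
    simp only [actMatrix, dif_pos hj, dif_pos hl]
    rw [exch_congr (i := j) (k := l) (i' := (⟨j, hj⟩ : Fin k)) (k' := ⟨l, hl⟩) Iff.rfl
      (by simp [Fin.ext_iff])]
    exact ha i a ⟨j, hj⟩ ⟨l, hl⟩
  · intro i a j l hj hl
    simp only [actMatrix, dif_neg hj, dif_neg hl]
    have h := isQuantum_factor (a := leftOp hq0 k (n - k)) ha
      (isRevQuantum_lmul_revX (p := n - k) hq0) hS i a ⟨j - k, by omega⟩ ⟨l - k, by omega⟩
    rwa [exch_congr (i' := j) (k' := l) (by rw [Fin.lt_def, Fin.lt_def]; dsimp only; omega)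
      (by rw [Fin.ext_iff, Fin.ext_iff]; dsimp only; omega)] at h
  · intro i a j l hj hl
    simp only [actMatrix, dif_pos hj, dif_neg hl]
    exact mul_factor ha hS i ⟨j, hj⟩ a ⟨l - k, by omega⟩

/-- The action of `QMat q k n` on `QMat q k (n - k)`. Of the two factors of the other
columns, namely their quotient by the first `k` columns and the first `k` columns themselves, the
former acts by left multiplication and the latter by an upper triangular matrix of operators. -/
def act (hq0 : q ≠ 0) (k n : ℕ) : QMat q k n →ₐ[K] Module.End K (QMat q k (n - k)) :=
  lift _ (isQuantum_actMatrix hq0)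

theorem act_left (hq0 : q ≠ 0) (hkn : k ≤ n) (i j : Fin k) :
    act hq0 k n (X q i (Fin.castLE hkn j)) = leftOp hq0 k (n - k) i j := by
  rw [act, lift_X, actMatrix, dif_pos (show ((Fin.castLE hkn j : Fin n) : ℕ) < k from j.isLt)]
  rfl

theorem act_right (hq0 : q ≠ 0) (i : Fin k) (j : Fin (n - k)) :
    act hq0 k n (X q i (rightCol j)) =
      ∑ m, Algebra.lmul K _ (revX q m j) * leftOp hq0 k (n - k) i m := by
  rw [act, lift_X, actMatrix, dif_neg (by simp [rightCol])]
  simp [rightCol]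

/-- The first columns act by an upper triangular matrix with invertible diagonal entries. -/
theorem isUnit_act_firstCols (hq0 : q ≠ 0) (hkn : k ≤ n) :
    IsUnit (act hq0 k n (fullMinor q (firstCols k n))) := by
  rw [map_fullMinor_of_upper_triangular (card_firstCols hkn)]
  · have : ∀ L : List (Module.End K (QMat q k (n - k))), (∀ a ∈ L, IsUnit a) → IsUnit L.prod := by
      intro L hL
      induction L with
      | nil => simp
      | cons a L ih =>
        rw [List.prod_cons]
        exact (hL a (by simp)).mul (ih fun b hb => hL b (by simp [hb]))
    refine this _ fun a ha => ?_
    obtain ⟨i, rfl⟩ := List.mem_ofFn.1 ha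
    rw [orderEmbOfFin_firstCols hkn, act_left, leftOp_self, Module.End.isUnit_iff]
    exact AlgEquiv.bijective _
  · intro i j h
    rw [orderEmbOfFin_firstCols hkn, act_left, leftOp_of_gt hq0 h]

/-- The quotients `[genCols i j] [u]⁻¹` act by left multiplication with generators. -/
theorem act_cramerCoeff (hq0 : q ≠ 0) (hkn : k ≤ n) (c : Fin k) (j : Fin (n - k)) :
    act hq0 k n (cramerCoeff q hkn c j) =
      q • (Algebra.lmul K _ (revX q c j) * act hq0 k n (fullMinor q (firstCols k n))) := by
  set Φ := act (q := q) hq0 k n with hΦ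
  set U : QMat q k n := fullMinor q (firstCols k n) with hU
  rw [← sub_eq_zero]
  refine (isUnit_act_firstCols hq0 hkn).mul_left_eq_zero.1 (mul_firstCols_of_sum_eq_zero hq0 hkn Φ
    (fun c => Φ (cramerCoeff q hkn c j) - q • (Algebra.lmul K _ (revX q c j) * Φ U))
    (fun l => ?_) c)
  have h1 := congrArg Φ (cramer hq0 hkn l j)
  rw [firstCols_mul_X hq0 hkn, if_neg (by simp [rightCol])] at h1
  simp only [map_smul, map_sum, map_mul] at h1
  simp only [sub_mul, Finset.sum_sub_distrib]
  rw [← h1, act_right, sub_eq_zero, Finset.sum_mul, Finset.smul_sum]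
  refine Finset.sum_congr rfl fun m _ => ?_
  have h2 := congrArg Φ (firstCols_mul_X hq0 hkn l (Fin.castLE hkn m))
  rw [if_pos (show ((Fin.castLE hkn m : Fin n) : ℕ) < k from m.isLt), one_smul, map_mul, map_mul]
    at h2
  rw [smul_mul_assoc, mul_assoc, mul_assoc, h2, act_left]

end QMat

/-! ### The localization at `[u]` -/

section Coord

variable {q : K} {k n : ℕ}

/-- The Plücker coordinate `[J]` for an arbitrary set of columns; it is `0` unless `J` has `k`
elements. -/
def coord (q : K) (k : ℕ) {n : ℕ} (J : Finset (Fin n)) : grass q k n :=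
  ⟨QMat.fullMinor q J, by
    by_cases hJ : J.card = k
    · rw [QMat.fullMinor, ← maxMinor_eq q J hJ]
      exact (plucker q J hJ).2
    · rw [QMat.fullMinor, minor_eq_zero_of_card_ne]
      · exact zero_mem _
      · simpa using Ne.symm hJ⟩

theorem plucker_eq_coord (J : Finset (Fin n)) (hJ : J.card = k) : plucker q J hJ = coord q k J :=
  Subtype.ext (maxMinor_eq q J hJ)

theorem coord_eq_zero {J : Finset (Fin n)} (hJ : J.card ≠ k) : coord q k J = 0 := by
  refine Subtype.ext (minor_eq_zero_of_card_ne _ _ ?_)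
  simpa using Ne.symm hJ

theorem pluckerU_eq_coord (hkn : k ≤ n) : pluckerU q hkn = coord q k (firstCols k n) :=
  plucker_eq_coord _ _

theorem pluckerW_eq_coord (hkn : k ≤ n) : pluckerW q hkn = coord q k (lastCols k n) :=
  plucker_eq_coord _ _

theorem grass_induction {P : grass q k n → Prop} (alg : ∀ r, P (algebraMap K _ r))
    (gen : ∀ J : Finset (Fin n), J.card = k → P (coord q k J))
    (mul : ∀ a b, P a → P b → P (a * b)) (add : ∀ a b, P a → P b → P (a + b))
    (a : grass q k n) : P a := by
  obtain ⟨a, ha⟩ := a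
  induction ha using Algebra.adjoin_induction with
  | mem x hx =>
    obtain ⟨J, hJ, rfl⟩ := hx
    have := gen J hJ
    rwa [← plucker_eq_coord J hJ] at this
  | algebraMap r => exact alg r
  | add x y hx hy h1 h2 => exact add ⟨x, hx⟩ ⟨y, hy⟩ h1 h2
  | mul x y hx hy h1 h2 => exact mul ⟨x, hx⟩ ⟨y, hy⟩ h1 h2

theorem pluckerU_mul_coord (hq0 : q ≠ 0) (hkn : k ≤ n) (J : Finset (Fin n)) :
    pluckerU q hkn * coord q k J =
      q ^ (J \ firstCols k n).card • (coord q k J * pluckerU q hkn) := by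
  rw [pluckerU_eq_coord]
  exact Subtype.ext (QMat.firstCols_mul_fullMinor hq0 hkn J)

theorem pluckerW_mul_coord (hq0 : q ≠ 0) (hkn : k ≤ n) (J : Finset (Fin n)) :
    pluckerW q hkn * coord q k J =
      q⁻¹ ^ (J \ lastCols k n).card • (coord q k J * pluckerW q hkn) := by
  rw [pluckerW_eq_coord]
  exact Subtype.ext (QMat.lastCols_mul_fullMinor hq0 hkn J)

theorem grass_noZeroDivisors (hq0 : q ≠ 0) : NoZeroDivisors (grass q k n) :=
  have := QMat.noZeroDivisors hq0 k n
  inferInstance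

theorem pluckerU_ne_zero (hkn : k ≤ n) : pluckerU q hkn ≠ 0 := by
  rw [pluckerU_eq_coord]
  exact fun h => QMat.fullMinor_ne_zero (card_firstCols hkn) (congrArg Subtype.val h)

theorem pluckerW_ne_zero (hkn : k ≤ n) : pluckerW q hkn ≠ 0 := by
  rw [pluckerW_eq_coord]
  exact fun h => QMat.fullMinor_ne_zero (card_lastCols hkn) (congrArg Subtype.val h)

/-- The element `[u]` is normal. -/
theorem exists_pluckerU_mul (hq0 : q ≠ 0) (hkn : k ≤ n) (a : grass q k n) :
    ∃ b, pluckerU q hkn * a = b * pluckerU q hkn := by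
  induction a using grass_induction with
  | alg r => exact ⟨algebraMap K _ r, (Algebra.commutes _ _).symm⟩
  | gen J _ =>
    exact ⟨_, (pluckerU_mul_coord hq0 hkn J).trans (smul_mul_assoc _ _ _).symm⟩
  | mul a b ha hb =>
    obtain ⟨a', ha⟩ := ha
    obtain ⟨b', hb⟩ := hb
    exact ⟨a' * b', by rw [← mul_assoc, ha, mul_assoc, hb, mul_assoc]⟩
  | add a b ha hb =>
    obtain ⟨a', ha⟩ := ha
    obtain ⟨b', hb⟩ := hb
    exact ⟨a' + b', by rw [mul_add, ha, hb, add_mul]⟩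

/-- The powers of `[u]` form an Ore set, since `[u]` is a normal element of a domain. -/
theorem nonempty_oreSet (hq0 : q ≠ 0) (hkn : k ≤ n) :
    Nonempty (OreLocalization.OreSet (powersU q hkn)) := by
  have := grass_noZeroDivisors (k := k) (n := n) hq0
  rw [OreLocalization.nonempty_oreSet_iff_of_noZeroDivisors]
  rintro a ⟨_, m, rfl⟩
  suffices h : ∃ b, pluckerU q hkn ^ m * a = b * pluckerU q hkn ^ m by
    obtain ⟨b, hb⟩ := h
    exact ⟨b, ⟨_, m, rfl⟩, hb⟩
  induction m generalizing a with
  | zero => exact ⟨a, by simp⟩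
  | succ m ih =>
    obtain ⟨b, hb⟩ := exists_pluckerU_mul hq0 hkn a
    obtain ⟨c, hc⟩ := ih b
    exact ⟨c, by rw [pow_succ, mul_assoc, hb, ← mul_assoc, hc, mul_assoc]⟩

end Coord

/-- Dividing by a unit which commutes with all entries up to the same scalar preserves quantum
matrices. -/
theorem IsQuantum.mul_inv_unit {A : Type*} [Ring A] [Algebra K A] {q : K} (hq0 : q ≠ 0)
    {ι κ : Type*} [LinearOrder ι] [LinearOrder κ] {g : ι → κ → A} (hg : IsQuantum q g) (y : Aˣ)
    (hy : ∀ i j, (y : A) * g i j = q • (g i j * y)) :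
    IsQuantum q fun i j => g i j * (y⁻¹ : Aˣ) := by
  have h : ∀ i j p l, g i j * ((y⁻¹ : Aˣ) : A) * (g p l * (y⁻¹ : Aˣ)) =
      q⁻¹ • (g i j * g p l * (y⁻¹ : Aˣ) * (y⁻¹ : Aˣ)) := by
    intro i j p l
    have h1 : ((y⁻¹ : Aˣ) : A) * g p l = q⁻¹ • (g p l * (y⁻¹ : Aˣ)) := by
      rw [Units.inv_mul_eq_iff_eq_mul, mul_smul_comm, ← mul_assoc, hy, smul_mul_assoc, smul_smul,
        inv_mul_cancel₀ hq0, one_smul, mul_assoc, Units.mul_inv, mul_one]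
    rw [mul_assoc, ← mul_assoc _ (g p l), h1, smul_mul_assoc, mul_smul_comm]
    simp only [mul_assoc]
  intro i p j l
  simp only [h]
  rw [← smul_sub, ← sub_mul, ← sub_mul, hg, smul_mul_assoc, smul_mul_assoc, smul_comm]

section Localization

variable {q : K} {k n : ℕ} (hkn : k ≤ n) [OreLocalization.OreSet (powersU q hkn)]

theorem toLoc_injective (hq0 : q ≠ 0) : Function.Injective (toLoc q hkn) := by
  have := grass_noZeroDivisors (k := k) (n := n) hq0
  refine OreLocalization.numeratorHom_inj ?_
  rintro _ ⟨m, rfl⟩ x hx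
  exact (mul_eq_zero.1 hx).resolve_left (pow_ne_zero m (pluckerU_ne_zero hkn))

theorem coe_locY : (locY q hkn : grassLoc q hkn) = toLoc q hkn (pluckerU q hkn) := rfl

/-- The canonical map to the localization, as a homomorphism of `K`-algebras. -/
def toLocHom : grass q k n →ₐ[K] grassLoc q hkn :=
  { toLoc q hkn with commutes' := fun _ => rfl }

theorem toLocHom_apply (a : grass q k n) : toLocHom hkn a = toLoc q hkn a := rfl

theorem exists_eq_inv_mul (t : grassLoc q hkn) : ∃ (m : ℕ) (a : grass q k n),
    t = ((locY q hkn ^ (-(m : ℤ)) : (grassLoc q hkn)ˣ) : grassLoc q hkn) * toLoc q hkn a := by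
  induction t using OreLocalization.ind with
  | _ a s =>
    obtain ⟨s, m, hm⟩ := s
    refine ⟨m, a, ?_⟩
    rw [zpow_neg, zpow_natCast, Units.eq_inv_mul_iff_mul_eq, Units.val_pow_eq_pow_val, coe_locY,
      ← map_pow]
    have h := OreLocalization.mul_cancel (R := grass q k n) (r := a)
      (s := (⟨s, m, hm⟩ : powersU q hkn)) (t := 1)
    rw [show pluckerU q hkn ^ m = s from hm]
    exact h

theorem loc_hom_ext {E : Type*} [Ring E] {f g : grassLoc q hkn →+* E}
    (h : ∀ a, f (toLoc q hkn a) = g (toLoc q hkn a)) : f = g := by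
  refine RingHom.ext fun t => ?_
  obtain ⟨m, a, rfl⟩ := exists_eq_inv_mul hkn t
  have h1 : Units.map (f : grassLoc q hkn →* E) (locY q hkn) =
      Units.map (g : grassLoc q hkn →* E) (locY q hkn) := Units.ext (h _)
  have h2 := congrArg (fun u : Eˣ => ((u ^ (-(m : ℤ)) : Eˣ) : E)) h1
  simp only [← map_zpow] at h2
  rw [map_mul, map_mul, h a]
  exact congrArg (· * _) h2

/-- A homomorphism which inverts `[u]` extends to the localization. -/
def locLift {E : Type*} [Semiring E] [Algebra K E] (f : grass q k n →ₐ[K] E)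
    (hf : IsUnit (f (pluckerU q hkn))) : grassLoc q hkn →ₐ[K] E :=
  have h : ∀ s : powersU q hkn,
      IsUnit (((f : grass q k n →* E).comp (powersU q hkn).subtype) s) := by
    rintro ⟨_, m, rfl⟩
    exact (map_pow f _ m).symm ▸ hf.pow m
  { OreLocalization.universalHom f.toRingHom (IsUnit.liftRight _ h) (fun _ => rfl) with
    commutes' := fun r => (OreLocalization.universalHom_commutes ..).trans (f.commutes r) }

theorem locLift_toLoc {E : Type*} [Semiring E] [Algebra K E] (f : grass q k n →ₐ[K] E)
    (hf : IsUnit (f (pluckerU q hkn))) (a : grass q k n) :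
    locLift hkn f hf (toLoc q hkn a) = f a :=
  OreLocalization.universalHom_commutes f.toRingHom _ _

theorem locY_mul_coord (hq0 : q ≠ 0) (J : Finset (Fin n)) :
    (locY q hkn : grassLoc q hkn) * toLoc q hkn (coord q k J) =
      q ^ (J \ firstCols k n).card • (toLoc q hkn (coord q k J) * locY q hkn) := by
  simp only [coe_locY, ← toLocHom_apply, ← map_mul, ← map_smul]
  rw [pluckerU_mul_coord hq0]

theorem card_genCols_sdiff (i : Fin k) (j : Fin (n - k)) :
    (genCols hkn i j \ firstCols k n).card = 1 := by
  have h : genCols hkn i j \ firstCols k n = {rightCol j} := by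
    rw [genCols, Finset.insert_sdiff_of_notMem, Finset.sdiff_eq_empty_iff_subset.2
      (Finset.erase_subset _ _)]
    · rfl
    · simp [QMat.mem_firstCols, rightCol]
  rw [h, Finset.card_singleton]

theorem locX_eq (i : Fin k) (j : Fin (n - k)) : locX q hkn i j =
    toLoc q hkn (coord q k (genCols hkn i j)) * ((locY q hkn)⁻¹ : (grassLoc q hkn)ˣ) := by
  rw [locX, plucker_eq_coord]

theorem locX_mul_locY (i : Fin k) (j : Fin (n - k)) :
    locX q hkn i j * locY q hkn = toLoc q hkn (coord q k (genCols hkn i j)) := by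
  rw [locX_eq, mul_assoc, Units.inv_mul, mul_one]

theorem locY_mul_locX (hq0 : q ≠ 0) (i : Fin k) (j : Fin (n - k)) :
    (locY q hkn : grassLoc q hkn) * locX q hkn i j = q • (locX q hkn i j * locY q hkn) := by
  rw [locX_mul_locY, locX_eq, ← mul_assoc, locY_mul_coord hkn hq0, card_genCols_sdiff, pow_one,
    smul_mul_assoc, mul_assoc, Units.mul_inv, mul_one]

theorem isQuantum_locX (hq0 : q ≠ 0) : IsQuantum q (locX q hkn) := by
  have hG : IsQuantum q fun i j => toLoc q hkn (coord q k (genCols hkn i j)) := by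
    intro i p j l
    have := QMat.isQuantum_genCols (q := q) hq0 hkn i p j l
    have h2 : coord q k (genCols hkn p j) * coord q k (genCols hkn i l) -
        coord q k (genCols hkn i l) * coord q k (genCols hkn p j) = (exch q j l - exch q i p) •
        (coord q k (genCols hkn i j) * coord q k (genCols hkn p l)) := Subtype.ext this
    simp only [← toLocHom_apply, ← map_mul, ← map_sub, ← map_smul, h2]
  have h := hG.mul_inv_unit hq0 (locY q hkn) fun i j => by
    rw [locY_mul_coord hkn hq0, card_genCols_sdiff, pow_one]
  have h2 : locX q hkn = fun i j => toLoc q hkn (coord q k (genCols hkn i j)) *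
      ((locY q hkn)⁻¹ : (grassLoc q hkn)ˣ) := by
    funext i j
    exact locX_eq hkn i j
  rw [h2]
  exact h

/-- The homomorphism from the quantum matrices to the localization which sends the generators to the
`locX q hkn i j`; it is injective by `isSkewLaurentExtension`. -/
def matHom (hq0 : q ≠ 0) : QMat q k (n - k) →ₐ[K] grassLoc q hkn :=
  QMat.lift _ (isQuantum_locX hkn hq0)

theorem matHom_X (hq0 : q ≠ 0) (i : Fin k) (j : Fin (n - k)) :
    matHom hkn hq0 (QMat.X q i j) = locX q hkn i j := QMat.lift_X _ _ _ _

/-- The automorphism which multiplies the generators by `q`. -/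
def twist (hq0 : q ≠ 0) (k p : ℕ) : QMat q k p ≃ₐ[K] QMat q k p :=
  QMat.scale hq0 (fun _ => Units.mk0 q hq0) 1

theorem twist_X (hq0 : q ≠ 0) {k p : ℕ} (i : Fin k) (j : Fin p) :
    twist hq0 k p (QMat.X q i j) = q • QMat.X q i j := by
  rw [twist, QMat.scale_X, Units.val_mk0, Pi.one_apply, Units.val_one, mul_one]

theorem locY_mul_matHom (hq0 : q ≠ 0) (r : QMat q k (n - k)) :
    (locY q hkn : grassLoc q hkn) * matHom hkn hq0 r =
      matHom hkn hq0 (twist hq0 k (n - k) r) * locY q hkn := by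
  induction r using QMat.induction with
  | alg r => rw [AlgEquiv.commutes, AlgHom.commutes, Algebra.commutes]
  | gen i j =>
    rw [twist_X, map_smul, matHom_X, locY_mul_locX hkn hq0, smul_mul_assoc]
  | mul a b ha hb => rw [map_mul, map_mul, map_mul, ← mul_assoc, ha, mul_assoc, hb, mul_assoc]
  | add a b ha hb => rw [map_add, map_add, map_add, mul_add, ha, hb, add_mul]

theorem zpow_mul_matHom (hq0 : q ≠ 0) (s : ℤ) (r : QMat q k (n - k)) :
    ((locY q hkn ^ s : (grassLoc q hkn)ˣ) : grassLoc q hkn) * matHom hkn hq0 r =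
      matHom hkn hq0 ((twist hq0 k (n - k) ^ s) r) *
        ((locY q hkn ^ s : (grassLoc q hkn)ˣ) : grassLoc q hkn) := by
  induction s using Int.induction_on generalizing r with
  | zero => simp
  | succ s ih =>
    rw [zpow_add_one, zpow_add_one, Units.val_mul, mul_assoc, locY_mul_matHom, ← mul_assoc, ih,
      mul_assoc, AlgEquiv.mul_apply]
  | pred s ih =>
    have h : (((locY q hkn)⁻¹ : (grassLoc q hkn)ˣ) : grassLoc q hkn) * matHom hkn hq0 r =
        matHom hkn hq0 (((twist hq0 k (n - k))⁻¹ : _ ≃ₐ[K] _) r) *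
          ((locY q hkn)⁻¹ : (grassLoc q hkn)ˣ) := by
      rw [Units.inv_mul_eq_iff_eq_mul, ← mul_assoc, locY_mul_matHom, mul_assoc, Units.mul_inv,
        mul_one]
      exact congrArg _ ((AlgEquiv.apply_symm_apply _ r).symm)
    rw [zpow_sub_one, zpow_sub_one, Units.val_mul, mul_assoc, h, ← mul_assoc, ih,
      mul_assoc, AlgEquiv.mul_apply]

end Localization

/-! ### The localization is a skew Laurent extension -/

section Span

variable {q : K} {k n : ℕ}

/-- Up to scalars, `[u][J]` is the sum of the products in which the column `k + j` of `J` has been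
exchanged with a column of `u`. -/
theorem exists_exchange (hq0 : q ≠ 0) (hkn : k ≤ n) {J : Finset (Fin n)} (hJ : J.card = k)
    {j : Fin (n - k)} (hj : rightCol j ∈ J) : ∃ t : Fin k → K,
    coord q k (firstCols k n) * coord q k J =
      ∑ c, t c • (coord q k (genCols hkn c.rev j) *
        coord q k (insert (Fin.castLE hkn c) (J.erase (rightCol j)))) := by
  have h := QMat.plucker_exchange hq0 hkn j (J.erase (rightCol j)).sort
  rw [QMat.transpose_minor_cons hq0 hJ hj, mul_smul_comm] at h
  have h1 : ∀ c, ∃ s : K, minor q (fun j i => (QMat.X q i j : QMat q k n))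
      (Fin.castLE hkn c :: (J.erase (rightCol j)).sort) Finset.univ =
      s • QMat.fullMinor q (insert (Fin.castLE hkn c) (J.erase (rightCol j))) := by
    intro c
    by_cases hc : Fin.castLE hkn c ∈ J.erase (rightCol j)
    · refine ⟨0, ?_⟩
      rw [zero_smul]
      exact minor_cons_eq_zero ((QMat.isQuantum_X hq0).transpose hq0) hq0
        ((Finset.mem_sort _).2 hc) _
    · have h2 := QMat.transpose_minor_cons (q := q) hq0
        (I := insert (Fin.castLE hkn c) (J.erase (rightCol j))) (k := k) (by
          rw [Finset.card_insert_of_notMem hc, Finset.card_erase_of_mem hj, hJ]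
          have := c.isLt
          omega) (Finset.mem_insert_self _ _)
      rw [Finset.erase_insert hc] at h2
      exact ⟨_, h2⟩
  choose s hs using h1
  have he := pow_ne_zero (J.filter (· < rightCol j)).card (neg_ne_zero.2 hq0)
  refine ⟨fun c => ((-q) ^ (J.filter (· < rightCol j)).card)⁻¹ *
    (s c * (-(-q) ^ (((firstCols k n).filter (Fin.castLE hkn c < ·)).card + 1))), ?_⟩
  refine Subtype.ext ?_
  have h3 : ((∑ c, (((-q) ^ (J.filter (· < rightCol j)).card)⁻¹ *
    (s c * (-(-q) ^ (((firstCols k n).filter (Fin.castLE hkn c < ·)).card + 1)))) •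
      (coord q k (genCols hkn c.rev j) * coord q k (insert (Fin.castLE hkn c)
        (J.erase (rightCol j)))) : grass q k n) : QMat q k n) =
      ((-q) ^ (J.filter (· < rightCol j)).card)⁻¹ • ∑ c, QMat.cramerCoeff q hkn c j *
        minor q (fun j i => (QMat.X q i j : QMat q k n))
          (Fin.castLE hkn c :: (J.erase (rightCol j)).sort) Finset.univ := by
    rw [AddSubmonoidClass.coe_finsetSum, Finset.smul_sum]
    refine Finset.sum_congr rfl fun c _ => ?_
    rw [hs, QMat.cramerCoeff, smul_mul_assoc, mul_smul_comm, smul_smul, smul_smul,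
      mul_comm (s c), ← mul_assoc]
    rfl
  rw [h3, ← h, smul_smul, inv_mul_cancel₀ he, one_smul]
  rfl

variable (hkn : k ≤ n) [OreLocalization.OreSet (powersU q hkn)]

/-- Every Plücker coordinate is a quantum matrix times `y`. The columns of `J` outside `u` are
exchanged one after the other with columns of `u`. -/
theorem exists_coord_eq (hq0 : q ≠ 0) {J : Finset (Fin n)} (hJ : J.card = k) :
    ∃ r, toLoc q hkn (coord q k J) = matHom hkn hq0 r * locY q hkn := by
  obtain ⟨m, hm⟩ : ∃ m, (J \ firstCols k n).card = m := ⟨_, rfl⟩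
  induction m generalizing J with
  | zero =>
    have h : J = firstCols k n := by
      rw [Finset.card_eq_zero, Finset.sdiff_eq_empty_iff_subset] at hm
      exact Finset.eq_of_subset_of_card_le hm (by rw [hJ, card_firstCols hkn])
    refine ⟨1, ?_⟩
    rw [h, map_one, one_mul, coe_locY, pluckerU_eq_coord]
  | succ m ih =>
    obtain ⟨d, hd⟩ : ∃ d, d ∈ J \ firstCols k n := by
      rw [← Finset.Nonempty, ← Finset.card_pos]
      omega
    rw [Finset.mem_sdiff, QMat.mem_firstCols, not_lt] at hd
    obtain ⟨j, rfl⟩ : ∃ j : Fin (n - k), d = rightCol j :=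
      ⟨⟨d - k, by omega⟩, Fin.ext (by simp [rightCol]; omega)⟩
    obtain ⟨t, ht⟩ := exists_exchange hq0 hkn hJ hd.1
    have h1 : ∀ c : Fin k, ∃ r, toLoc q hkn (coord q k (insert (Fin.castLE hkn c)
        (J.erase (rightCol j)))) = matHom hkn hq0 r * locY q hkn := by
      intro c
      by_cases hc : (insert (Fin.castLE hkn c) (J.erase (rightCol j))).card = k
      · refine ih hc ?_
        have hmem : Fin.castLE hkn c ∈ firstCols k n := QMat.mem_firstCols.2 c.isLt
        rw [Finset.insert_sdiff_of_mem _ hmem, Finset.erase_sdiff_comm,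
          Finset.card_erase_of_mem, hm, Nat.add_sub_cancel]
        exact Finset.mem_sdiff.2 ⟨hd.1, fun h => (QMat.mem_firstCols.1 h).not_ge hd.2⟩
      · exact ⟨0, by rw [coord_eq_zero hc, map_zero, map_zero, zero_mul]⟩
    choose r hr using h1
    set R := ∑ c, t c • (QMat.X q c.rev j * twist hq0 k (n - k) (r c)) with hR
    have h2 : (locY q hkn : grassLoc q hkn) * toLoc q hkn (coord q k J) =
        matHom hkn hq0 R * locY q hkn * locY q hkn := by
      have h3 := congrArg (toLocHom hkn) ht
      rw [map_mul, ← pluckerU_eq_coord hkn, map_sum] at h3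
      refine h3.trans ?_
      rw [hR, map_sum, Finset.sum_mul, Finset.sum_mul]
      refine Finset.sum_congr rfl fun c _ => ?_
      rw [map_smul, map_mul, toLocHom_apply, toLocHom_apply, hr, ← locX_mul_locY, map_smul, map_mul,
        matHom_X, smul_mul_assoc, smul_mul_assoc]
      congr 1
      rw [mul_assoc, ← mul_assoc _ (matHom hkn hq0 (r c)), locY_mul_matHom]
      simp only [mul_assoc]
    -- move the factor `y` on the left of `[J]` to the right and cancel it
    refine ⟨(twist hq0 k (n - k)).symm R, ?_⟩
    rw [← Units.mul_right_inj (locY q hkn), h2, ← mul_assoc, locY_mul_matHom,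
      AlgEquiv.apply_symm_apply]

/-- The sum `∑ r_s y^s`. -/
def laurentSum (hq0 : q ≠ 0) (f : ℤ →₀ QMat q k (n - k)) : grassLoc q hkn :=
  f.sum fun s r => matHom hkn hq0 r * ((locY q hkn ^ s : (grassLoc q hkn)ˣ) : grassLoc q hkn)

theorem laurentSum_single (hq0 : q ≠ 0) (s : ℤ) (r : QMat q k (n - k)) :
    laurentSum hkn hq0 (Finsupp.single s r) = matHom hkn hq0 r *
      ((locY q hkn ^ s : (grassLoc q hkn)ˣ) : grassLoc q hkn) := by
  rw [laurentSum, Finsupp.sum_single_index]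
  rw [map_zero, zero_mul]

theorem laurentSum_add (hq0 : q ≠ 0) (f g : ℤ →₀ QMat q k (n - k)) :
    laurentSum hkn hq0 (f + g) = laurentSum hkn hq0 f + laurentSum hkn hq0 g := by
  refine Finsupp.sum_add_index' (fun s => ?_) fun s a b => ?_
  · rw [map_zero, zero_mul]
  · rw [map_add, add_mul]

theorem exists_laurentSum_mul (hq0 : q ≠ 0) (f g : ℤ →₀ QMat q k (n - k)) :
    ∃ h, laurentSum hkn hq0 f * laurentSum hkn hq0 g = laurentSum hkn hq0 h := by
  induction f using Finsupp.induction_linear with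
  | zero => exact ⟨0, by simp [laurentSum]⟩
  | add f f' hf hf' =>
    obtain ⟨h, hf⟩ := hf
    obtain ⟨h', hf'⟩ := hf'
    exact ⟨h + h', by rw [laurentSum_add, laurentSum_add, add_mul, hf, hf']⟩
  | single s r =>
    induction g using Finsupp.induction_linear with
    | zero => exact ⟨0, by simp [laurentSum]⟩
    | add g g' hg hg' =>
      obtain ⟨h, hg⟩ := hg
      obtain ⟨h', hg'⟩ := hg'
      exact ⟨h + h', by rw [laurentSum_add, laurentSum_add, mul_add, hg, hg']⟩
    | single s' r' =>
      refine ⟨Finsupp.single (s + s') (r * (twist hq0 k (n - k) ^ s) r'), ?_⟩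
      rw [laurentSum_single, laurentSum_single, laurentSum_single, mul_assoc, ← mul_assoc _
        (matHom hkn hq0 r'), zpow_mul_matHom, map_mul, zpow_add, Units.val_mul]
      simp only [mul_assoc]

theorem laurentSum_surjective (hq0 : q ≠ 0) : Function.Surjective (laurentSum hkn hq0) := by
  intro t
  obtain ⟨m, a, rfl⟩ := exists_eq_inv_mul hkn t
  have ha : ∃ f, laurentSum hkn hq0 f = toLoc q hkn a := by
    induction a using grass_induction with
    | alg r =>
      refine ⟨Finsupp.single 0 (algebraMap K _ r), ?_⟩
      rw [laurentSum_single, zpow_zero, Units.val_one, mul_one, AlgHom.commutes]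
      rfl
    | gen J hJ =>
      obtain ⟨r, hr⟩ := exists_coord_eq hkn hq0 hJ
      exact ⟨Finsupp.single 1 r, by rw [laurentSum_single, zpow_one, hr]⟩
    | mul a b ha hb =>
      obtain ⟨f, hf⟩ := ha
      obtain ⟨g, hg⟩ := hb
      obtain ⟨h, hh⟩ := exists_laurentSum_mul hkn hq0 f g
      exact ⟨h, by rw [← hh, hf, hg, map_mul]⟩
    | add a b ha hb =>
      obtain ⟨f, hf⟩ := ha
      obtain ⟨g, hg⟩ := hb
      exact ⟨f + g, by rw [laurentSum_add, hf, hg, map_add]⟩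
  obtain ⟨f, hf⟩ := ha
  obtain ⟨h, hh⟩ := exists_laurentSum_mul hkn hq0 (Finsupp.single (-(m : ℤ)) 1) f
  refine ⟨h, ?_⟩
  rw [← hh, hf, laurentSum_single, map_one, one_mul]

end Span

section Unique

variable {q : K} {k n : ℕ}

/-- The ring of Laurent polynomials, in a central variable, over the endomorphisms of
`QMat q k p`. -/
abbrev GradedEnd (q : K) (k p : ℕ) : Type _ := AddMonoidAlgebra (Module.End K (QMat q k p)) ℤ

theorem IsQuantum.single {A : Type*} [Ring A] [Algebra K A] {ι κ : Type*} [LinearOrder ι]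
    [LinearOrder κ] {x : ι → κ → A} (hx : IsQuantum q x) :
    IsQuantum q fun i c => (AddMonoidAlgebra.single 1 (x i c) : AddMonoidAlgebra A ℤ) := by
  intro i p j l
  simp only [AddMonoidAlgebra.single_mul_single, AddMonoidAlgebra.smul_single]
  rw [← hx i p j l, sub_eq_iff_eq_add, ← AddMonoidAlgebra.single_add, sub_add_cancel]

/-- The action of the quantum matrices, with a central variable that keeps track of the degree. -/
def gradedAct (hq0 : q ≠ 0) (k n : ℕ) : QMat q k n →ₐ[K] GradedEnd q k (n - k) :=
  QMat.lift _ ((QMat.isQuantum_X hq0).map (QMat.act hq0 k n)).single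

theorem gradedAct_X (hq0 : q ≠ 0) (i : Fin k) (c : Fin n) : gradedAct hq0 k n (QMat.X q i c) =
    AddMonoidAlgebra.single 1 (QMat.act hq0 k n (QMat.X q i c)) := QMat.lift_X _ _ _ _

theorem minor_single {A : Type*} [Ring A] [Algebra K A] {ι κ : Type*} [LinearOrder κ]
    (x : ι → κ → A) (rs : List ι) (J : Finset κ) :
    minor q (fun i c => (AddMonoidAlgebra.single 1 (x i c) : AddMonoidAlgebra A ℤ)) rs J =
      AddMonoidAlgebra.single (rs.length : ℤ) (minor q x rs J) := by
  induction rs generalizing J with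
  | nil =>
    rw [minor_nil, minor_nil]
    split_ifs
    · rfl
    · simp
  | cons r rs ih =>
    rw [minor_cons, minor_cons, ← AddMonoidAlgebra.singleAddHom_apply, map_sum]
    refine Finset.sum_congr rfl fun c _ => ?_
    rw [ih, AddMonoidAlgebra.single_mul_single, AddMonoidAlgebra.smul_single,
      AddMonoidAlgebra.singleAddHom_apply, List.length_cons, Nat.cast_succ, add_comm (1 : ℤ)]

theorem map_minor {A B : Type*} [Ring A] [Algebra K A] [Ring B] [Algebra K B] (f : A →ₐ[K] B)
    {ι κ : Type*} [LinearOrder κ] (x : ι → κ → A) (rs : List ι) (J : Finset κ) :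
    f (minor q x rs J) = minor q (fun i c => f (x i c)) rs J := by
  induction rs generalizing J with
  | nil => rw [minor_nil, minor_nil]; split_ifs <;> simp
  | cons r rs ih =>
    rw [minor_cons, minor_cons, map_sum]
    simp only [map_smul, map_mul, ih]

theorem gradedAct_fullMinor (hq0 : q ≠ 0) (J : Finset (Fin n)) :
    gradedAct hq0 k n (QMat.fullMinor q J) =
      AddMonoidAlgebra.single (k : ℤ) (QMat.act hq0 k n (QMat.fullMinor q J)) := by
  rw [QMat.fullMinor, map_minor (B := GradedEnd q k (n - k)) (gradedAct hq0 k n),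
    map_minor (QMat.act hq0 k n)]
  simp only [gradedAct_X]
  rw [minor_single, Finset.length_sort, Finset.card_univ, Fintype.card_fin]

/-- A homogeneous unit. -/
def singleUnit {A : Type*} [Ring A] (d : ℤ) (w : Aˣ) : (AddMonoidAlgebra A ℤ)ˣ where
  val := AddMonoidAlgebra.single d (w : A)
  inv := AddMonoidAlgebra.single (-d) ((w⁻¹ : Aˣ) : A)
  val_inv := by
    rw [AddMonoidAlgebra.single_mul_single, Units.mul_inv, add_neg_cancel]; rfl
  inv_val := by
    rw [AddMonoidAlgebra.single_mul_single, Units.inv_mul, neg_add_cancel]; rfl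

theorem singleUnit_zpow {A : Type*} [Ring A] (d : ℤ) (w : Aˣ) (s : ℤ) :
    singleUnit d w ^ s = singleUnit (d * s) (w ^ s) := by
  have hmul : ∀ (d e : ℤ) (w v : Aˣ), singleUnit d w * singleUnit e v =
      singleUnit (d + e) (w * v) := fun d e w v => Units.ext
    (AddMonoidAlgebra.single_mul_single ..)
  have hinv : ∀ (d : ℤ) (w : Aˣ), (singleUnit d w)⁻¹ = singleUnit (-d) w⁻¹ :=
    fun d w => Units.ext rfl
  induction s using Int.induction_on with
  | zero => rw [zpow_zero, zpow_zero, mul_zero]; rfl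
  | succ s ih => rw [zpow_add_one, ih, hmul, zpow_add_one, mul_add, mul_one]
  | pred s ih => rw [zpow_sub_one, ih, hinv, hmul, zpow_sub_one, mul_sub, mul_one, sub_eq_add_neg]

variable (hkn : k ≤ n)

/-- The unit by which `[u]` acts on `QMat q k (n - k)`. -/
def actUnit (hq0 : q ≠ 0) : (Module.End K (QMat q k (n - k)))ˣ :=
  (QMat.isUnit_act_firstCols (n := n) hq0 hkn).unit

/-- The graded action of the quantum grassmannian. -/
def grassAct (hq0 : q ≠ 0) : grass q k n →ₐ[K] GradedEnd q k (n - k) :=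
  (gradedAct hq0 k n).comp (grass q k n).val

theorem grassAct_pluckerU (hq0 : q ≠ 0) : grassAct hq0 (pluckerU q hkn) =
    (singleUnit (k : ℤ) (actUnit hkn hq0) : (GradedEnd q k (n - k))ˣ) := by
  refine Eq.trans ?_ (gradedAct_fullMinor hq0 (firstCols k n))
  rw [pluckerU_eq_coord]
  rfl

variable [OreLocalization.OreSet (powersU q hkn)]

/-- The graded action of the localization. -/
def locAct (hq0 : q ≠ 0) : grassLoc q hkn →ₐ[K] GradedEnd q k (n - k) :=
  locLift (E := GradedEnd q k (n - k)) hkn (grassAct hq0)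
    ((congrArg IsUnit (grassAct_pluckerU hkn hq0)).mpr (Units.isUnit _))

theorem locAct_toLoc (hq0 : q ≠ 0) (a : grass q k n) :
    locAct hkn hq0 (toLoc q hkn a) = grassAct hq0 a :=
  locLift_toLoc (E := GradedEnd q k (n - k)) hkn (grassAct hq0) _ a

theorem locAct_coord (hq0 : q ≠ 0) (J : Finset (Fin n)) :
    locAct hkn hq0 (toLoc q hkn (coord q k J)) =
      AddMonoidAlgebra.single (k : ℤ) (QMat.act hq0 k n (QMat.fullMinor q J)) :=
  (locAct_toLoc hkn hq0 _).trans (gradedAct_fullMinor hq0 J)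

theorem locAct_locY (hq0 : q ≠ 0) : locAct hkn hq0 (locY q hkn) =
    (singleUnit (k : ℤ) (actUnit hkn hq0) : (GradedEnd q k (n - k))ˣ) :=
  (locAct_toLoc hkn hq0 _).trans (grassAct_pluckerU hkn hq0)

theorem locAct_zpow (hq0 : q ≠ 0) (s : ℤ) :
    locAct hkn hq0 ((locY q hkn ^ s : (grassLoc q hkn)ˣ) : grassLoc q hkn) =
      AddMonoidAlgebra.single (k * s) ((actUnit hkn hq0 ^ s : _ˣ) : Module.End K _) := by
  have h : Units.map (locAct hkn hq0 : grassLoc q hkn →* _) (locY q hkn) =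
      singleUnit (k : ℤ) (actUnit hkn hq0) :=
    Units.ext (locAct_locY hkn hq0)
  have h2 := congrArg (fun u : (GradedEnd q k (n - k))ˣ => u ^ s) h
  rw [singleUnit_zpow, ← map_zpow] at h2
  exact congrArg Units.val h2

/-- The quantum matrices in the localization act in degree `0` by left multiplication, up to an
automorphism that rescales the rows. -/
theorem exists_locAct_matHom (hq0 : q ≠ 0) : ∃ γ : QMat q k (n - k) ≃ₐ[K] QMat q k (n - k),
    ∀ r, locAct hkn hq0 (matHom hkn hq0 r) =
      AddMonoidAlgebra.single 0 (Algebra.lmul K _ (γ r)) := by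
  set β : Fin k → K := fun i =>
    -(-q) ^ (((firstCols k n).filter (Fin.castLE hkn i.rev < ·)).card + 1) with hβ
  have hβ0 : ∀ i, β i ≠ 0 := fun i => neg_ne_zero.2 (pow_ne_zero _ (neg_ne_zero.2 hq0))
  refine ⟨QMat.scale hq0 (fun i => Units.mk0 ((β i)⁻¹ * q)
    (mul_ne_zero (inv_ne_zero (hβ0 i)) hq0)) 1, fun r => ?_⟩
  have hX : ∀ i j, locAct hkn hq0 (locX q hkn i j) =
      AddMonoidAlgebra.single 0 (Algebra.lmul K _ (((β i)⁻¹ * q) • QMat.X q i j)) := by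
    intro i j
    have h1 := congrArg (locAct hkn hq0) (locX_mul_locY hkn i j)
    rw [map_mul, locAct_coord, locAct_locY] at h1
    have h3 : QMat.fullMinor q (genCols hkn i j) =
        (β i)⁻¹ • QMat.cramerCoeff q hkn i.rev j := by
      rw [QMat.cramerCoeff, Fin.rev_rev, smul_smul, inv_mul_cancel₀ (hβ0 i), one_smul]
    rw [← Units.eq_mul_inv_iff_mul_eq, h3, map_smul, QMat.act_cramerCoeff hq0, smul_smul] at h1
    refine h1.trans ?_
    change AddMonoidAlgebra.single _ _ * AddMonoidAlgebra.single _ _ = _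
    rw [AddMonoidAlgebra.single_mul_single, add_neg_cancel, smul_mul_assoc, mul_assoc, map_smul,
      QMat.revX, Fin.rev_rev]
    congr 2
    exact (congrArg _ ((actUnit hkn hq0).mul_inv)).trans (mul_one _)
  induction r using QMat.induction with
  | alg r =>
    rw [AlgHom.commutes, AlgHom.commutes, AlgEquiv.commutes, AlgHom.commutes]
    rfl
  | gen i j => rw [matHom_X, hX, QMat.scale_X, Pi.one_apply, Units.val_one, mul_one, Units.val_mk0]
  | mul a b ha hb =>
    rw [map_mul, map_mul, ha, hb, AddMonoidAlgebra.single_mul_single, add_zero, map_mul, map_mul]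
  | add a b ha hb =>
    rw [map_add, map_add, ha, hb, ← AddMonoidAlgebra.single_add, map_add, map_add]

/-- The coefficient `r_s` is recovered from the graded action of `∑ r_s y^s`: it is determined by
the component of degree `k s`, which is the action of `r_s y^s`. -/
theorem laurentSum_injective (hq0 : q ≠ 0) (hk : 0 < k) :
    Function.Injective (laurentSum hkn hq0) := by
  obtain ⟨γ, hγ⟩ := exists_locAct_matHom hkn hq0
  set w := actUnit hkn hq0 with hw
  have key : ∀ (f : ℤ →₀ QMat q k (n - k)) (s : ℤ),
      (locAct hkn hq0 (laurentSum hkn hq0 f)).coeff ((k : ℤ) * s) =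
        Algebra.lmul K _ (γ (f s)) * ((w ^ s : _ˣ) : Module.End K _) := by
    intro f s
    induction f using Finsupp.induction_linear with
    | zero => simp [laurentSum]
    | add f g hf hg =>
      rw [laurentSum_add, map_add, AddMonoidAlgebra.coeff_add, Finsupp.add_apply, hf, hg,
        Finsupp.add_apply, map_add, map_add, add_mul]
    | single t r =>
      rw [laurentSum_single, map_mul (locAct hkn hq0), hγ, locAct_zpow,
        AddMonoidAlgebra.single_mul_single, zero_add,
        AddMonoidAlgebra.coeff_single]
      by_cases h : t = s
      · subst h
        rw [Finsupp.single_eq_same, Finsupp.single_eq_same]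
      · have h2 : (k : ℤ) * s ≠ k * t := fun h2 => h
          (mul_left_cancel₀ (by exact_mod_cast hk.ne') h2).symm
        rw [Finsupp.single_eq_of_ne h2, Finsupp.single_eq_of_ne (Ne.symm h), map_zero, map_zero,
          zero_mul]
  intro f g hfg
  ext1 s
  have h := (key f s).symm.trans (hfg ▸ key g s)
  rw [Units.mul_left_inj] at h
  have h2 := LinearMap.congr_fun h 1
  simpa using h2

theorem isSkewLaurentExtension (hq0 : q ≠ 0) (hk : 0 < k) :
    IsSkewLaurentExtension (T := grassLoc q hkn) (twist hq0 k (n - k)) (matHom hkn hq0)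
      (locY q hkn) where
  skew_comm := locY_mul_matHom hkn hq0
  bijective := ⟨laurentSum_injective hkn hq0 hk, laurentSum_surjective hkn hq0⟩

end Unique

/-! ### Weights of eigenvectors -/

/-- If the eigenvectors with eigenvalues in `S` span, there are no other eigenvalues. -/
theorem mem_of_span_eigenvectors_eq_top {V : Type*} [AddCommGroup V] [Module K V]
    (φ : Module.End K V) (S : Set K)
    (h : Submodule.span K {v | ∃ μ ∈ S, φ v = μ • v} = ⊤) {v : V} (hv : v ≠ 0) {c : K}
    (hc : φ v = c • v) : c ∈ S := by
  by_contra hcS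
  have h1 := φ.eigenspaces_iSupIndep c
  have h2 : (⨆ μ, ⨆ (_ : μ ≠ c), φ.eigenspace μ) = ⊤ := by
    rw [eq_top_iff, ← h, Submodule.span_le]
    rintro x ⟨μ, hμ, hx⟩
    have hne : μ ≠ c := fun h => hcS (h ▸ hμ)
    exact Submodule.mem_iSup_of_mem μ (Submodule.mem_iSup_of_mem hne
      (Module.End.mem_eigenspace_iff.2 hx))
  rw [h2, disjoint_top] at h1
  have h3 : v ∈ φ.eigenspace c := Module.End.mem_eigenspace_iff.2 hc
  rw [h1] at h3
  exact hv h3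

theorem pow_apply_of_apply_eq_smul {A : Type*} [Ring A] [Algebra K A] (σ : A ≃ₐ[K] A) {x : A}
    {c : K} (h : σ x = c • x) (N : ℕ) : (σ ^ N) x = c ^ N • x := by
  induction N with
  | zero => simp
  | succ N ih => rw [pow_succ, AlgEquiv.mul_apply, h, map_smul, ih, smul_smul, pow_succ']

theorem zpow_right_injective_of_pow_ne_one {q : K} (hq0 : q ≠ 0)
    (hq : ∀ m : ℕ, 0 < m → q ^ m ≠ 1) : Function.Injective fun a : ℤ => q ^ a := by
  have h : ¬ IsOfFinOrder (Units.mk0 q hq0) := by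
    rw [isOfFinOrder_iff_pow_eq_one]
    rintro ⟨m, hm, h⟩
    exact hq m hm (by simpa using congrArg Units.val h)
  intro a b hab
  refine injective_zpow_iff_not_isOfFinOrder.2 h (Units.ext ?_)
  simpa using hab

section Weights

variable {q : K} {k p : ℕ}

/-- The automorphism which multiplies by `q` the generators in the columns of `C`. -/
def colTwist (hq0 : q ≠ 0) (k : ℕ) {p : ℕ} (C : Finset (Fin p)) : QMat q k p ≃ₐ[K] QMat q k p :=
  QMat.scale hq0 1 fun j => if j ∈ C then Units.mk0 q hq0 else 1

theorem colTwist_X (hq0 : q ≠ 0) (C : Finset (Fin p)) (i : Fin k) (j : Fin p) :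
    colTwist hq0 k C (QMat.X q i j) = q ^ (if j ∈ C then 1 else 0) • QMat.X q i j := by
  rw [colTwist, QMat.scale_X, Pi.one_apply, Units.val_one, one_mul]
  split_ifs <;> simp

/-- A homogeneous element of degree `1` which is also homogeneous for the degree in the columns of
`C` has degree `0` or `1` there. -/
theorem eq_zero_or_one_of_twist_eq (hq0 : q ≠ 0) (hq : ∀ m : ℕ, 0 < m → q ^ m ≠ 1)
    (C : Finset (Fin p)) {r : QMat q k p} (hr : r ≠ 0) (h1 : twist hq0 k p r = q • r) {m : ℤ}
    (h2 : colTwist hq0 k C r = q ^ m • r) : m = 0 ∨ m = 1 := by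
  set N := m.natAbs + 1 with hN
  -- a single automorphism whose eigenvalues determine both degrees, as `N` exceeds `|m|`
  set φ := twist hq0 k p ^ N * colTwist hq0 k C with hφ
  have hφr : φ r = q ^ ((N : ℤ) + m) • r := by
    rw [hφ, AlgEquiv.mul_apply, h2, map_smul, pow_apply_of_apply_eq_smul _ h1, smul_smul,
      zpow_add₀ hq0, zpow_natCast, mul_comm]
  set S : Set K := {μ | ∃ d e : ℕ, e ≤ d ∧ μ = q ^ (N * d + e)} with hS
  have htop : Submodule.span K {v | ∃ μ ∈ S, φ.toLinearMap v = μ • v} = ⊤ := by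
    rw [eq_top_iff]
    rintro x -
    induction x using QMat.induction with
    | alg c =>
      refine Submodule.subset_span ⟨1, ⟨0, 0, le_rfl, by simp⟩, ?_⟩
      rw [one_smul]
      exact φ.commutes c
    | gen i j =>
      refine Submodule.subset_span ⟨_, ⟨1, if j ∈ C then 1 else 0, by split_ifs <;> simp, rfl⟩, ?_⟩
      change φ _ = _
      rw [hφ, AlgEquiv.mul_apply, colTwist_X, map_smul,
        pow_apply_of_apply_eq_smul _ (twist_X hq0 i j), smul_smul, mul_one, pow_add _ N, mul_comm]
    | mul a b ha hb =>
      have h := Submodule.mul_mem_mul ha hb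
      rw [Submodule.span_mul_span] at h
      refine Submodule.span_mono ?_ h
      rintro _ ⟨x, ⟨_, ⟨d, e, hde, rfl⟩, hx⟩, y, ⟨_, ⟨d', e', hde', rfl⟩, hy⟩, rfl⟩
      refine ⟨_, ⟨d + d', e + e', by omega, rfl⟩, ?_⟩
      change φ (x * y) = _
      change φ x = _ at hx
      change φ y = _ at hy
      rw [map_mul, hx, hy, smul_mul_smul_comm, ← pow_add]
      congr 2
      ring
    | add a b ha hb => exact add_mem ha hb
  obtain ⟨d, e, hde, h⟩ := mem_of_span_eigenvectors_eq_top φ.toLinearMap S htop hr hφr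
  rw [← zpow_natCast] at h
  have h3 := zpow_right_injective_of_pow_ne_one hq0 hq h
  push_cast at h3
  have hm : |m| < N := by rw [hN, Int.abs_eq_natAbs]; push_cast; omega
  rw [abs_lt] at hm
  obtain rfl | rfl | hd : d = 0 ∨ d = 1 ∨ 2 ≤ d := by omega
  · have : e = 0 := by omega
    subst this
    push_cast at h3
    omega
  · push_cast at h3
    omega
  · have h4 : (N : ℤ) * 2 ≤ N * d := by gcongr; exact_mod_cast hd
    omega

end Weights

/-! ### Extending automorphisms to the localization -/

section Rigidity

variable {q : K} {k n : ℕ} (hkn : k ≤ n)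

theorem disjoint_firstCols_lastCols (h2k : 2 * k ≤ n) :
    Disjoint (firstCols k n) (lastCols k n) := by
  rw [Finset.disjoint_left]
  intro c hc hc'
  rw [QMat.mem_firstCols] at hc
  rw [QMat.mem_lastCols] at hc'
  omega

theorem card_firstCols_sdiff_lastCols (hkn : k ≤ n) (h2k : 2 * k ≤ n) :
    (firstCols k n \ lastCols k n).card = k := by
  rw [Finset.sdiff_eq_self_of_disjoint (disjoint_firstCols_lastCols h2k), card_firstCols hkn]

/-- The columns `j` of a `k × (n - k)` matrix for which `k + j` is one of the last `k` columns of
a `k × n` matrix. -/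
def lastRightCols (k n : ℕ) : Finset (Fin (n - k)) :=
  Finset.univ.filter fun j => rightCol j ∈ lastCols k n

theorem card_genCols_sdiff_lastCols (h2k : 2 * k ≤ n) (i : Fin k) (j : Fin (n - k)) :
    (genCols hkn i j \ lastCols k n).card + (if j ∈ lastRightCols k n then 1 else 0) = k := by
  have hd : Disjoint ((firstCols k n).erase (revCol hkn i)) (lastCols k n) :=
    (disjoint_firstCols_lastCols h2k).mono_left (Finset.erase_subset _ _)
  have hc : ((firstCols k n).erase (revCol hkn i)).card = k - 1 := by
    rw [Finset.card_erase_of_mem, card_firstCols hkn]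
    exact QMat.mem_firstCols.2 i.rev.isLt
  have hi := i.isLt
  by_cases h : rightCol j ∈ lastCols k n
  · rw [if_pos (by simpa [lastRightCols] using h), genCols, Finset.insert_sdiff_of_mem _ h,
      Finset.sdiff_eq_self_of_disjoint hd, hc]
    omega
  · rw [if_neg (by simpa [lastRightCols] using h), add_zero, Finset.sdiff_eq_self_of_disjoint,
      card_genCols]
    rw [genCols, Finset.disjoint_insert_left]
    exact ⟨h, hd⟩

variable [OreLocalization.OreSet (powersU q hkn)]

theorem toLoc_pluckerW_mul_coord (hq0 : q ≠ 0) (J : Finset (Fin n)) :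
    toLoc q hkn (pluckerW q hkn) * toLoc q hkn (coord q k J) =
      q⁻¹ ^ (J \ lastCols k n).card •
        (toLoc q hkn (coord q k J) * toLoc q hkn (pluckerW q hkn)) := by
  simp only [← toLocHom_apply, ← map_mul, ← map_smul]
  rw [pluckerW_mul_coord hq0]

theorem toLoc_pluckerW_mul_locY (hq0 : q ≠ 0) (h2k : 2 * k ≤ n) :
    toLoc q hkn (pluckerW q hkn) * locY q hkn =
      q⁻¹ ^ k • ((locY q hkn : grassLoc q hkn) * toLoc q hkn (pluckerW q hkn)) := by
  rw [coe_locY, pluckerU_eq_coord, toLoc_pluckerW_mul_coord hkn hq0,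
    card_firstCols_sdiff_lastCols hkn h2k]

theorem toLoc_pluckerW_mul_zpow (hq0 : q ≠ 0) (h2k : 2 * k ≤ n) (s : ℤ) :
    toLoc q hkn (pluckerW q hkn) * ((locY q hkn ^ s : (grassLoc q hkn)ˣ) : grassLoc q hkn) =
      q ^ (-(k * s) : ℤ) • (((locY q hkn ^ s : (grassLoc q hkn)ˣ) : grassLoc q hkn) *
        toLoc q hkn (pluckerW q hkn)) := by
  have h := toLoc_pluckerW_mul_locY hkn hq0 h2k
  have hinv : toLoc q hkn (pluckerW q hkn) * ((locY q hkn)⁻¹ : (grassLoc q hkn)ˣ) =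
      q ^ k • (((locY q hkn)⁻¹ : (grassLoc q hkn)ˣ) * toLoc q hkn (pluckerW q hkn)) := by
    rw [Units.mul_inv_eq_iff_eq_mul, smul_mul_assoc, mul_assoc, h, mul_smul_comm, smul_smul,
      ← mul_pow, mul_inv_cancel₀ hq0, one_pow, one_smul, ← mul_assoc, Units.inv_mul, one_mul]
  induction s using Int.induction_on with
  | zero => simp
  | succ s ih =>
    rw [zpow_add_one, Units.val_mul, ← mul_assoc, ih, smul_mul_assoc, mul_assoc, h, mul_smul_comm,
      smul_smul, ← mul_assoc]
    congr 1
    rw [inv_pow, ← zpow_natCast, ← zpow_neg, ← zpow_add₀ hq0]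
    congr 1
    ring
  | pred s ih =>
    rw [zpow_sub_one, Units.val_mul, ← mul_assoc, ih, smul_mul_assoc, mul_assoc, hinv,
      mul_smul_comm, smul_smul, ← mul_assoc]
    congr 1
    rw [← zpow_natCast, ← zpow_add₀ hq0]
    congr 1
    ring

/-- The element `[w]` commutes with the generators up to powers of `q`; the exponent, `0` or `1`,
depends on whether the column `k + j` belongs to `w`. -/
theorem toLoc_pluckerW_mul_locX (hq0 : q ≠ 0) (h2k : 2 * k ≤ n) (i : Fin k) (j : Fin (n - k)) :
    toLoc q hkn (pluckerW q hkn) * locX q hkn i j =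
      q ^ (if j ∈ lastRightCols k n then 1 else 0) •
        (locX q hkn i j * toLoc q hkn (pluckerW q hkn)) := by
  have hinv := toLoc_pluckerW_mul_zpow hkn hq0 h2k (-1)
  rw [zpow_neg_one, mul_neg_one, neg_neg, zpow_natCast] at hinv
  rw [locX_eq, ← mul_assoc, toLoc_pluckerW_mul_coord hkn hq0, smul_mul_assoc, mul_assoc, hinv,
    mul_smul_comm, smul_smul, ← mul_assoc]
  congr 1
  have h := card_genCols_sdiff_lastCols hkn h2k i j
  generalize (genCols hkn i j \ lastCols k n).card = a at h ⊢
  generalize (if j ∈ lastRightCols k n then 1 else 0) = b at h ⊢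
  subst h
  rw [pow_add, ← mul_assoc, ← mul_pow, inv_mul_cancel₀ hq0, one_pow, one_mul]

theorem toLoc_pluckerW_mul_matHom (hq0 : q ≠ 0) (h2k : 2 * k ≤ n) (r : QMat q k (n - k)) :
    toLoc q hkn (pluckerW q hkn) * matHom hkn hq0 r =
      matHom hkn hq0 (colTwist hq0 k (lastRightCols k n) r) * toLoc q hkn (pluckerW q hkn) := by
  induction r using QMat.induction with
  | alg r => rw [AlgEquiv.commutes, AlgHom.commutes, Algebra.commutes]
  | gen i j =>
    rw [colTwist_X, map_smul, matHom_X, toLoc_pluckerW_mul_locX hkn hq0 h2k, smul_mul_assoc]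
  | mul a b ha hb => rw [map_mul, map_mul, map_mul, ← mul_assoc, ha, mul_assoc, hb, mul_assoc]
  | add a b ha hb => rw [map_add, map_add, map_add, mul_add, ha, hb, add_mul]

theorem eq_zero_of_mul_toLoc_pluckerW (hq0 : q ≠ 0) {t : grassLoc q hkn}
    (ht : t * toLoc q hkn (pluckerW q hkn) = 0) : t = 0 := by
  have := grass_noZeroDivisors (k := k) (n := n) hq0
  obtain ⟨m, a, rfl⟩ := exists_eq_inv_mul hkn t
  rw [mul_assoc, Units.mul_right_eq_zero, ← map_mul, map_eq_zero_iff _ (toLoc_injective hkn hq0),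
    mul_eq_zero] at ht
  rw [ht.resolve_right (pluckerW_ne_zero hkn), map_zero, mul_zero]

theorem laurentSum_smul (hq0 : q ≠ 0) (c : K) (f : ℤ →₀ QMat q k (n - k)) :
    laurentSum hkn hq0 (c • f) = c • laurentSum hkn hq0 f := by
  rw [laurentSum, Finsupp.sum_smul_index' (fun s => by rw [map_zero, zero_mul]), laurentSum,
    Finsupp.smul_sum]
  simp only [map_smul, smul_mul_assoc]

/-- Commutation with an element that permutes the homogeneous components up to a twist can be read
off componentwise. -/
theorem apply_eq_smul_of_mul_laurentSum (hq0 : q ≠ 0) (hk : 0 < k) (z : grassLoc q hkn)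
    (hz : ∀ t, t * z = 0 → t = 0) (g : ℤ → QMat q k (n - k) →ₗ[K] QMat q k (n - k))
    (hg : ∀ s r, z * (matHom hkn hq0 r * ((locY q hkn ^ s : (grassLoc q hkn)ˣ) : grassLoc q hkn)) =
      matHom hkn hq0 (g s r) * ((locY q hkn ^ s : (grassLoc q hkn)ˣ) : grassLoc q hkn) * z)
    {c : K} {f : ℤ →₀ QMat q k (n - k)}
    (hf : z * laurentSum hkn hq0 f = c • (laurentSum hkn hq0 f * z)) (s : ℤ) :
    g s (f s) = c • f s := by
  have h : ∀ f, ∃ f' : ℤ →₀ QMat q k (n - k), (∀ s, f' s = g s (f s)) ∧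
      z * laurentSum hkn hq0 f = laurentSum hkn hq0 f' * z := by
    intro f
    induction f using Finsupp.induction_linear with
    | zero => exact ⟨0, by simp, by simp [laurentSum]⟩
    | add f₁ f₂ h₁ h₂ =>
      obtain ⟨f₁', h₁, e₁⟩ := h₁
      obtain ⟨f₂', h₂, e₂⟩ := h₂
      refine ⟨f₁' + f₂', fun s => ?_, ?_⟩
      · rw [Finsupp.add_apply, Finsupp.add_apply, map_add, h₁, h₂]
      · rw [laurentSum_add, laurentSum_add, mul_add, add_mul, e₁, e₂]
    | single t r =>
      refine ⟨Finsupp.single t (g t r), fun s => ?_, ?_⟩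
      · by_cases hts : s = t
        · subst hts
          rw [Finsupp.single_eq_same, Finsupp.single_eq_same]
        · rw [Finsupp.single_eq_of_ne hts, Finsupp.single_eq_of_ne hts, map_zero]
      · rw [laurentSum_single, laurentSum_single, hg]
  obtain ⟨f', h1, h2⟩ := h f
  have h3 : f' = c • f := by
    refine laurentSum_injective hkn hq0 hk (sub_eq_zero.1 (hz _ ?_))
    rw [sub_mul, ← h2, hf, laurentSum_smul, smul_mul_assoc, sub_self]
  rw [← h1, h3, Finsupp.smul_apply]

/-- An element with the commutation relations of a generator lies in the copy of the quantum
matrices. For a nonzero component `r y ^ s` of such an element, `r` is homogeneous of degree `1`,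
and of degree `e + k s` in the columns `lastRightCols k n`. This degree is `0` or `1`, so `s = 0`
since `1 < k`. -/
theorem mem_range_matHom (hq0 : q ≠ 0) (hq : ∀ m : ℕ, 0 < m → q ^ m ≠ 1) (hk : 1 < k)
    (h2k : 2 * k ≤ n) {t : grassLoc q hkn}
    (hy : (locY q hkn : grassLoc q hkn) * t = q • (t * locY q hkn)) {e : ℕ} (he : e ≤ 1)
    (hw : toLoc q hkn (pluckerW q hkn) * t = q ^ e • (t * toLoc q hkn (pluckerW q hkn))) :
    t ∈ (matHom hkn hq0).range := by
  obtain ⟨f, rfl⟩ := laurentSum_surjective hkn hq0 t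
  have h1 := apply_eq_smul_of_mul_laurentSum hkn hq0 (by omega) (locY q hkn)
    (fun t ht => (Units.mul_left_eq_zero _).1 ht) (fun _ => (twist hq0 k (n - k)).toLinearMap)
    (fun s r => by
      rw [← mul_assoc, locY_mul_matHom, mul_assoc, mul_assoc, ← Units.val_mul, ← Units.val_mul,
        (Commute.refl (locY q hkn)).zpow_right s |>.eq]
      rfl) hy
  have h2 := apply_eq_smul_of_mul_laurentSum hkn hq0 (by omega) (toLoc q hkn (pluckerW q hkn))
    (fun t ht => eq_zero_of_mul_toLoc_pluckerW hkn hq0 ht)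
    (fun s => q ^ (-(k * s) : ℤ) • (colTwist hq0 k (lastRightCols k n)).toLinearMap)
    (fun s r => by
      rw [← mul_assoc, toLoc_pluckerW_mul_matHom hkn hq0 h2k, mul_assoc,
        toLoc_pluckerW_mul_zpow hkn hq0 h2k, mul_smul_comm, LinearMap.smul_apply, map_smul,
        smul_mul_assoc, smul_mul_assoc, mul_assoc]
      rfl) hw
  have h3 : ∀ s, s ≠ 0 → f s = 0 := by
    intro s hs
    by_contra hfs
    have h4 : colTwist hq0 k (lastRightCols k n) (f s) = q ^ ((e : ℤ) + k * s) • f s := by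
      have h5 := congrArg (q ^ (k * s : ℤ) • ·) (h2 s)
      simp only [LinearMap.smul_apply, smul_smul] at h5
      rw [← zpow_add₀ hq0, add_neg_cancel, zpow_zero, one_smul, ← zpow_natCast,
        ← zpow_add₀ hq0, add_comm] at h5
      exact h5
    have h5 := eq_zero_or_one_of_twist_eq hq0 hq _ hfs (h1 s) h4
    have h6 : (k : ℤ) ≤ |(k : ℤ) * s| := by
      rw [abs_mul, Nat.abs_cast]
      exact le_mul_of_one_le_right (by positivity) (Int.one_le_abs hs)
    have h7 : |(k : ℤ) * s| ≤ 1 := by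
      rw [abs_le]
      omega
    omega
  have h4 : f = Finsupp.single 0 (f 0) := by
    ext1 s
    by_cases hs : s = 0
    · rw [hs, Finsupp.single_eq_same]
    · rw [h3 s hs, Finsupp.single_eq_of_ne hs]
  rw [h4, laurentSum_single, zpow_zero, Units.val_one, mul_one]
  exact ⟨_, rfl⟩

theorem map_matHom_mem_range (hq0 : q ≠ 0) (hq : ∀ m : ℕ, 0 < m → q ^ m ≠ 1) (hk : 1 < k)
    (h2k : 2 * k ≤ n) (φ : grassLoc q hkn →ₐ[K] grassLoc q hkn)
    (hu : φ (locY q hkn) = locY q hkn)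
    (hw : φ (toLoc q hkn (pluckerW q hkn)) = toLoc q hkn (pluckerW q hkn))
    (r : QMat q k (n - k)) : φ (matHom hkn hq0 r) ∈ (matHom hkn hq0).range := by
  induction r using QMat.induction with
  | alg r =>
    rw [AlgHom.commutes, AlgHom.commutes]
    exact Subalgebra.algebraMap_mem _ r
  | gen i j =>
    rw [matHom_X]
    refine mem_range_matHom hkn hq0 hq hk h2k ?_
      (e := if j ∈ lastRightCols k n then 1 else 0) (by split_ifs <;> simp) ?_
    · have h := congrArg φ (locY_mul_locX hkn hq0 i j)
      rwa [map_mul, map_smul, map_mul, hu] at h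
    · have h := congrArg φ (toLoc_pluckerW_mul_locX hkn hq0 h2k i j)
      rwa [map_mul, map_smul, map_mul, hw] at h
  | mul a b ha hb => rw [map_mul, map_mul]; exact mul_mem ha hb
  | add a b ha hb => rw [map_add, map_add]; exact add_mem ha hb

/-- The extension to the localization of an endomorphism which fixes `[u]`. -/
def locMap (ρ : grass q k n →ₐ[K] grass q k n) (hu : ρ (pluckerU q hkn) = pluckerU q hkn) :
    grassLoc q hkn →ₐ[K] grassLoc q hkn :=
  locLift hkn ((toLocHom hkn).comp ρ) (by
    rw [AlgHom.comp_apply, hu, toLocHom_apply, ← coe_locY]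
    exact Units.isUnit _)

theorem locMap_toLoc (ρ : grass q k n →ₐ[K] grass q k n)
    (hu : ρ (pluckerU q hkn) = pluckerU q hkn) (a : grass q k n) :
    locMap hkn ρ hu (toLoc q hkn a) = toLoc q hkn (ρ a) := locLift_toLoc hkn _ _ a

theorem locMap_comp_eq_id {ρ ρ' : grass q k n →ₐ[K] grass q k n}
    (hu : ρ (pluckerU q hkn) = pluckerU q hkn) (hu' : ρ' (pluckerU q hkn) = pluckerU q hkn)
    (h : ∀ a, ρ (ρ' a) = a) : (locMap hkn ρ hu).comp (locMap hkn ρ' hu') = AlgHom.id K _ := by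
  have h1 : ((locMap hkn ρ hu).comp (locMap hkn ρ' hu')).toRingHom = RingHom.id _ := by
    refine loc_hom_ext hkn fun a => ?_
    change locMap hkn ρ hu (locMap hkn ρ' hu' (toLoc q hkn a)) = toLoc q hkn a
    rw [locMap_toLoc, locMap_toLoc, h]
  exact AlgHom.ext fun t => RingHom.congr_fun h1 t

/-- The extension to the localization of an automorphism which fixes `[u]`. -/
def locEquiv (ρ : grass q k n ≃ₐ[K] grass q k n) (hu : ρ (pluckerU q hkn) = pluckerU q hkn) :
    grassLoc q hkn ≃ₐ[K] grassLoc q hkn :=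
  AlgEquiv.ofAlgHom (locMap hkn (ρ : grass q k n →ₐ[K] grass q k n) hu)
    (locMap hkn (ρ.symm : grass q k n →ₐ[K] grass q k n) ((AlgEquiv.symm_apply_eq ρ).2 hu.symm))
    (locMap_comp_eq_id hkn _ _ ρ.apply_symm_apply)
    (locMap_comp_eq_id hkn _ _ ρ.symm_apply_apply)

theorem locEquiv_toLoc (ρ : grass q k n ≃ₐ[K] grass q k n)
    (hu : ρ (pluckerU q hkn) = pluckerU q hkn) (a : grass q k n) :
    locEquiv hkn ρ hu (toLoc q hkn a) = toLoc q hkn (ρ a) := locMap_toLoc hkn _ hu a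

theorem locEquiv_symm_toLoc (ρ : grass q k n ≃ₐ[K] grass q k n)
    (hu : ρ (pluckerU q hkn) = pluckerU q hkn) (a : grass q k n) :
    (locEquiv hkn ρ hu).symm (toLoc q hkn a) = toLoc q hkn (ρ.symm a) :=
  locMap_toLoc hkn (ρ.symm : grass q k n →ₐ[K] grass q k n) ((AlgEquiv.symm_apply_eq ρ).2 hu.symm) a

theorem map_range_matHom (hq0 : q ≠ 0) (hq : ∀ m : ℕ, 0 < m → q ^ m ≠ 1) (hk : 1 < k)
    (h2k : 2 * k ≤ n) (ρ : grass q k n ≃ₐ[K] grass q k n)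
    (hu : ρ (pluckerU q hkn) = pluckerU q hkn) (hw : ρ (pluckerW q hkn) = pluckerW q hkn) :
    (matHom hkn hq0).range.map
      (locEquiv hkn ρ hu : grassLoc q hkn →ₐ[K] grassLoc q hkn) = (matHom hkn hq0).range := by
  have hu' : ρ.symm (pluckerU q hkn) = pluckerU q hkn := (AlgEquiv.symm_apply_eq ρ).2 hu.symm
  have hw' : ρ.symm (pluckerW q hkn) = pluckerW q hkn := (AlgEquiv.symm_apply_eq ρ).2 hw.symm
  refine le_antisymm ?_ ?_
  · rintro _ ⟨_, ⟨r, rfl⟩, rfl⟩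
    refine map_matHom_mem_range hkn hq0 hq hk h2k
      (locEquiv hkn ρ hu : grassLoc q hkn →ₐ[K] grassLoc q hkn) ?_ ?_ r
    · exact (locEquiv_toLoc hkn ρ hu _).trans (congrArg _ hu)
    · exact (locEquiv_toLoc hkn ρ hu _).trans (congrArg _ hw)
  · rintro _ ⟨r, rfl⟩
    refine ⟨(locEquiv hkn ρ hu).symm (matHom hkn hq0 r), ?_,
      (locEquiv hkn ρ hu).apply_symm_apply _⟩
    refine map_matHom_mem_range hkn hq0 hq hk h2k
      ((locEquiv hkn ρ hu).symm : grassLoc q hkn →ₐ[K] grassLoc q hkn) ?_ ?_ r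
    · exact (locEquiv_symm_toLoc hkn ρ hu _).trans (congrArg _ hu')
    · exact (locEquiv_symm_toLoc hkn ρ hu _).trans (congrArg _ hw')

end Rigidity

end QGrass

end

theorem theorem6p5 {K : Type*} [Field K] (q : K) (hq0 : q ≠ 0)
    (hq : ∀ m : ℕ, 0 < m → q ^ m ≠ 1) (k n : ℕ) (hk : 1 < k) (h2k : 2 * k ≤ n) (hkn : k ≤ n)
    (ρ : QGrass.grass q k n ≃ₐ[K] QGrass.grass q k n)
    (hu : ρ (QGrass.pluckerU q hkn) = QGrass.pluckerU q hkn)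
    (hw : ρ (QGrass.pluckerW q hkn) = QGrass.pluckerW q hkn) :
    ∃ _ : OreLocalization.OreSet (QGrass.powersU q hkn),
      Function.Injective (QGrass.toLoc q hkn) ∧
      ∃ (σ : QGrass.QMat q k (n - k) ≃ₐ[K] QGrass.QMat q k (n - k))
        (j : QGrass.QMat q k (n - k) →ₐ[K] QGrass.grassLoc q hkn),
        (∀ a b, σ (QGrass.QMat.X q a b) = q • QGrass.QMat.X q a b) ∧
        (∀ a b, j (QGrass.QMat.X q a b) = QGrass.locX q hkn a b) ∧
        QGrass.IsSkewLaurentExtension (T := QGrass.grassLoc q hkn) σ j (QGrass.locY q hkn) ∧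
        ∃ ρT : QGrass.grassLoc q hkn ≃ₐ[K] QGrass.grassLoc q hkn,
          (∀ a, ρT (QGrass.toLoc q hkn a) = QGrass.toLoc q hkn (ρ a)) ∧
          (∀ ρ' : QGrass.grassLoc q hkn ≃ₐ[K] QGrass.grassLoc q hkn,
            (∀ a, ρ' (QGrass.toLoc q hkn a) = QGrass.toLoc q hkn (ρ a)) → ρ' = ρT) ∧
          ρT (QGrass.locY q hkn : QGrass.grassLoc q hkn) = QGrass.locY q hkn ∧
          j.range.map (ρT : QGrass.grassLoc q hkn →ₐ[K] QGrass.grassLoc q hkn) = j.range := by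
  obtain ⟨hOre⟩ := QGrass.nonempty_oreSet (k := k) (n := n) hq0 hkn
  refine ⟨hOre, QGrass.toLoc_injective hkn hq0, QGrass.twist hq0 k (n - k),
    QGrass.matHom hkn hq0, QGrass.twist_X hq0, QGrass.matHom_X hkn hq0,
    QGrass.isSkewLaurentExtension hkn hq0 (by omega), QGrass.locEquiv hkn ρ hu,
    QGrass.locEquiv_toLoc hkn ρ hu, fun ρ' h => ?_, ?_,
    QGrass.map_range_matHom hkn hq0 hq hk h2k ρ hu hw⟩
  · have h1 : (ρ' : QGrass.grassLoc q hkn →+* QGrass.grassLoc q hkn) =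
        QGrass.locEquiv hkn ρ hu :=
      QGrass.loc_hom_ext hkn fun a => (h a).trans (QGrass.locEquiv_toLoc hkn ρ hu a).symm
    exact AlgEquiv.ext fun t => RingHom.congr_fun h1 t
  · exact (QGrass.locEquiv_toLoc hkn ρ hu _).trans (congrArg _ hu)
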